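/- For a prime $q$ and $1\le n\le q$, the $(q,n,q-n+1)_q$ (normalized) generalized Reed--Solomon code encodes a message $x=(x_1,\dots,x_n)\in\mathbb{F}_q^n$ as the word $\mathrm{GRS}_x:\mathbb{F}_q\to\mathbb{F}_q$, $\mathrm{GRS}_x(r)=\sum_{i=1}^n x_i r^{i-1}$. Elements of $\mathbb{F}_q=\{0,\dots,q-1\}$ are written in binary. A quantumly corrupted codeword is a unitary operator $\tilde O$ on three registers, of $\lceil\log_2 q\rceil$, $l$ and $m$ qubits (with $2^l\ge q$), such that for all $r\in\mathbb{F}_q$, $s\in\{0,1\}^l$, $t\in\{0,1\}^m$ $$\tilde O|r\rangle|s\rangle|t\rangle=\sum_{z\in\{0,1\}^l}\alpha_{r,z}\,|r\rangle|s\oplus z\rangle\sum_{w\in\{0,1\}^m}\langle w|\phi_{r,z}\rangle|t\oplus w\rangle$$ with complex numbers $\alpha_{r,z}$ and unit vectors $|\phi_{r,z}\rangle$. The presence of $\mathrm{GRS}_x$ in $\tilde O$ is $\mathrm{Pre}_{\tilde O}(\mathrm{GRS}_x)=\frac1q\sum_{r\in\mathbb{F}_q}|\alpha_{r,\mathrm{GRS}_x(r)}|^2$.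 A quantum list decoder with bias $\varepsilon$ and confidence $\delta$ is a quantum algorithm that, for every quantumly corrupted codeword $\tilde O$ given as an oracle, outputs with probability at least $\delta$ a list of messages including all $x$ with $\mathrm{Pre}_{\tilde O}(\mathrm{GRS}_x)\ge \frac1q+\varepsilon$. There are a quantum oracle algorithm (a program for a classical random access machine that controls a quantum memory by elementary gates, oracle queries and measurements) and a polynomial $P$ with the following property. Let $n\in\mathbb{N}$, let $q$ be a prime, and let $\varepsilon,\varepsilon',\delta\in(0,1)$ satisfy $2\le n\le q$, $n-2\le q\varepsilon'\le q-1$, and $$\varepsilon'+\Bigl(1-\frac1q-\varepsilon'\Bigr)\sqrt{\frac{n-1}{1+q\varepsilon'}}<\varepsilon\le 1-\frac1q .$$ Then the algorithm, on input $n$, $q$ and the values $1/\varepsilon$, $1/\delta$, $1/(1-\delta)$ rounded up to integers, is a quantum list decoder for the $(q,n,q-n+1)_q$ generalized Reed--Solomon code with bias $\varepsilon$ and confidence $\delta$, and it always halts within $P\bigl(n,q,\frac1\delta,\frac1{1-\delta}\bigr)$ steps. -/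

import Mathlib

/-! ## Codes, quantumly corrupted codewords, presence -/

/-- Bit strings of length `k`. -/
abbrev Bits (k : ℕ) : Type := Fin k → Bool

/-- The `k`-bit binary representation of a natural number, least significant bit first. -/
def toBits (k a : ℕ) : Bits k := fun i => a.testBit i

/-- Bitwise XOR. -/
def bxor {k : ℕ} (s t : Bits k) : Bits k := fun i => Bool.xor (s i) (t i)

/-- The code `GRS^{(q,n,q)}` over `𝔽_q`, every element of `𝔽_q` being a code locator: the message
`(x_1, …, x_n)` is mapped to `r ↦ ∑ x_i r^(i-1)`. -/
def GRS (q n : ℕ) (x : Fin n → ZMod q) (r : ZMod q) : ZMod q := ∑ i : Fin n, x i * r ^ (i : ℕ)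

/-- Computational basis of the three registers `|r⟩|s⟩|t⟩` on which an oracle for words in
`(𝔽_q)^q` acts; an index takes `⌈log₂ q⌉` bits. -/
abbrev Block (q l m : ℕ) : Type := Bits (Nat.clog 2 q) × Bits l × Bits m

/-- The basis vector `|v⟩`. -/
def ket {q l m : ℕ} (v : Block q l m) : Block q l m → ℂ := Pi.single v 1

/-- A quantumly corrupted codeword with block length `q` and code alphabet `𝔽_q`: a unitary
operator with `O|r⟩|s⟩|t⟩ = ∑_z α_{r,z} |r⟩|s ⊕ z⟩|t ⊕ φ_{r,z}⟩`, where `φ_{r,z}` is a unit vector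
and `|t ⊕ φ⟩ = ∑_w ⟨w|φ⟩ |t ⊕ w⟩`. The sum is over all `l`-bit strings `z`. If `q` is not a power
of two, nothing is required on the strings `r` that do not represent an index. -/
structure CorruptedCodeword (q l m : ℕ) where
  U : Matrix.unitaryGroup (Block q l m) ℂ
  α : ZMod q → Bits l → ℂ
  φ : ZMod q → Bits l → Bits m → ℂ
  φ_unit : ∀ r z, ∑ w, ‖φ r z w‖ ^ 2 = 1
  apply_ket : ∀ (r : ZMod q) (s : Bits l) (t : Bits m),
    (U : Matrix (Block q l m) (Block q l m) ℂ).mulVec (ket (toBits _ r.val, s, t)) =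
      ∑ z, ∑ w, (α r z * φ r z w) • ket (toBits _ r.val, bxor s z, bxor t w)

/-- The presence of the word `c` in `O`: the average over all indices `r` of the probability
`|α_{r,c(r)}|²`. -/
noncomputable def presence {q l m : ℕ} [NeZero q] (O : CorruptedCodeword q l m)
    (c : ZMod q → ZMod q) : ℝ :=
  (1 / (q : ℝ)) * ∑ r : ZMod q, ‖O.α r (toBits l (c r).val)‖ ^ 2

/-! ## Quantum random access machines with an oracle

A classical random access machine controls a quantum memory: it applies elementary gates, queries
the oracle, and measures qubits, one at a time, and may use the results. -/

/-- Kinds of qubits: work qubits and the three registers to which the oracle is applied. -/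
inductive Reg
  | work
  | index
  | answer
  | garbage
deriving DecidableEq

/-- A qubit: kind, block number, position in the block. There are infinitely many blocks; the
oracle may be applied to the registers of any of them. -/
abbrev Qubit : Type := Reg × ℕ × ℕ

/-- Computational basis states of the quantum memory. -/
abbrev QBasis : Type := Qubit → Bool

/-- Pure states of the quantum memory: finite superpositions of basis states. They are kept
unnormalised: the squared norm is the probability of the measurement results so far. -/
abbrev QState : Type := QBasis →₀ ℂ

/-- Squared norm. -/
noncomputable def QState.normSq (ψ : QState) : ℝ := ψ.sum fun _ a => ‖a‖ ^ 2

/-- Elementary one-qubit gates. Together with the controlled not they are universal. -/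
inductive Gate
  | X
  | H
  | T

/-- `g.mat v u` is the amplitude `⟨v|g|u⟩`. -/
noncomputable def Gate.mat : Gate → Bool → Bool → ℂ
  | .X, v, u => if v = u then 0 else 1
  | .H, v, u => (if v && u then -1 else 1) / (Real.sqrt 2 : ℂ)
  | .T, v, u => if v = u then (if u then Complex.exp (Complex.I * Real.pi / 4) else 1) else 0

/-- Application of the gate `g` to the qubit `a`. -/
noncomputable def QState.gate (g : Gate) (a : Qubit) (ψ : QState) : QState :=
  ψ.sum fun b c => ∑ v : Bool, Finsupp.single (Function.update b a v) (g.mat v (b a) * c)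

/-- Controlled not with control `a` and target `a'`; no effect if these coincide. -/
noncomputable def QState.cnot (a a' : Qubit) (ψ : QState) : QState :=
  ψ.sum fun b c =>
    Finsupp.single (if a ≠ a' ∧ b a = true then Function.update b a' (!b a') else b) c

/-- The contents of the oracle registers of block `j`. -/
def QBasis.read {q l m : ℕ} (b : QBasis) (j : ℕ) : Block q l m :=
  (fun i => b (.index, j, i), fun i => b (.answer, j, i), fun i => b (.garbage, j, i))

/-- Replacement of the contents of the oracle registers of block `j`. -/
def QBasis.write {q l m : ℕ} (b : QBasis) (j : ℕ) (v : Block q l m) : QBasis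
  | (.work, j', i) => b (.work, j', i)
  | (.index, j', i) =>
      if h : j' = j ∧ i < Nat.clog 2 q then v.1 ⟨i, h.2⟩ else b (.index, j', i)
  | (.answer, j', i) => if h : j' = j ∧ i < l then v.2.1 ⟨i, h.2⟩ else b (.answer, j', i)
  | (.garbage, j', i) => if h : j' = j ∧ i < m then v.2.2 ⟨i, h.2⟩ else b (.garbage, j', i)

/-- Application of the oracle to the registers of block `j`. -/
noncomputable def QState.query {q l m : ℕ} (U : Matrix (Block q l m) (Block q l m) ℂ) (j : ℕ)
    (ψ : QState) : QState :=
  ψ.sum fun b c => ∑ v : Block q l m, Finsupp.single (b.write j v) (U v (b.read j) * c)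

/-- Projection onto the subspace where the qubit `a` has the value `v`. -/
noncomputable def QState.project (a : Qubit) (v : Bool) (ψ : QState) : QState :=
  ψ.filter fun b => b a = v

/-- Arithmetic expressions over the variables `var x` and the memory cells `load e`; `sub` is
truncated subtraction, `div` and `mod` are those of `ℕ`, `lt` and `eq` have the values 0 and 1. -/
inductive Expr
  | const (k : ℕ)
  | var (x : ℕ)
  | load (e : Expr)
  | add (e f : Expr)
  | sub (e f : Expr)
  | mul (e f : Expr)
  | div (e f : Expr)
  | mod (e f : Expr)
  | lt (e f : Expr)
  | eq (e f : Expr)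

/-- State of the machine: variables, memory, output tape, quantum memory. -/
structure MState where
  vars : ℕ → ℕ
  mem : ℕ → ℕ
  out : List ℕ
  psi : QState

/-- Value of an expression. -/
def Expr.eval (s : MState) : Expr → ℕ
  | .const k => k
  | .var x => s.vars x
  | .load e => s.mem (e.eval s)
  | .add e f => e.eval s + f.eval s
  | .sub e f => e.eval s - f.eval s
  | .mul e f => e.eval s * f.eval s
  | .div e f => e.eval s / f.eval s
  | .mod e f => e.eval s % f.eval s
  | .lt e f => if e.eval s < f.eval s then 1 else 0
  | .eq e f => if e.eval s = f.eval s then 1 else 0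

/-- Time to evaluate an expression. Every operation takes one step, except for a multiplication,
which is charged in addition the binary lengths of its operands. So the binary length of the
numbers in the machine grows by at most the time spent, and the machine is polynomially equivalent
to a Turing machine. -/
def Expr.time (s : MState) : Expr → ℕ
  | .const _ => 1
  | .var _ => 1
  | .load e => 1 + e.time s
  | .add e f => 1 + e.time s + f.time s
  | .sub e f => 1 + e.time s + f.time s
  | .mul e f => 1 + e.time s + f.time s + Nat.size (e.eval s) + Nat.size (f.eval s)
  | .div e f => 1 + e.time s + f.time s
  | .mod e f => 1 + e.time s + f.time s
  | .lt e f => 1 + e.time s + f.time s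
  | .eq e f => 1 + e.time s + f.time s

/-- A reference to a qubit, with computed block number and position. -/
structure QRef where
  reg : Reg
  block : Expr
  pos : Expr

/-- The qubit referred to. -/
def QRef.eval (s : MState) (a : QRef) : Qubit := (a.reg, a.block.eval s, a.pos.eval s)

/-- Time to compute the address of the qubit. -/
def QRef.time (s : MState) (a : QRef) : ℕ := a.block.time s + a.pos.time s

/-- Programs. -/
inductive Program
  | skip
  /-- assign the value of `e` to the variable `x` -/
  | assign (x : ℕ) (e : Expr)
  /-- write the value of `f` into the memory cell with address `e` -/
  | store (e f : Expr)
  /-- append the value of `e` to the output tape -/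
  | emit (e : Expr)
  | seq (c d : Program)
  /-- `c` if the value of `e` is not 0, and `d` otherwise -/
  | ite (e : Expr) (c d : Program)
  /-- repeat `c` as long as the value of `e` is not 0 -/
  | loop (e : Expr) (c : Program)
  | gate (g : Gate) (a : QRef)
  | cnot (a a' : QRef)
  /-- apply the oracle to the registers of the block with number `e` -/
  | query (e : Expr)
  /-- measure the qubit `a` in the computational basis, with result 0 or 1 assigned to `x` -/
  | measure (x : ℕ) (a : QRef)

/-- The state after the measurement of `a` with result `v`, put into the variable `x`. -/
noncomputable def MState.measured (s : MState) (x : ℕ) (a : QRef) (v : Bool) : MState :=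
  { s with
    vars := Function.update s.vars x v.toNat
    psi := s.psi.project (a.eval s) v }

/-- `Exec U c s L`: with the oracle `U`, the program `c` started in the state `s` halts whatever
the results of the measurements are, and `L` lists, over all sequences of results, the final state
together with the number of steps made. -/
inductive Exec {q l m : ℕ} (U : Matrix (Block q l m) (Block q l m) ℂ) :
    Program → MState → List (MState × ℕ) → Prop
  | skip (s : MState) : Exec U .skip s [(s, 1)]
  | assign (x : ℕ) (e : Expr) (s : MState) :
      Exec U (.assign x e) s
        [({ s with vars := Function.update s.vars x (e.eval s) }, 1 + e.time s)]
  | store (e f : Expr) (s : MState) :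
      Exec U (.store e f) s
        [({ s with mem := Function.update s.mem (e.eval s) (f.eval s) },
          1 + e.time s + f.time s)]
  | emit (e : Expr) (s : MState) :
      Exec U (.emit e) s [({ s with out := s.out ++ [e.eval s] }, 1 + e.time s)]
  | seq {c d : Program} {s : MState} {L : List (MState × ℕ)} (K : MState → List (MState × ℕ)) :
      Exec U c s L → (∀ p ∈ L, Exec U d p.1 (K p.1)) →
      Exec U (.seq c d) s (L.flatMap fun p => (K p.1).map fun p' => (p'.1, p.2 + p'.2))
  | ite_true {e : Expr} {c d : Program} {s : MState} {L : List (MState × ℕ)} :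
      e.eval s ≠ 0 → Exec U c s L →
      Exec U (.ite e c d) s (L.map fun p => (p.1, 1 + e.time s + p.2))
  | ite_false {e : Expr} {c d : Program} {s : MState} {L : List (MState × ℕ)} :
      e.eval s = 0 → Exec U d s L →
      Exec U (.ite e c d) s (L.map fun p => (p.1, 1 + e.time s + p.2))
  | loop_stop {e : Expr} {c : Program} {s : MState} :
      e.eval s = 0 → Exec U (.loop e c) s [(s, 1 + e.time s)]
  | loop_step {e : Expr} {c : Program} {s : MState} {L : List (MState × ℕ)} :
      e.eval s ≠ 0 → Exec U (.seq c (.loop e c)) s L →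
      Exec U (.loop e c) s (L.map fun p => (p.1, 1 + e.time s + p.2))
  | gate (g : Gate) (a : QRef) (s : MState) :
      Exec U (.gate g a) s [({ s with psi := s.psi.gate g (a.eval s) }, 1 + a.time s)]
  | cnot (a a' : QRef) (s : MState) :
      Exec U (.cnot a a') s
        [({ s with psi := s.psi.cnot (a.eval s) (a'.eval s) }, 1 + a.time s + a'.time s)]
  | query (e : Expr) (s : MState) :
      Exec U (.query e) s [({ s with psi := s.psi.query U (e.eval s) }, 1 + e.time s)]
  | measure (x : ℕ) (a : QRef) (s : MState) :
      Exec U (.measure x a) s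
        [(s.measured x a false, 1 + a.time s), (s.measured x a true, 1 + a.time s)]

/-- The initial state on the input `w`: the variables `0, 1, …` contain `w`, all the rest of the
classical memory is zero, the output tape is empty, and all qubits are `|0⟩`. -/
noncomputable def initState (w : List ℕ) : MState where
  vars := fun x => w.getD x 0
  mem := fun _ => 0
  out := []
  psi := Finsupp.single (fun _ => false) 1

open Classical in
/-- The probability that the output tape finally satisfies `P`, for the list of the final states
over all sequences of measurement results. -/
noncomputable def outputProb (L : List (MState × ℕ)) (P : List ℕ → Prop) : ℝ :=
  (L.map fun p => if P p.1.out then p.1.psi.normSq else 0).sum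

/-! ## Quantum list decoding -/

/-- `out` is a list of messages, each written as its `n` symbols in `{0, …, q-1}`, that includes
all messages `x` whose codeword has presence at least `1/q + ε` in `O`. -/
def IsValidList {q n l m : ℕ} [NeZero q] (C : (Fin n → ZMod q) → ZMod q → ZMod q) (ε : ℝ)
    (O : CorruptedCodeword q l m) (out : List ℕ) : Prop :=
  ∃ xs : List (Fin n → ZMod q),
    out = xs.flatMap (fun x => List.ofFn fun i => (x i).val) ∧
    ∀ x, 1 / (q : ℝ) + ε ≤ presence O (C x) → x ∈ xs

/-- The program `A`, on input `n`, `q` and the values `1/ε`, `1/δ`, `1/(1-δ)` rounded up to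
integers, is a quantum list decoder for the code `C` with bias `ε` and confidence `δ` that runs in
time at most `τ`: for every quantumly corrupted codeword as its oracle, it halts after at most `τ`
steps and outputs a valid list with probability at least `δ`. -/
def IsQuantumListDecoder {q n : ℕ} [NeZero q] (A : Program)
    (C : (Fin n → ZMod q) → ZMod q → ZMod q) (ε δ τ : ℝ) : Prop :=
  ∀ (l m : ℕ), q ≤ 2 ^ l → ∀ O : CorruptedCodeword q l m,
    ∃ L : List (MState × ℕ),
      Exec (O.U : Matrix (Block q l m) (Block q l m) ℂ) A
        (initState [n, q, ⌈1 / ε⌉₊, ⌈1 / δ⌉₊, ⌈1 / (1 - δ)⌉₊]) L ∧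
      (∀ p ∈ L, (p.2 : ℝ) ≤ τ) ∧
      δ ≤ outputProb L (IsValidList C ε O)

/-! The oracle is used only as a source of classical samples. If it is applied to a basis state with
index `r` and zeros elsewhere, and the answer bits are measured, then `z` appears with probability
`|α_{r,z}|²`, since the garbage vectors are unit vectors (`wsum_query`, `sum_oracle`). Only the
lowest `⌈log₂ q⌉` answer bits are kept, which can only increase the probability of a symbol
(`le_answerProb`). Presence at least `1/q + ε` thus says that the probabilities of the codeword
symbols, summed over all `r`, are at least `1 + qε`.

Put `C = ⌈1/(1-δ)⌉` and `M = 256 q² C`. Each index is queried `M` times, on a fresh block every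
time, and `μ(r,z)` counts the answers. The expected squared distance of `μ` from its mean is at most
the number `qM` of samples, because one answer adds at most 1 on average (`row_deviation_le`,
`outs_samples`). By Markov's inequality it is below `qMC` with probability at least `1 - 1/C ≥ δ`.
Cauchy–Schwarz then shows that the agreement `∑_r μ(r, c(r))` of a word `c` falls short of its mean
by less than `M/16`.

The counts serve as multiplicities in algebraic soft-decision decoding. For a degree bound `D`, a
nonzero polynomial `N(X,Y)` of `(1,n-1)`-weighted degree below `D` is sought that vanishes at every
`(r,z)` to order `μ(r,z)`. There are at least `D(D+1)/(2(n-1))` monomials and `∑ μ(μ+1)/2` linear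
conditions, so `N` exists as soon as `(n-1) ∑ μ(μ+1) < D(D+1)` (`run_interpolateCmd`). If `f` is a
message polynomial with agreement at least `D`, then `N(X, f(X))` has at least `D` zeros and degree
below `D`, so it vanishes (`subst_eq_zero`). All such `f` lie in a search tree: its nodes are the
prefixes of coefficient sequences, and a step replaces `N(X,Y)` by `N(X, XY+b)` for a root `b` of
the coefficient of the lowest power of `X`. A degree count bounds every level by `D` nodes
(`length_level_le`). All values of `D` up to the number of samples are tried, so a message with
agreement `A` is caught at `D = A` if `(n-1) ∑ μ(μ+1) < A(A+1)`.

What remains is that large presence forces this inequality. The hypothesis on `ε` and `ε'` implies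
`√((n-1)q) + 1/8 ≤ 1 + qε` (`radius_gap`); the constant margin comes from `n ≤ q` being integers, so
the sample size need not depend on `ε`. Half of the margin absorbs the sampling noise, and the rest
beats the lower-order terms (`agreement_large`).

The program is written in a small language of bounded loops whose assignments are reduced modulo `q`
or modulo a number `B`, a fixed power of a bound for the relevant inputs. All numbers then stay at
most `B`, and the running time is a polynomial in `B` read off from the syntax (`reaches_outs`).
Correctness is proved for the list of outcomes `outs`, or for the function `run` where no
measurement occurs. -/

namespace ListDecoder

open Polynomial

/-! ## A structured language on top of random access machine programs -/

/-- An injective polynomial pairing function. -/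
def pr (x y : ℕ) : ℕ := (x + y) * (x + y) + x

/-- The value lies between `(x + y)²` and `(x + y + 1)²`, the latter excluded, and so determines `x
+ y`. -/
theorem pr_injective {x y x' y' : ℕ} (h : pr x y = pr x' y') : x = x' ∧ y = y' := by
  unfold pr at h
  have hs : x + y = x' + y' := by
    rcases lt_trichotomy (x + y) (x' + y') with hlt | heq | hlt
    · exfalso; nlinarith
    · exact heq
    · exfalso; nlinarith
  rw [hs] at h
  omega

/-- Address of the cell with indices `a b c d` of the array `k < 16`. -/
def addr (k a b c d : ℕ) : ℕ := 16 * pr (pr a b) (pr c d) + k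

/-- The residue modulo 16 is the number of the array. Injectivity makes the sixteen four-dimensional
arrays independent regions of memory. -/
theorem addr_injective {k a b c d k' a' b' c' d' : ℕ} (hk : k < 16) (hk' : k' < 16)
    (h : addr k a b c d = addr k' a' b' c' d') :
    k = k' ∧ a = a' ∧ b = b' ∧ c = c' ∧ d = d' := by
  unfold addr at h
  have h1 : k = k' := by omega
  have h2 : pr (pr a b) (pr c d) = pr (pr a' b') (pr c' d') := by omega
  obtain ⟨h3, h4⟩ := pr_injective h2
  obtain ⟨ha, hb⟩ := pr_injective h3
  obtain ⟨hc, hd⟩ := pr_injective h4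
  exact ⟨h1, ha, hb, hc, hd⟩

/-- The pairing function on expressions. -/
def prE (x y : Expr) : Expr := .add (.mul (.add x y) (.add x y)) x

/-- The address of an array cell as an expression. -/
def addrE (k : ℕ) (a b c d : Expr) : Expr :=
  .add (.mul (.const 16) (prE (prE a b) (prE c d))) (.const k)

/-- Reading of an array cell. -/
def ld (k : ℕ) (a b c d : Expr) : Expr := .load (addrE k a b c d)

/-- Contents of an array cell. -/
def rd (s : MState) (k a b c d : ℕ) : ℕ := s.mem (addr k a b c d)

@[simp] theorem eval_ld (s : MState) (k : ℕ) (a b c d : Expr) :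
    (ld k a b c d).eval s = rd s k (a.eval s) (b.eval s) (c.eval s) (d.eval s) := rfl

@[simp] theorem eval_const (s : MState) (k : ℕ) : (Expr.const k).eval s = k := (rfl)
@[simp] theorem eval_var (s : MState) (x : ℕ) : (Expr.var x).eval s = s.vars x := (rfl)
@[simp] theorem eval_add' (s : MState) (e f : Expr) :
    (Expr.add e f).eval s = e.eval s + f.eval s := (rfl)
@[simp] theorem eval_sub' (s : MState) (e f : Expr) :
    (Expr.sub e f).eval s = e.eval s - f.eval s := (rfl)
@[simp] theorem eval_mul' (s : MState) (e f : Expr) :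
    (Expr.mul e f).eval s = e.eval s * f.eval s := (rfl)
@[simp] theorem eval_div' (s : MState) (e f : Expr) :
    (Expr.div e f).eval s = e.eval s / f.eval s := (rfl)
@[simp] theorem eval_mod' (s : MState) (e f : Expr) :
    (Expr.mod e f).eval s = e.eval s % f.eval s := (rfl)
@[simp] theorem eval_lt' (s : MState) (e f : Expr) :
    (Expr.lt e f).eval s = if e.eval s < f.eval s then 1 else 0 := (rfl)
@[simp] theorem eval_eq' (s : MState) (e f : Expr) :
    (Expr.eq e f).eval s = if e.eval s = f.eval s then 1 else 0 := (rfl)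

/-- Assignment to a variable. -/
def setV (s : MState) (x v : ℕ) : MState := { s with vars := Function.update s.vars x v }

/-- Assignment to an array cell. -/
def setC (s : MState) (k a b c d v : ℕ) : MState :=
  { s with mem := Function.update s.mem (addr k a b c d) v }

@[simp] theorem setV_vars (s : MState) (x v y : ℕ) :
    (setV s x v).vars y = if y = x then v else s.vars y := by
  simp [setV, Function.update_apply]

@[simp] theorem setV_rd (s : MState) (x v : ℕ) : rd (setV s x v) = rd s := rfl
@[simp] theorem setV_out (s : MState) (x v : ℕ) : (setV s x v).out = s.out := rfl
@[simp] theorem setV_psi (s : MState) (x v : ℕ) : (setV s x v).psi = s.psi := rfl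
@[simp] theorem setC_vars (s : MState) (k a b c d v : ℕ) : (setC s k a b c d v).vars = s.vars := rfl

theorem rd_setC (s : MState) {k k' : ℕ} (hk : k < 16) (hk' : k' < 16) (a b c d v a' b' c' d' : ℕ) :
    rd (setC s k a b c d v) k' a' b' c' d' =
      if k' = k ∧ a' = a ∧ b' = b ∧ c' = c ∧ d' = d then v else rd s k' a' b' c' d' := by
  unfold rd setC
  simp only [Function.update_apply]
  by_cases h : addr k' a' b' c' d' = addr k a b c d
  · rw [if_pos h, if_pos (addr_injective hk' hk h)]
  · rw [if_neg h, if_neg]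
    rintro ⟨rfl, rfl, rfl, rfl, rfl⟩
    exact h rfl

/-- Structured commands. The value of an assignment is reduced modulo one of the variables 1 and 5,
which are never changed. -/
inductive Cmd
  /-- `x := e mod v_md` -/
  | set (x md : ℕ) (e : Expr)
  /-- the cell `a b c d` of the array `k` becomes `e mod v_md` -/
  | put (k md : ℕ) (a b c d : Expr) (e : Expr)
  | emit (e : Expr)
  | seq (c d : Cmd)
  | ite (e : Expr) (c d : Cmd)
  /-- `c` for all values of the variable `x` less than that of the variable `y` -/
  | rep (x y : ℕ) (c : Cmd)
  /-- not gate -/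
  | flip (a : QRef)
  | query (e : Expr)
  | meas (x : ℕ) (a : QRef)

infixr:60 ";;" => Cmd.seq

/-! ### Syntax, outcomes and frame properties of structured commands -/

namespace Cmd

/-- Translation of commands into programs. -/
def compile : Cmd → Program
  | set x md e => .assign x (.mod e (.var md))
  | put k md a b c d e => .store (addrE k a b c d) (.mod e (.var md))
  | emit e => .emit e
  | seq c d => .seq c.compile d.compile
  | ite e c d => .ite e c.compile d.compile
  | rep x y c => .seq (.assign x (.const 0))
      (.loop (.lt (.var x) (.var y)) (.seq c.compile (.assign x (.add (.var x) (.const 1)))))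
  | flip a => .gate .X a
  | query e => .query e
  | meas x a => .measure x a

/-- `c.wv x`: the command writes to the variable `x`. -/
def wv : Cmd → ℕ → Bool
  | set x _ _, y => x == y
  | put .., _ => false
  | emit _, _ => false
  | seq c d, y => c.wv y || d.wv y
  | ite _ c d, y => c.wv y || d.wv y
  | rep x _ c, y => x == y || c.wv y
  | flip _, _ => false
  | query _, _ => false
  | meas x _, y => x == y

/-- `c.wa k`: the command writes to the array `k`. -/
def wa : Cmd → ℕ → Bool
  | set .., _ => false
  | put k .., j => k == j
  | emit _, _ => false
  | seq c d, y => c.wa y || d.wa y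
  | ite _ c d, y => c.wa y || d.wa y
  | rep _ _ c, y => c.wa y
  | flip _, _ => false
  | query _, _ => false
  | meas .., _ => false

/-- The command has no output. -/
def silent : Cmd → Bool
  | emit _ => false
  | seq c d => c.silent && d.silent
  | ite _ c d => c.silent && d.silent
  | rep _ _ c => c.silent
  | _ => true

/-- The command contains no measurements. -/
def det : Cmd → Bool
  | meas .. => false
  | seq c d => c.det && d.det
  | ite _ c d => c.det && d.det
  | rep _ _ c => c.det
  | _ => true

/-- The command does not use the quantum memory. -/
def classical : Cmd → Bool
  | meas .. => false
  | flip _ => false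
  | query _ => false
  | seq c d => c.classical && d.classical
  | ite _ c d => c.classical && d.classical
  | rep _ _ c => c.classical
  | _ => true

/-- Well-formed commands. -/
def wf : Cmd → Bool
  | set x md _ => x != 1 && x != 5 && (md == 1 || md == 5)
  | put k md .. => decide (k < 16) && (md == 1 || md == 5)
  | emit _ => true
  | seq c d => c.wf && d.wf
  | ite _ c d => c.wf && d.wf
  | rep x y c => x != 1 && x != 5 && x != y && !c.wv x && !c.wv y && c.wf
  | flip _ => true
  | query _ => true
  | meas x _ => x != 1 && x != 5

variable {q l m : ℕ} (U : Matrix (Block q l m) (Block q l m) ℂ)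

/-- Increment of a variable. -/
def inc (x : ℕ) (s : MState) : MState := setV s x (s.vars x + 1)

@[simp] theorem inc_rd (s : MState) (x : ℕ) : rd (inc x s) = rd s := rfl
@[simp] theorem inc_out (s : MState) (x : ℕ) : (inc x s).out = s.out := rfl
@[simp] theorem inc_psi (s : MState) (x : ℕ) : (inc x s).psi = s.psi := rfl
@[simp] theorem inc_vars (s : MState) (x y : ℕ) :
    (inc x s).vars y = if y = x then s.vars x + 1 else s.vars y := by simp [inc]

/-- The outcomes of a repetition of `g`. -/
def outsIter (g : MState → List MState) (x : ℕ) : ℕ → MState → List MState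
  | 0, s => [s]
  | N + 1, s => (g s).flatMap fun t => outsIter g x N (inc x t)

/-- The final states over all sequences of measurement results. -/
noncomputable def outs : Cmd → MState → List MState
  | set x md e, s => [setV s x (e.eval s % s.vars md)]
  | put k md a b c d e, s =>
      [setC s k (a.eval s) (b.eval s) (c.eval s) (d.eval s) (e.eval s % s.vars md)]
  | emit e, s => [{ s with out := s.out ++ [e.eval s] }]
  | seq c d, s => (outs c s).flatMap (outs d)
  | ite e c d, s => if e.eval s ≠ 0 then outs c s else outs d s
  | rep x y c, s => outsIter (outs c) x (s.vars y) (setV s x 0)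
  | flip a, s => [{ s with psi := s.psi.gate .X (a.eval s) }]
  | query e, s => [{ s with psi := s.psi.query U (e.eval s) }]
  | meas x a, s => [s.measured x a false, s.measured x a true]

/-- The final state of a command without measurements. -/
noncomputable def run : Cmd → MState → MState
  | set x md e, s => setV s x (e.eval s % s.vars md)
  | put k md a b c d e, s =>
      setC s k (a.eval s) (b.eval s) (c.eval s) (d.eval s) (e.eval s % s.vars md)
  | emit e, s => { s with out := s.out ++ [e.eval s] }
  | seq c d, s => run d (run c s)
  | ite e c d, s => if e.eval s ≠ 0 then run c s else run d s
  | rep x y c, s => (fun s' => inc x (run c s'))^[s.vars y] (setV s x 0)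
  | flip a, s => { s with psi := s.psi.gate .X (a.eval s) }
  | query e, s => { s with psi := s.psi.query U (e.eval s) }
  | meas _ _, s => s

/-- Branching comes only from measurements. The decoding phase can therefore be analysed as a
function on states, without lists of outcomes. -/
theorem outs_eq_run (c : Cmd) (hc : c.det = true) (s : MState) : outs U c s = [run U c s] := by
  induction c generalizing s with
  | seq c d ihc ihd =>
    simp only [det, Bool.and_eq_true] at hc
    simp [outs, run, ihc hc.1, ihd hc.2]
  | ite e c d ihc ihd =>
    simp only [det, Bool.and_eq_true] at hc
    simp only [outs, run, ihc hc.1, ihd hc.2]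
    split_ifs <;> rfl
  | rep x y c ih =>
    simp only [det] at hc
    have key : ∀ N s, outsIter (outs U c) x N s = [(fun s' => inc x (run U c s'))^[N] s] := by
      intro N
      induction N with
      | zero => intro s; rfl
      | succ N ihN => intro s; simp [outsIter, ih hc, ihN]
    simp only [outs, run, key]
  | meas => simp [det] at hc
  | _ => rfl

theorem outsIter_forall {g : MState → List MState} {x : ℕ} {P : MState → Prop}
    (hg : ∀ s, P s → ∀ s' ∈ g s, P (inc x s')) (N : ℕ) (s : MState) (hs : P s) :
    ∀ s' ∈ outsIter g x N s, P s' := by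
  induction N generalizing s with
  | zero => simpa [outsIter] using hs
  | succ N ih =>
    intro s' h
    simp only [outsIter, List.mem_flatMap] at h
    obtain ⟨a, ha, h⟩ := h
    exact ih _ (hg s hs a ha) _ h

/-- This and the following lemmas turn decidable syntactic checks into frame conditions, so that
later proofs discharge "unchanged" by `decide`. -/
theorem outs_vars (c : Cmd) {x : ℕ} (hx : c.wv x = false) (s : MState) :
    ∀ s' ∈ outs U c s, s'.vars x = s.vars x := by
  induction c generalizing s with
  | set y md e =>
    simp only [wv, beq_eq_false_iff_ne, ne_eq] at hx
    simp [outs, Ne.symm hx]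
  | put => simp [outs]
  | emit => simp [outs]
  | flip => simp [outs]
  | query => simp [outs]
  | meas y a =>
    simp only [wv, beq_eq_false_iff_ne, ne_eq] at hx
    simp [outs, MState.measured, Ne.symm hx]
  | seq c d ihc ihd =>
    simp only [wv, Bool.or_eq_false_iff] at hx
    intro s' h
    simp only [outs, List.mem_flatMap] at h
    obtain ⟨a, ha, h⟩ := h
    rw [ihd hx.2 _ _ h, ihc hx.1 _ _ ha]
  | ite e c d ihc ihd =>
    simp only [wv, Bool.or_eq_false_iff] at hx
    intro s' h
    simp only [outs] at h
    split_ifs at h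
    · exact ihc hx.1 _ _ h
    · exact ihd hx.2 _ _ h
  | rep y z c ih =>
    simp only [wv, Bool.or_eq_false_iff, beq_eq_false_iff_ne, ne_eq] at hx
    refine outsIter_forall (P := fun s' => s'.vars x = s.vars x) ?_ _ _ ?_
    · intro s1 h1 s2 h2
      simp [Ne.symm hx.1, ih hx.2 _ _ h2, h1]
    · simp [Ne.symm hx.1]

theorem run_iterate {P : MState → Prop} {f : MState → MState} (hf : ∀ s, P s → P (f s)) (N : ℕ)
    {s : MState} (hs : P s) : P (f^[N] s) := by
  induction N generalizing s with
  | zero => exact hs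
  | succ N ih => exact ih (hf s hs)

theorem run_vars (c : Cmd) {x : ℕ} (hx : c.wv x = false) (s : MState) :
    (run U c s).vars x = s.vars x := by
  induction c generalizing s with
  | set y md e =>
    simp only [wv, beq_eq_false_iff_ne, ne_eq] at hx
    simp [run, Ne.symm hx]
  | put => simp [run]
  | emit => simp [run]
  | flip => simp [run]
  | query => simp [run]
  | meas y a => simp [run]
  | seq c d ihc ihd =>
    simp only [wv, Bool.or_eq_false_iff] at hx
    simp only [run]
    rw [ihd hx.2, ihc hx.1]
  | ite e c d ihc ihd =>
    simp only [wv, Bool.or_eq_false_iff] at hx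
    simp only [run]
    split_ifs
    · exact ihc hx.1 _
    · exact ihd hx.2 _
  | rep y z c ih =>
    simp only [wv, Bool.or_eq_false_iff, beq_eq_false_iff_ne, ne_eq] at hx
    refine run_iterate (P := fun s' => s'.vars x = s.vars x) ?_ _ ?_
    · intro s1 h1
      simp [Ne.symm hx.1, ih hx.2, h1]
    · simp [Ne.symm hx.1]

theorem run_rd (c : Cmd) (hw : c.wf = true) {k : ℕ} (hk : k < 16) (hx : c.wa k = false)
    (s : MState) : rd (run U c s) k = rd s k := by
  induction c generalizing s with
  | set y md e => rfl
  | put j md =>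
    simp only [wa, beq_eq_false_iff_ne, ne_eq] at hx
    simp only [wf, Bool.and_eq_true, decide_eq_true_eq] at hw
    ext a b c d
    simp only [run]
    rw [rd_setC _ hw.1 hk, if_neg]
    exact fun h => hx h.1.symm
  | emit => rfl
  | flip => rfl
  | query => rfl
  | meas y a => rfl
  | seq c d ihc ihd =>
    simp only [wa, Bool.or_eq_false_iff] at hx
    simp only [wf, Bool.and_eq_true] at hw
    simp only [run]
    rw [ihd hw.2 hx.2, ihc hw.1 hx.1]
  | ite e c d ihc ihd =>
    simp only [wa, Bool.or_eq_false_iff] at hx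
    simp only [wf, Bool.and_eq_true] at hw
    simp only [run]
    split_ifs
    · exact ihc hw.1 hx.1 _
    · exact ihd hw.2 hx.2 _
  | rep y z c ih =>
    simp only [wa] at hx
    simp only [wf, Bool.and_eq_true] at hw
    refine run_iterate (P := fun s' => rd s' k = rd s k) ?_ _ ?_
    · intro s1 h1
      simp [ih hw.2 hx, h1]
    · simp

theorem run_out (c : Cmd) (hx : c.silent = true) (s : MState) : (run U c s).out = s.out := by
  induction c generalizing s with
  | emit => simp [silent] at hx
  | seq c d ihc ihd =>
    simp only [silent, Bool.and_eq_true] at hx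
    simp only [run]
    rw [ihd hx.2, ihc hx.1]
  | ite e c d ihc ihd =>
    simp only [silent, Bool.and_eq_true] at hx
    simp only [run]
    split_ifs
    · exact ihc hx.1 _
    · exact ihd hx.2 _
  | rep y z c ih =>
    simp only [silent] at hx
    refine run_iterate (P := fun s' => s'.out = s.out) ?_ _ ?_
    · intro s1 h1
      simp [ih hx, h1]
    · simp
  | _ => rfl

theorem run_psi (c : Cmd) (hx : c.classical = true) (s : MState) : (run U c s).psi = s.psi := by
  induction c generalizing s with
  | flip => simp [classical] at hx
  | query => simp [classical] at hx
  | meas => rfl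
  | seq c d ihc ihd =>
    simp only [classical, Bool.and_eq_true] at hx
    simp only [run]
    rw [ihd hx.2, ihc hx.1]
  | ite e c d ihc ihd =>
    simp only [classical, Bool.and_eq_true] at hx
    simp only [run]
    split_ifs
    · exact ihc hx.1 _
    · exact ihd hx.2 _
  | rep y z c ih =>
    simp only [classical] at hx
    refine run_iterate (P := fun s' => s'.psi = s.psi) ?_ _ ?_
    · intro s1 h1
      simp [ih hx, h1]
    · simp
  | _ => rfl

/-- Invariants of loops. -/
theorem run_rep (I : ℕ → MState → Prop) {x y : ℕ} {c : Cmd} (hx : c.wv x = false) {s : MState}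
    (h0 : I 0 (setV s x 0))
    (hstep : ∀ i < s.vars y, ∀ s', I i s' → s'.vars x = i → I (i + 1) (setV (run U c s') x (i + 1))) :
    I (s.vars y) (run U (rep x y c) s) := by
  have key : ∀ i ≤ s.vars y,
      I i ((fun s' => inc x (run U c s'))^[i] (setV s x 0)) ∧
        ((fun s' => inc x (run U c s'))^[i] (setV s x 0)).vars x = i := by
    intro i
    induction i with
    | zero => intro _; simpa using h0
    | succ i ih =>
      intro hi
      obtain ⟨h1, h2⟩ := ih (by omega)
      rw [Function.iterate_succ_apply']
      have := hstep i (by omega) _ h1 h2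
      have h3 : ∀ s', inc x (run U c s') = setV (run U c s') x (s'.vars x + 1) := fun s' => by
        rw [inc, run_vars U c hx]
      rw [h3, h2]
      exact ⟨this, by simp⟩
  exact (key _ le_rfl).1

end Cmd

/-! ### Running time -/

/-- The exponent in a bound for the value of an expression. -/
def wt : Expr → ℕ
  | .const k => k + 1
  | .var _ => 1
  | .load _ => 1
  | .add e f => wt e + wt f
  | .sub e _ => wt e
  | .mul e f => wt e + wt f
  | .div e _ => wt e
  | .mod e _ => wt e
  | .lt _ _ => 1
  | .eq _ _ => 1

/-- A bound for the time to evaluate an expression, as a polynomial in a bound for all numbers in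
the machine. -/
noncomputable def exprCost : Expr → ℕ[X]
  | .const _ => 1
  | .var _ => 1
  | .load e => 1 + exprCost e
  | .add e f => 1 + exprCost e + exprCost f
  | .sub e f => 1 + exprCost e + exprCost f
  | .mul e f => 1 + exprCost e + exprCost f + X * C (wt e) + X * C (wt f)
  | .div e f => 1 + exprCost e + exprCost f
  | .mod e f => 1 + exprCost e + exprCost f
  | .lt e f => 1 + exprCost e + exprCost f
  | .eq e f => 1 + exprCost e + exprCost f

theorem wt_pos (e : Expr) : 1 ≤ wt e := by
  induction e <;> simp only [wt] <;> omega

/-- Exponents add for a product, and also for a sum, since a sum of two numbers that are at least 2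
is at most their product. Intermediate values thus have binary length linear in `B`, which bounds
the charge for multiplications. -/
theorem eval_le {B : ℕ} (hB : 2 ≤ B) {s : MState} (hv : ∀ x, s.vars x ≤ B) (hm : ∀ a, s.mem a ≤ B)
    (e : Expr) : e.eval s ≤ B ^ wt e := by
  have h2 : ∀ e, 2 ≤ B ^ wt e := fun e => hB.trans (Nat.le_self_pow (by have := wt_pos e; omega) B)
  induction e with
  | const k =>
    simp only [Expr.eval, wt]
    exact (Nat.lt_two_pow_self.trans_le (Nat.pow_le_pow_left hB k)).le.trans
      (Nat.pow_le_pow_right (by omega) (by omega))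
  | var x => simpa [Expr.eval, wt] using hv x
  | load e => simpa [Expr.eval, wt] using hm _
  | add e f he hf =>
    simp only [Expr.eval, wt, pow_add]
    have := h2 e; have := h2 f
    nlinarith
  | sub e f he hf => exact (Nat.sub_le _ _).trans he
  | mul e f he hf =>
    simp only [Expr.eval, wt, pow_add]
    exact Nat.mul_le_mul he hf
  | div e f he hf => exact (Nat.div_le_self _ _).trans he
  | mod e f he hf => exact (Nat.mod_le _ _).trans he
  | lt e f => rw [eval_lt', wt, pow_one]; split_ifs <;> omega
  | eq e f => rw [eval_eq', wt, pow_one]; split_ifs <;> omega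

theorem size_le_of_le_pow {B w v : ℕ} (hw : 1 ≤ w) (hv : v ≤ B ^ w) : Nat.size v ≤ B * w := by
  rw [Nat.size_le, pow_mul]
  exact hv.trans_lt (Nat.pow_lt_pow_left Nat.lt_two_pow_self (by omega))

theorem time_le {B : ℕ} (hB : 2 ≤ B) {s : MState} (hv : ∀ x, s.vars x ≤ B) (hm : ∀ a, s.mem a ≤ B)
    (e : Expr) : e.time s ≤ (exprCost e).eval B := by
  induction e with
  | const k => simp [Expr.time, exprCost]
  | var x => simp [Expr.time, exprCost]
  | load e he => simpa [Expr.time, exprCost] using he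
  | mul e f he hf =>
    have h1 := size_le_of_le_pow (wt_pos e) (eval_le hB hv hm e)
    have h2 := size_le_of_le_pow (wt_pos f) (eval_le hB hv hm f)
    simp only [Expr.time, exprCost, eval_add, eval_one, eval_mul, eval_X, eval_C]
    omega
  | _ e f he hf =>
    simp only [Expr.time, exprCost, eval_add, eval_one]
    omega

/-- All numbers in the machine are at most `B`, the modulus in variable 5 is `B`, and the modulus
in variable 1 is positive. -/
structure Bounded (B : ℕ) (s : MState) : Prop where
  two_le : 2 ≤ B
  vars : ∀ x, s.vars x ≤ B
  mem : ∀ a, s.mem a ≤ B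
  five : s.vars 5 = B
  one : 0 < s.vars 1

namespace Cmd

/-- A bound for the running time, as a polynomial in a bound for all numbers in the machine. -/
noncomputable def cost : Cmd → ℕ[X]
  | set _ md e => 1 + exprCost (.mod e (.var md))
  | put k md a b c d e => 1 + exprCost (addrE k a b c d) + exprCost (.mod e (.var md))
  | emit e => 1 + exprCost e
  | seq c d => c.cost + d.cost
  | ite e c d => 1 + exprCost e + c.cost + d.cost
  | rep _ _ c => X * (8 + c.cost) + 6
  | flip a => 1 + (exprCost a.block + exprCost a.pos)
  | query e => 1 + exprCost e
  | meas _ a => 1 + (exprCost a.block + exprCost a.pos)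

end Cmd

/-! ### Executions that realise the outcomes within the cost -/

variable {q l m : ℕ} (U : Matrix (Block q l m) (Block q l m) ℂ)

/-- The program `c`, started in `s`, ends in the states `l` after at most `t` steps, and these
states satisfy `G`. -/
def Reaches (c : Program) (s : MState) (l : List MState) (t : ℕ) (G : MState → Prop) : Prop :=
  ∃ L, Exec U c s L ∧ L.map Prod.fst = l ∧ ∀ p ∈ L, p.2 ≤ t ∧ G p.1

variable {U}

theorem Reaches.single {c : Program} {s s' : MState} {t t' : ℕ} {G : MState → Prop}
    (h : Exec U c s [(s', t)]) (ht : t ≤ t') (hG : G s') : Reaches U c s [s'] t' G :=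
  ⟨_, h, rfl, by simpa using ⟨ht, hG⟩⟩

theorem Reaches.mono {c : Program} {s : MState} {l : List MState} {t t' : ℕ} {G G' : MState → Prop}
    (h : Reaches U c s l t G) (ht : t ≤ t') (hG : ∀ s' ∈ l, G s' → G' s') :
    Reaches U c s l t' G' := by
  obtain ⟨L, h1, rfl, h3⟩ := h
  exact ⟨L, h1, rfl, fun p hp => ⟨(h3 p hp).1.trans ht,
    hG _ (List.mem_map_of_mem hp) (h3 p hp).2⟩⟩

/-- The continuation in `Exec.seq` is a function of the state alone. It is obtained by choosing one
execution per reachable state, with the empty list elsewhere. -/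
theorem Reaches.seq {c d : Program} {s : MState} {l : List MState} {t t' : ℕ}
    {G G' : MState → Prop} {R : MState → List MState} (hc : Reaches U c s l t G)
    (hd : ∀ s' ∈ l, G s' → Reaches U d s' (R s') t' G') :
    Reaches U (.seq c d) s (l.flatMap R) (t + t') G' := by
  classical
  obtain ⟨L, h1, rfl, h3⟩ := hc
  have H : ∀ s', ∃ L', s' ∈ L.map Prod.fst → Exec U d s' L' ∧ L'.map Prod.fst = R s' ∧
      ∀ p ∈ L', p.2 ≤ t' ∧ G' p.1 := by
    intro s'
    by_cases hs : s' ∈ L.map Prod.fst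
    · obtain ⟨p, hp, rfl⟩ := List.mem_map.1 hs
      obtain ⟨L', h⟩ := hd _ hs (h3 p hp).2
      exact ⟨L', fun _ => h⟩
    · exact ⟨[], fun h => absurd h hs⟩
  choose K hK using H
  have hK' : ∀ p ∈ L, _ := fun p hp => hK p.1 (List.mem_map_of_mem hp)
  refine ⟨_, Exec.seq K h1 fun p hp => (hK' p hp).1, ?_, ?_⟩
  · rw [List.map_flatMap, List.flatMap_map]
    have : ∀ L0 : List (MState × ℕ), (∀ p ∈ L0, p ∈ L) →
        L0.flatMap (fun a => List.map Prod.fst (List.map (fun p' => (p'.1, a.2 + p'.2)) (K a.1))) =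
        L0.flatMap (fun a => R a.1) := by
      intro L0 h0
      induction L0 with
      | nil => rfl
      | cons a L0 ih =>
        simp only [List.flatMap_cons]
        rw [ih fun p hp => h0 p (List.mem_cons_of_mem _ hp),
          ← (hK' a (h0 a List.mem_cons_self)).2.1, List.map_map]
        rfl
    exact this L fun _ h => h
  · intro p hp
    simp only [List.mem_flatMap, List.mem_map] at hp
    obtain ⟨a, ha, b, hb, rfl⟩ := hp
    have := (hK' a ha).2.2 b hb
    exact ⟨Nat.add_le_add (h3 a ha).1 this.1, this.2⟩

theorem Reaches.of_map {c d : Program} {s : MState} {l : List MState} {t u t' : ℕ}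
    {G : MState → Prop} (hc : Reaches U c s l t G)
    (h : ∀ L, Exec U c s L → Exec U d s (L.map fun p => (p.1, u + p.2))) (ht : u + t ≤ t') :
    Reaches U d s l t' G := by
  obtain ⟨L, h1, rfl, h3⟩ := hc
  refine ⟨_, h L h1, by simp, ?_⟩
  intro p hp
  obtain ⟨p, hp', rfl⟩ := List.mem_map.1 hp
  exact ⟨(Nat.add_le_add_left (h3 p hp').1 u).trans ht, (h3 p hp').2⟩

theorem Bounded.mod_le {B : ℕ} {s : MState} (h : Bounded B s) {md : ℕ} (hmd : md = 1 ∨ md = 5)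
    (v : ℕ) : v % s.vars md ≤ B := by
  have : v % s.vars md < s.vars md := Nat.mod_lt _ (by
    rcases hmd with rfl | rfl
    · exact h.one
    · have := h.five; have := h.two_le; omega)
  exact this.le.trans (h.vars md)

theorem Bounded.setV {B : ℕ} {s : MState} (h : Bounded B s) {x v : ℕ} (h1 : x ≠ 1) (h5 : x ≠ 5)
    (hv : v ≤ B) : Bounded B (setV s x v) where
  two_le := h.two_le
  vars y := by
    simp only [setV_vars]
    split_ifs
    · exact hv
    · exact h.vars y
  mem := h.mem
  five := by simpa [Ne.symm h5] using h.five
  one := by simpa [Ne.symm h1] using h.one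

/-- The body changes neither the counter nor the limit, so `N`, the difference of the two, is the
number of rounds still to come. -/
theorem Reaches.loop {B : ℕ} {c : Cmd} {x y : ℕ} (hx1 : x ≠ 1) (hx5 : x ≠ 5) (hxy : x ≠ y)
    (hwx : c.wv x = false) (hwy : c.wv y = false)
    (ih : ∀ s, Bounded B s → Reaches U c.compile s (c.outs U s) (c.cost.eval B) (Bounded B))
    (N : ℕ) (s : MState) (hs : Bounded B s) (hN : s.vars y = s.vars x + N) :
    Reaches U (.loop (.lt (.var x) (.var y))
        (.seq c.compile (.assign x (.add (.var x) (.const 1))))) s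
      (Cmd.outsIter (c.outs U) x N s) (N * (8 + c.cost.eval B) + 4) (Bounded B) := by
  induction N generalizing s with
  | zero =>
    have := Exec.loop_stop (U := U) (e := .lt (.var x) (.var y))
      (c := .seq c.compile (.assign x (.add (.var x) (.const 1)))) (s := s)
      (by rw [eval_lt', if_neg (by simp; omega)])
    exact Reaches.single this (by simp [Expr.time]) hs
  | succ N ihN =>
    have hb : ∀ s' ∈ c.outs U s, s'.vars x = s.vars x ∧ s'.vars y = s.vars y := fun s' h =>
      ⟨Cmd.outs_vars U c hwx s s' h, Cmd.outs_vars U c hwy s s' h⟩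
    have h1 : Reaches U (.seq c.compile (.assign x (.add (.var x) (.const 1)))) s
        ((c.outs U s).flatMap fun s' => [Cmd.inc x s']) (c.cost.eval B + 4)
        (fun s' => Bounded B s' ∧ s'.vars y = s'.vars x + N) := by
      refine (ih s hs).seq fun s' hs' hB => ?_
      refine Reaches.single (Exec.assign _ _ _) (by simp [Expr.time]) ⟨?_, ?_⟩
      · refine Bounded.setV hB hx1 hx5 ?_
        have := hb s' hs'
        -- The counter is incremented without reduction; it stays at most `B` because it does not
        -- exceed the limit, which does not.
        have := hB.vars y
        change s'.vars x + 1 ≤ B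
        omega
      · have := hb s' hs'
        change (setV s' x (s'.vars x + 1)).vars y = (setV s' x (s'.vars x + 1)).vars x + N
        simp only [setV_vars, if_neg (Ne.symm hxy), if_true]
        omega
    have h2 := h1.seq fun s' _ h => ihN s' h.1 h.2
    have h3 : ∀ L, _ → Exec U _ s _ := fun L =>
      Exec.loop_step (U := U) (e := .lt (.var x) (.var y))
      (c := .seq c.compile (.assign x (.add (.var x) (.const 1)))) (s := s)  (L := L)
      (by rw [eval_lt', if_pos (by simp; omega)]; simp)
    -- A round costs 4 for the loop test and 4 for the increment, besides the body; the final
    -- failing test costs 4.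
    have h4 := h2.of_map h3 (t' := (N + 1) * (8 + c.cost.eval B) + 4)
      (by simp only [Expr.time]; ring_nf; omega)
    have h5 : ((c.outs U s).flatMap fun s' => [Cmd.inc x s']).flatMap
        (Cmd.outsIter (c.outs U) x N) = Cmd.outsIter (c.outs U) x (N + 1) s := by
      rw [List.flatMap_assoc]
      simp [Cmd.outsIter]
    rwa [h5] at h4

/-- Since `Bounded B` survives every command, the same `B` bounds the cost of all rounds of all
loops. This is the only link needed between the structured language and the machine model. -/
theorem reaches_outs {B : ℕ} (c : Cmd) (hw : c.wf = true) (s : MState) (hs : Bounded B s) :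
    Reaches U c.compile s (c.outs U s) (c.cost.eval B) (Bounded B) := by
  have ht : ∀ {s}, Bounded B s → ∀ e : Expr, e.time s ≤ (exprCost e).eval B := fun hs e =>
    time_le hs.two_le hs.vars hs.mem e
  induction c generalizing s with
  | set x md e =>
    simp only [Cmd.wf, Bool.and_eq_true, bne_iff_ne, Bool.or_eq_true, beq_iff_eq] at hw
    refine Reaches.single (Exec.assign _ _ _) ?_ (Bounded.setV hs hw.1.1 hw.1.2 ?_)
    · have := ht hs (.mod e (.var md))
      simpa [Cmd.cost] using this
    · exact hs.mod_le hw.2 _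
  | put k md a b c d e =>
    simp only [Cmd.wf, Bool.and_eq_true, decide_eq_true_eq, Bool.or_eq_true, beq_iff_eq] at hw
    refine Reaches.single (Exec.store _ _ _) ?_ ⟨hs.two_le, hs.vars, ?_, hs.five, hs.one⟩
    · have h1 := ht hs (.mod e (.var md))
      have h2 := ht hs (addrE k a b c d)
      simp only [Cmd.cost, eval_add, eval_one]
      omega
    · intro j
      change Function.update s.mem _ _ j ≤ B
      rw [Function.update_apply]
      split_ifs
      · exact hs.mod_le hw.2 _
      · exact hs.mem _
  | emit e =>
    refine Reaches.single (Exec.emit _ _) ?_ ⟨hs.two_le, hs.vars, hs.mem, hs.five, hs.one⟩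
    simpa [Cmd.cost] using ht hs e
  | flip a =>
    refine Reaches.single (Exec.gate _ _ _) ?_ ⟨hs.two_le, hs.vars, hs.mem, hs.five, hs.one⟩
    have h1 := ht hs a.block
    have h2 := ht hs a.pos
    simp only [Cmd.cost, eval_add, eval_one, QRef.time]
    omega
  | query e =>
    refine Reaches.single (Exec.query _ _) ?_ ⟨hs.two_le, hs.vars, hs.mem, hs.five, hs.one⟩
    simpa [Cmd.cost] using ht hs e
  | meas x a =>
    simp only [Cmd.wf, Bool.and_eq_true, bne_iff_ne] at hw
    have h1 := ht hs a.block
    have h2 := ht hs a.pos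
    have hb : ∀ v, Bounded B (s.measured x a v) := by
      intro v
      have := Bounded.setV hs hw.1 hw.2 (v := v.toNat)
        ((Bool.toNat_le v).trans (by have := hs.two_le; omega))
      exact ⟨this.two_le, this.vars, this.mem, this.five, this.one⟩
    refine ⟨_, Exec.measure x a s, by simp [Cmd.outs], ?_⟩
    have : 1 + a.time s ≤ eval B (Cmd.meas x a).cost := by
      simp only [Cmd.cost, eval_add, eval_one, QRef.time]
      omega
    simp [this, hb]
  | seq c d ihc ihd =>
    simp only [Cmd.wf, Bool.and_eq_true] at hw
    have := (ihc hw.1 s hs).seq fun s' _ h => ihd hw.2 s' h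
    simpa [Cmd.cost, Cmd.compile, Cmd.outs] using this
  | ite e c d ihc ihd =>
    simp only [Cmd.wf, Bool.and_eq_true] at hw
    have h1 := ht hs e
    simp only [Cmd.outs]
    split_ifs with h
    · refine (ihc hw.1 s hs).of_map (fun L => Exec.ite_true h) ?_
      simp only [Cmd.cost, eval_add, eval_one]
      omega
    · refine (ihd hw.2 s hs).of_map (fun L => Exec.ite_false (by simpa using h)) ?_
      simp only [Cmd.cost, eval_add, eval_one]
      omega
  | rep x y c ih =>
    simp only [Cmd.wf, Bool.and_eq_true, bne_iff_ne, Bool.not_eq_true'] at hw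
    obtain ⟨⟨⟨⟨⟨h1, h5⟩, hxy⟩, hwx⟩, hwy⟩, hw⟩ := hw
    have hb := Bounded.setV hs h1 h5 (Nat.zero_le B)
    have h := Reaches.loop h1 h5 hxy hwx hwy (fun s hs => ih hw s hs) (s.vars y) _ hb
      (by simp [Ne.symm hxy])
    have h0 : Reaches U (.assign x (.const 0)) s [setV s x 0] 2 (fun s' => s' = setV s x 0) :=
      Reaches.single (Exec.assign _ _ _) (by simp [Expr.time]) rfl
    have := h0.seq (R := fun s' => Cmd.outsIter (c.outs U) x (s.vars y) s') fun s' _ h' => by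
      subst h'; exact h
    simp only [List.flatMap_cons, List.flatMap_nil, List.append_nil] at this
    refine this.mono ?_ fun _ _ h => h
    simp only [Cmd.cost, eval_add, eval_mul, eval_X, eval_ofNat]
    have := Nat.mul_le_mul_right (8 + eval B c.cost) (hs.vars y)
    omega

end ListDecoder

namespace ListDecoder

open Polynomial

/-! ## Interpolation with multiplicities -/

section Interpolation

variable {F : Type*} [Field F]

/-- The coefficient of `X ^ u` in `(X + a) ^ i`. -/
noncomputable def shiftCoeff (a : F) (u i : ℕ) : F := ((X + C a) ^ i).coeff u

theorem shiftCoeff_zero (a : F) (u : ℕ) : shiftCoeff a u 0 = if u = 0 then 1 else 0 := by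
  simp [shiftCoeff, coeff_one]

theorem shiftCoeff_zero_succ (a : F) (i : ℕ) : shiftCoeff a 0 (i + 1) = a * shiftCoeff a 0 i := by
  simp only [shiftCoeff, pow_succ']
  simp [add_mul]

theorem shiftCoeff_succ_succ (a : F) (u i : ℕ) :
    shiftCoeff a (u + 1) (i + 1) = shiftCoeff a u i + a * shiftCoeff a (u + 1) i := by
  simp only [shiftCoeff, pow_succ']
  simp [add_mul]

theorem shiftCoeff_eq_zero (a : F) {u i : ℕ} (h : i < u) : shiftCoeff a u i = 0 :=
  coeff_eq_zero_of_natDegree_lt (by rw [natDegree_pow, natDegree_X_add_C]; simpa using h)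

theorem shiftCoeff_zero_left (a : F) (i : ℕ) : shiftCoeff a 0 i = a ^ i := by
  simp [shiftCoeff, coeff_zero_eq_eval_zero]

/-- The binomial expansion in a range that does not depend on `j`, which allows sums over `j` and
`v` to be interchanged later. -/
theorem C_add_pow (b : F) (p : F[X]) {j D : ℕ} (hj : j < D) :
    (C b + p) ^ j = ∑ v ∈ Finset.range D, C (shiftCoeff b v j) * p ^ v := by
  have h1 : aeval p ((X + C b) ^ j) = (C b + p) ^ j := by
    simp [add_comm]
  rw [← h1, aeval_eq_sum_range' (n := D)]
  · simp [shiftCoeff, smul_eq_C_mul]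
  · rw [natDegree_pow, natDegree_X_add_C]; simpa using hj

/-- The polynomial `∑ N_{j,i} X^i f^j`. -/
noncomputable def subst (D W : ℕ) (N : ℕ → ℕ → F) (f : F[X]) : F[X] :=
  ∑ j ∈ Finset.range D, ∑ i ∈ Finset.range W, C (N j i) * X ^ i * f ^ j

/-- The hypothesis says that `N(X + a, Y + b)` has no terms of total degree below `μ`. As `f(X + a)
= b + X g`, a term `X^u Y^v` of it becomes `X^(u+v) g^v`, which is divisible by `X^μ`. -/
theorem X_sub_C_pow_dvd_subst {D μ : ℕ} {N : ℕ → ℕ → F} {f : F[X]} {a b : F} (hf : f.eval a = b)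
    (hN : ∀ u v, u + v < μ → ∑ j ∈ Finset.range D, ∑ i ∈ Finset.range D,
      N j i * shiftCoeff a u i * shiftCoeff b v j = 0) :
    (X - C a) ^ μ ∣ subst D D N f := by
  obtain ⟨g, hg⟩ : X ∣ f.comp (X + C a) - C b := by
    rw [X_dvd_iff, coeff_zero_eq_eval_zero]
    simp [hf]
  have hg' : f.comp (X + C a) = C b + X * g := by rw [← hg]; ring
  have h1 : (subst D D N f).comp (X + C a) =
      ∑ u ∈ Finset.range D, ∑ v ∈ Finset.range D,
        C (∑ j ∈ Finset.range D, ∑ i ∈ Finset.range D,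
          N j i * shiftCoeff a u i * shiftCoeff b v j) * (X ^ (u + v) * g ^ v) := by
    have h2 : (subst D D N f).comp (X + C a) = ∑ j ∈ Finset.range D, ∑ i ∈ Finset.range D,
        ∑ u ∈ Finset.range D, ∑ v ∈ Finset.range D,
          C (N j i * shiftCoeff a u i * shiftCoeff b v j) * (X ^ (u + v) * g ^ v) := by
      unfold subst
      rw [Polynomial.sum_comp]
      refine Finset.sum_congr rfl fun j hj => ?_
      rw [Polynomial.sum_comp]
      refine Finset.sum_congr rfl fun i hi => ?_
      rw [mul_comp, mul_comp, pow_comp, pow_comp, C_comp, X_comp, hg', add_comm X (C a),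
        C_add_pow a X (Finset.mem_range.1 hi), C_add_pow b _ (Finset.mem_range.1 hj),
        mul_assoc, Finset.sum_mul_sum, Finset.mul_sum]
      refine Finset.sum_congr rfl fun u _ => ?_
      rw [Finset.mul_sum]
      refine Finset.sum_congr rfl fun v _ => ?_
      simp only [C_mul]
      ring
    rw [h2]
    calc _ = ∑ j ∈ Finset.range D, ∑ u ∈ Finset.range D, ∑ v ∈ Finset.range D,
        ∑ i ∈ Finset.range D,
          C (N j i * shiftCoeff a u i * shiftCoeff b v j) * (X ^ (u + v) * g ^ v) := by
          refine Finset.sum_congr rfl fun j _ => ?_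
          rw [Finset.sum_comm]
          refine Finset.sum_congr rfl fun u _ => ?_
          rw [Finset.sum_comm]
      _ = _ := by
          rw [Finset.sum_comm]
          refine Finset.sum_congr rfl fun u _ => ?_
          rw [Finset.sum_comm]
          refine Finset.sum_congr rfl fun v _ => ?_
          simp only [map_sum, Finset.sum_mul]
  have h3 : X ^ μ ∣ (subst D D N f).comp (X + C a) := by
    rw [h1]
    refine Finset.dvd_sum fun u _ => Finset.dvd_sum fun v _ => ?_
    by_cases h : u + v < μ
    · rw [hN u v h]; simp
    · exact ((pow_dvd_pow X (not_lt.1 h)).mul_right _).mul_left _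
  obtain ⟨r, hr⟩ := h3
  refine ⟨r.comp (X - C a), ?_⟩
  have h4 := congrArg (fun p => p.comp (X - C a)) hr
  simpa [comp_assoc] using h4

theorem degree_subst_lt {D k : ℕ} {N : ℕ → ℕ → F} {f : F[X]} (hf : f.natDegree ≤ k)
    (hN : ∀ j i, N j i ≠ 0 → i + k * j < D) : (subst D D N f).degree < D := by
  unfold subst
  have h0 : (⊥ : WithBot ℕ) < D := WithBot.bot_lt_coe D
  have hsum : ∀ (s : Finset ℕ) (p : ℕ → F[X]), (∀ i ∈ s, (p i).degree < D) →
      (∑ i ∈ s, p i).degree < D := fun s p h =>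
    (degree_sum_le s p).trans_lt ((Finset.sup_lt_iff h0).2 h)
  refine hsum _ _ fun j _ => hsum _ _ fun i _ => ?_
  by_cases h : N j i = 0
  · simp [h]
  · refine (degree_le_natDegree).trans_lt ?_
    refine WithBot.coe_lt_coe.2 (lt_of_le_of_lt ?_ (hN j i h))
    refine natDegree_mul_le.trans (add_le_add (natDegree_C_mul_X_pow_le _ _) ?_)
    exact natDegree_pow_le.trans (by rw [mul_comm]; exact Nat.mul_le_mul_right j hf)

/-- Coprime powers of `X - a` all divide `N(X, f(X))`. Their product has degree at least `D`, more
than the degree of a nonzero `N(X, f(X))` allows. -/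
theorem subst_eq_zero [Fintype F] {D k : ℕ} {N : ℕ → ℕ → F} {f : F[X]}
    (hf : f.natDegree ≤ k) (hN : ∀ j i, N j i ≠ 0 → i + k * j < D) (μ : F → F → ℕ)
    (hc : ∀ a b u v, u + v < μ a b → ∑ j ∈ Finset.range D, ∑ i ∈ Finset.range D,
      N j i * shiftCoeff a u i * shiftCoeff b v j = 0)
    (hD : D ≤ ∑ a : F, μ a (f.eval a)) : subst D D N f = 0 := by
  by_contra hne
  have h1 : ∏ a : F, (X - C a) ^ μ a (f.eval a) ∣ subst D D N f := by
    refine Finset.prod_dvd_of_coprime ?_ fun a _ => X_sub_C_pow_dvd_subst rfl (hc a _)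
    intro a _ b _ hab
    exact (pairwise_coprime_X_sub_C Function.injective_id hab).pow
  have h2 := natDegree_le_of_dvd h1 hne
  have h3 : (subst D D N f).natDegree < D :=
    (natDegree_lt_iff_degree_lt hne).2 (degree_subst_lt hf hN)
  rw [natDegree_prod_of_monic _ _ fun a _ => (monic_X_sub_C a).pow _] at h2
  simp only [natDegree_pow, natDegree_X_sub_C, mul_one] at h2
  omega

end Interpolation

/-! ## Elimination -/

section Elimination

variable {F ι : Type*} [Field F]

/-- `A` indexes vectors `V g` that are supported on `S`, satisfy the linear equations `L`, and are
diagonal on `A`; at most `d` indices of `S` are missing. -/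
structure Eliminated (S : Finset ι) (L : Set ((ι → F) →ₗ[F] F)) (d : ℕ) (A : Finset ι)
    (V : ι → ι → F) : Prop where
  diag : ∀ g ∈ A, V g g ≠ 0
  off : ∀ g ∈ A, ∀ h ∈ A, g ≠ h → V g h = 0
  supp : ∀ g ∈ A, ∀ h, V g h ≠ 0 → h ∈ S
  eqs : ∀ g ∈ A, ∀ f ∈ L, f (V g) = 0
  card : S.card ≤ A.card + d

/-- The combination `f(V_p) V_g - f(V_g) V_p` is killed by `f` and needs no division. It stays
diagonal on the remaining indices because `V_p` vanishes on them. Each equation costs at most one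
index, so a vector survives whenever there are more indices than equations. -/
theorem Eliminated.pivot [DecidableEq ι] {S : Finset ι} {L : Set ((ι → F) →ₗ[F] F)} {d : ℕ} {A : Finset ι}
    {V : ι → ι → F} (h : Eliminated S L d A V) (f : (ι → F) →ₗ[F] F) {p : ι} (hp : p ∈ A)
    (hf : f (V p) ≠ 0) {V' : ι → ι → F}
    (hV : ∀ g ∈ A.erase p, V' g = f (V p) • V g - f (V g) • V p) :
    Eliminated S (insert f L) (d + 1) (A.erase p) V' where
  diag g hg := by
    have hg' := Finset.mem_erase.1 hg
    rw [hV g hg]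
    simp [h.off p hp g hg'.2 hg'.1.symm, hf, h.diag g hg'.2]
  off g hg g' hg' hne := by
    have h1 := Finset.mem_erase.1 hg
    have h2 := Finset.mem_erase.1 hg'
    rw [hV g hg]
    simp [h.off p hp g' h2.2 h2.1.symm, h.off g h1.2 g' h2.2 hne]
  supp g hg c hc := by
    have h1 := Finset.mem_erase.1 hg
    by_contra hS
    have h2 : V g c = 0 := not_imp_comm.1 (h.supp g h1.2 c) hS
    have h3 : V p c = 0 := not_imp_comm.1 (h.supp p hp c) hS
    rw [hV g hg] at hc
    simp [h2, h3] at hc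
  eqs g hg f' hf' := by
    have h1 := Finset.mem_erase.1 hg
    rw [hV g hg]
    rcases Set.mem_insert_iff.1 hf' with rfl | hf'
    · simp [mul_comm]
    · simp [h.eqs g h1.2 f' hf', h.eqs p hp f' hf']
  card := by
    have h1 := h.card
    have h2 := Finset.card_erase_add_one hp
    omega

theorem Eliminated.noPivot {S : Finset ι} {L : Set ((ι → F) →ₗ[F] F)} {d : ℕ} {A : Finset ι}
    {V : ι → ι → F} (h : Eliminated S L d A V) (f : (ι → F) →ₗ[F] F)
    (hf : ∀ g ∈ A, f (V g) = 0) : Eliminated S (insert f L) (d + 1) A V where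
  diag := h.diag
  off := h.off
  supp := h.supp
  eqs g hg f' hf' := by
    rcases Set.mem_insert_iff.1 hf' with rfl | hf'
    · exact hf g hg
    · exact h.eqs g hg f' hf'
  card := by have := h.card; omega

end Elimination

/-! ## Roots of bivariate polynomials -/

section Roots

variable {F : Type*} [Field F]

/-- The coefficients of `N(X, X Y + b)`; the first index is the exponent of `Y`. -/
noncomputable def shiftStep (D : ℕ) (b : F) (N : ℕ → ℕ → F) (v i : ℕ) : F :=
  if v ≤ i then ∑ j ∈ Finset.range D, shiftCoeff b v j * N j (i - v) else 0

/-- The powers of `X` are not divided out, so the range of exponents grows by `D` with every step.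
-/
theorem shiftStep_support {D W : ℕ} (b : F) {N : ℕ → ℕ → F}
    (hN : ∀ j i, N j i ≠ 0 → j < D ∧ i < W) {v i : ℕ} (h : shiftStep D b N v i ≠ 0) :
    v < D ∧ i < W + D := by
  unfold shiftStep at h
  split_ifs at h with hvi
  · obtain ⟨j, hj, hj'⟩ := Finset.exists_ne_zero_of_sum_ne_zero h
    have h1 := hN j (i - v) (right_ne_zero_of_mul hj')
    have h2 : ¬ j < v := fun hlt => left_ne_zero_of_mul hj' (shiftCoeff_eq_zero b hlt)
    omega
  · exact absurd rfl h

/-- If `b + X f` is a root in `Y` of the old polynomial, then `f` is a root of the new one: one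
coefficient is split off and the problem keeps its form. -/
theorem subst_C_add_X_mul {D W : ℕ} (b : F) {N : ℕ → ℕ → F}
    (hN : ∀ j i, N j i ≠ 0 → j < D ∧ i < W) (f : F[X]) :
    subst D (W + D) (shiftStep D b N) f = subst D W N (C b + X * f) := by
  have h1 : subst D W N (C b + X * f) = ∑ v ∈ Finset.range D, ∑ i ∈ Finset.range W,
      C (∑ j ∈ Finset.range D, shiftCoeff b v j * N j i) * X ^ (i + v) * f ^ v := by
    unfold subst
    have : ∀ j ∈ Finset.range D, ∑ i ∈ Finset.range W, C (N j i) * X ^ i * (C b + X * f) ^ j =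
        ∑ v ∈ Finset.range D, ∑ i ∈ Finset.range W,
          C (shiftCoeff b v j * N j i) * X ^ (i + v) * f ^ v := by
      intro j hj
      rw [Finset.sum_comm]
      refine Finset.sum_congr rfl fun i _ => ?_
      rw [C_add_pow b _ (Finset.mem_range.1 hj), Finset.mul_sum]
      refine Finset.sum_congr rfl fun v _ => ?_
      rw [C_mul]
      ring
    rw [Finset.sum_congr rfl this, Finset.sum_comm]
    refine Finset.sum_congr rfl fun v _ => ?_
    rw [Finset.sum_comm]
    refine Finset.sum_congr rfl fun i _ => ?_
    simp only [map_sum, Finset.sum_mul]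
  rw [h1]
  unfold subst
  refine Finset.sum_congr rfl fun v hv => ?_
  have hv := Finset.mem_range.1 hv
  have h2 : ∑ i ∈ Finset.range W,
      C (∑ j ∈ Finset.range D, shiftCoeff b v j * N j i) * X ^ (i + v) * f ^ v =
      ∑ i ∈ (Finset.range W).map (addRightEmbedding v),
        C (shiftStep D b N v i) * X ^ i * f ^ v := by
    rw [Finset.sum_map]
    refine Finset.sum_congr rfl fun i _ => ?_
    simp [shiftStep]
  rw [h2]
  symm
  refine Finset.sum_subset ?_ ?_
  · intro i hi
    simp only [Finset.mem_map, Finset.mem_range, addRightEmbedding_apply] at hi ⊢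
    obtain ⟨a, ha, rfl⟩ := hi
    omega
  · intro i _ hi
    simp only [Finset.mem_map, Finset.mem_range, addRightEmbedding_apply, not_exists, not_and] at hi
    have : shiftStep D b N v i = 0 := by
      unfold shiftStep
      split_ifs with hvi
      · refine Finset.sum_eq_zero fun j _ => ?_
        by_cases h : N j (i - v) = 0
        · rw [h, mul_zero]
        · exact absurd (Nat.sub_add_cancel hvi) (hi (i - v) (hN _ _ h).2)
      · rfl
    simp [this]

/-- `s` is the least exponent of `X` in the terms of `N`. -/
def IsOrder (N : ℕ → ℕ → F) (s : ℕ) : Prop := (∃ j, N j s ≠ 0) ∧ ∀ i < s, ∀ j, N j i = 0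

theorem IsOrder.unique {N : ℕ → ℕ → F} {s s' : ℕ} (h : IsOrder N s) (h' : IsOrder N s') :
    s = s' := by
  obtain ⟨⟨j, hj⟩, h1⟩ := h
  obtain ⟨⟨j', hj'⟩, h1'⟩ := h'
  rcases lt_trichotomy s s' with hlt | heq | hlt
  · exact absurd (h1' s hlt j) hj
  · exact heq
  · exact absurd (h1 s' hlt j') hj'

theorem exists_isOrder {N : ℕ → ℕ → F} (h : ∃ j i, N j i ≠ 0) : ∃ s, IsOrder N s := by
  classical
  have h' : ∃ i, ∃ j, N j i ≠ 0 := by obtain ⟨j, i, h⟩ := h; exact ⟨i, j, h⟩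
  refine ⟨Nat.find h', Nat.find_spec h', fun i hi j => ?_⟩
  have := Nat.find_min h' hi
  push Not at this
  exact this j

/-- The coefficient of `X ^ s`, a polynomial in `Y`. -/
noncomputable def slice (D : ℕ) (N : ℕ → ℕ → F) (s : ℕ) : F[X] :=
  ∑ j ∈ Finset.range D, C (N j s) * X ^ j

theorem coeff_slice (D : ℕ) (N : ℕ → ℕ → F) (s j : ℕ) :
    (slice D N s).coeff j = if j < D then N j s else 0 := by
  simp [slice, coeff_C_mul, coeff_X_pow]

theorem eval_slice (D : ℕ) (N : ℕ → ℕ → F) (s : ℕ) (b : F) :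
    (slice D N s).eval b = ∑ j ∈ Finset.range D, N j s * b ^ j := by
  simp [slice, eval_finsetSum]

/-- In the coefficient of `X^s` of `N(X, b + X f)` only the terms with exponent exactly `s`
contribute, each through the constant term `b^j` of `(b + X f)^j`. -/
theorem slice_eval_eq_zero {D W : ℕ} {N : ℕ → ℕ → F} (hN : ∀ j i, N j i ≠ 0 → j < D ∧ i < W)
    {s : ℕ} (hs : IsOrder N s) {b : F} {f : F[X]} (h : subst D W N (C b + X * f) = 0) :
    (slice D N s).eval b = 0 := by
  have h1 : (subst D W N (C b + X * f)).coeff s = ∑ j ∈ Finset.range D, N j s * b ^ j := by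
    unfold subst
    rw [finsetSum_coeff]
    refine Finset.sum_congr rfl fun j _ => ?_
    rw [finsetSum_coeff]
    have hc : ∀ i, (C (N j i) * X ^ i * (C b + X * f) ^ j).coeff s =
        if i = s then N j s * b ^ j else 0 := by
      intro i
      rw [mul_assoc, coeff_C_mul, coeff_X_pow_mul']
      rcases lt_trichotomy i s with hlt | rfl | hlt
      · rw [hs.2 i hlt j]; simp [hlt.ne]
      · simp [coeff_zero_eq_eval_zero]
      · simp [hlt.ne', not_le.2 hlt]
    simp only [hc]
    rw [Finset.sum_ite_eq']
    split_ifs with hW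
    · rfl
    · by_cases h0 : N j s = 0
      · simp [h0]
      · exact absurd (Finset.mem_range.2 (hN j s h0).2) hW
  rw [eval_slice, ← h1, h, coeff_zero]

theorem coeff_slice_comp (D : ℕ) (N : ℕ → ℕ → F) (s v : ℕ) (b : F) :
    ((slice D N s).comp (X + C b)).coeff v =
      ∑ j ∈ Finset.range D, shiftCoeff b v j * N j s := by
  rw [slice, Polynomial.sum_comp, finsetSum_coeff]
  refine Finset.sum_congr rfl fun j _ => ?_
  rw [mul_comp, C_comp, pow_comp, X_comp, coeff_C_mul, shiftCoeff, mul_comm]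

/-- The potential argument behind the size of the search tree. Let `h` be the multiplicity of the
root `b`. The coefficient of `X^(s+h) Y^h` in `N(X, XY + b)` is the lowest nonzero coefficient of
the slice shifted by `b`, so the new order is at most `s + h`. A term `X^(s') Y^v` comes from terms
with `X`-exponent `s' - v ≥ s`, hence `v ≤ h`. -/
theorem exists_isOrder_shiftStep {D W : ℕ} {N : ℕ → ℕ → F}
    (hN : ∀ j i, N j i ≠ 0 → j < D ∧ i < W) {s : ℕ} (hs : IsOrder N s) (b : F) :
    ∃ s', IsOrder (shiftStep D b N) s' ∧
      (slice D (shiftStep D b N) s').natDegree ≤ (slice D N s).rootMultiplicity b := by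
  set p := slice D N s with hp
  have hp0 : p ≠ 0 := by
    obtain ⟨j, hj⟩ := hs.1
    intro h0
    have := coeff_slice D N s j
    rw [← hp, h0, if_pos (hN j s hj).1] at this
    exact hj this.symm
  set h := p.rootMultiplicity b with hh
  have hroot : h = (p.comp (X + C b)).natTrailingDegree := rootMultiplicity_eq_natTrailingDegree
  have hcne : p.comp (X + C b) ≠ 0 := by
    intro h0
    apply hp0
    have := congrArg (fun r => r.comp (X - C b)) h0
    simpa [comp_assoc] using this
  have h1 : shiftStep D b N h (s + h) ≠ 0 := by
    have h2 : (p.comp (X + C b)).coeff h ≠ 0 := by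
      rw [hroot]
      exact mem_support_iff.1 (natTrailingDegree_mem_support_of_nonzero hcne)
    rw [hp, coeff_slice_comp] at h2
    simpa [shiftStep] using h2
  obtain ⟨s', hs'⟩ := exists_isOrder ⟨h, s + h, h1⟩
  refine ⟨s', hs', ?_⟩
  have hle : s' ≤ s + h := by
    by_contra hlt
    exact h1 (hs'.2 _ (by omega) _)
  rw [natDegree_le_iff_coeff_eq_zero]
  intro v hv
  rw [coeff_slice]
  split_ifs
  · unfold shiftStep
    split_ifs with hvs
    · refine Finset.sum_eq_zero fun j _ => ?_
      -- Here `v > h` and `s' ≤ s + h`, so `s' - v` lies below the order `s`.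
      rw [hs.2 (s' - v) (by omega) j, mul_zero]
    · rfl
  · rfl

end Roots

/-! ### The search tree -/

section Tree

variable {q : ℕ} [Fact q.Prime]

open Classical in
/-- The least exponent of `X` in the terms of `N`, if any. -/
noncomputable def order (N : ℕ → ℕ → ZMod q) : ℕ :=
  if h : ∃ s, IsOrder N s then h.choose else 0

theorem IsOrder.order_eq {N : ℕ → ℕ → ZMod q} {s : ℕ} (h : IsOrder N s) : order N = s := by
  have h' : ∃ s, IsOrder N s := ⟨s, h⟩
  rw [order, dif_pos h']
  exact h'.choose_spec.unique h

/-- The polynomial at the node `g` of the search tree with the polynomial `N` at its root. -/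
noncomputable def node (D : ℕ) (N : ℕ → ℕ → ZMod q) (g : List ℕ) : ℕ → ℕ → ZMod q :=
  g.foldl (fun N b => shiftStep D (b : ZMod q) N) N

/-- The lowest slice at a node. -/
noncomputable def nodeSlice (D : ℕ) (N : ℕ → ℕ → ZMod q) (g : List ℕ) : (ZMod q)[X] :=
  slice D (node D N g) (order (node D N g))

open Classical in
/-- The children of a node. -/
noncomputable def children (D : ℕ) (N : ℕ → ℕ → ZMod q) (g : List ℕ) : List (List ℕ) :=
  ((List.range q).filter fun b : ℕ => (nodeSlice D N g).eval (b : ZMod q) = 0).map fun b : ℕ => g ++ [b]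

/-- The nodes at depth `d`. -/
noncomputable def level (D : ℕ) (N : ℕ → ℕ → ZMod q) : ℕ → List (List ℕ)
  | 0 => [[]]
  | d + 1 => (level D N d).flatMap (children D N)

theorem node_append (D : ℕ) (N : ℕ → ℕ → ZMod q) (g : List ℕ) (b : ℕ) :
    node D N (g ++ [b]) = shiftStep D (b : ZMod q) (node D N g) := by
  simp [node]

theorem node_support {D W : ℕ} {N : ℕ → ℕ → ZMod q} (hN : ∀ j i, N j i ≠ 0 → j < D ∧ i < W)
    (g : List ℕ) : ∀ j i, node D N g j i ≠ 0 → j < D ∧ i < W + g.length * D := by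
  induction g using List.reverseRecOn with
  | nil => simpa [node] using hN
  | append_singleton g b ih =>
    intro j i h
    rw [node_append] at h
    have := shiftStep_support _ ih h
    simp only [List.length_append, List.length_singleton, add_mul, one_mul]
    omega

theorem node_isOrder {D W : ℕ} {N : ℕ → ℕ → ZMod q} (hN : ∀ j i, N j i ≠ 0 → j < D ∧ i < W)
    (h0 : ∃ j i, N j i ≠ 0) (g : List ℕ) : IsOrder (node D N g) (order (node D N g)) := by
  have : ∃ s, IsOrder (node D N g) s := by
    induction g using List.reverseRecOn with
    | nil => exact exists_isOrder h0
    | append_singleton g b ih =>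
      obtain ⟨s, hs⟩ := ih
      obtain ⟨s', hs', -⟩ := exists_isOrder_shiftStep (node_support hN g) hs (b : ZMod q)
      exact ⟨s', by rwa [node_append]⟩
  obtain ⟨s, hs⟩ := this
  rwa [hs.order_eq]

theorem nodeSlice_ne_zero {D W : ℕ} {N : ℕ → ℕ → ZMod q} (hN : ∀ j i, N j i ≠ 0 → j < D ∧ i < W)
    (h0 : ∃ j i, N j i ≠ 0) (g : List ℕ) : nodeSlice D N g ≠ 0 := by
  obtain ⟨j, hj⟩ := (node_isOrder hN h0 g).1
  intro h
  have := coeff_slice D (node D N g) (order (node D N g)) j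
  rw [if_pos (node_support hN g _ _ hj).1] at this
  rw [nodeSlice] at h
  rw [h, coeff_zero] at this
  exact hj this.symm

theorem natDegree_nodeSlice_append {D W : ℕ} {N : ℕ → ℕ → ZMod q}
    (hN : ∀ j i, N j i ≠ 0 → j < D ∧ i < W) (h0 : ∃ j i, N j i ≠ 0) (g : List ℕ) (b : ℕ) :
    (nodeSlice D N (g ++ [b])).natDegree ≤ (nodeSlice D N g).rootMultiplicity (b : ZMod q) := by
  obtain ⟨s', hs', h⟩ := exists_isOrder_shiftStep (node_support hN g) (node_isOrder hN h0 g)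
    (b : ZMod q)
  rw [nodeSlice, node_append, hs'.order_eq]
  exact h

theorem sum_range_natCast (f : ZMod q → ℕ) :
    ∑ i ∈ Finset.range q, f (i : ZMod q) = ∑ a : ZMod q, f a := by
  have : NeZero q := ⟨(Fact.out : q.Prime).ne_zero⟩
  refine Finset.sum_nbij' (fun i => (i : ZMod q)) ZMod.val (by simp)
    (fun a _ => Finset.mem_range.2 (ZMod.val_lt a)) ?_ (by simp) (by simp)
  intro i hi
  exact ZMod.val_cast_of_lt (Finset.mem_range.1 hi)

/-- The representatives `0, …, q-1` run through the field once, and a polynomial has at most as many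
roots, with multiplicity, as its degree. -/
theorem sum_rootMultiplicity_le (p : (ZMod q)[X]) (P : ℕ → Bool) :
    (((List.range q).filter P).map fun b : ℕ => p.rootMultiplicity (b : ZMod q)).sum ≤
      p.natDegree := by
  classical
  have h1 : (((List.range q).filter P).map fun b : ℕ => p.rootMultiplicity (b : ZMod q)).sum ≤
      ((List.range q).map fun b : ℕ => p.rootMultiplicity (b : ZMod q)).sum :=
    ((List.filter_sublist).map _).sum_le_sum (by simp)
  refine h1.trans ?_
  change ∑ b ∈ Finset.range q, p.rootMultiplicity (b : ZMod q) ≤ _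
  rw [sum_range_natCast fun b => p.rootMultiplicity b]
  simp only [← count_roots]
  rw [Multiset.sum_count_eq_card fun a _ => Finset.mem_univ a]
  exact card_roots' p

/-- Both numbers are controlled by root multiplicities of the slice at the parent: each child
accounts for at least 1, and the degree at a child is at most the multiplicity of its root. -/
theorem children_bound {D W : ℕ} {N : ℕ → ℕ → ZMod q} (hN : ∀ j i, N j i ≠ 0 → j < D ∧ i < W)
    (h0 : ∃ j i, N j i ≠ 0) (g : List ℕ) :
    (children D N g).length ≤ (nodeSlice D N g).natDegree ∧
    ((children D N g).map fun g' => (nodeSlice D N g').natDegree).sum ≤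
      (nodeSlice D N g).natDegree := by
  classical
  constructor
  · refine le_trans ?_ (sum_rootMultiplicity_le _
      fun b => decide ((nodeSlice D N g).eval (b : ZMod q) = 0))
    rw [children, List.length_map]
    refine le_trans ?_ (List.card_nsmul_le_sum _ 1 ?_)
    · simp
    · intro x hx
      obtain ⟨b, hb, rfl⟩ := List.mem_map.1 hx
      have hb := (List.mem_filter.1 hb).2
      exact (rootMultiplicity_pos (nodeSlice_ne_zero hN h0 g)).2 (by simpa using hb)
  · refine le_trans ?_ (sum_rootMultiplicity_le _
      fun b => decide ((nodeSlice D N g).eval (b : ZMod q) = 0))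
    rw [children, List.map_map]
    exact List.sum_le_sum fun b _ => natDegree_nodeSlice_append hN h0 g b

theorem natDegree_slice_lt {D : ℕ} (hD : 0 < D) (N : ℕ → ℕ → ZMod q) (s : ℕ) :
    (slice D N s).natDegree < D := by
  have : (slice D N s).natDegree ≤ D - 1 := by
    rw [natDegree_le_iff_coeff_eq_zero]
    intro v hv
    rw [coeff_slice, if_neg (by omega)]
  omega

/-- The total degree of the slices does not increase from one level to the next. This keeps the tree
from growing exponentially with the depth. -/
theorem level_degree_sum {D W : ℕ} {N : ℕ → ℕ → ZMod q} (hN : ∀ j i, N j i ≠ 0 → j < D ∧ i < W)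
    (h0 : ∃ j i, N j i ≠ 0) (d : ℕ) :
    ((level D N d).map fun g => (nodeSlice D N g).natDegree).sum ≤ D := by
  have hD : 0 < D := by
    obtain ⟨j, i, h⟩ := h0
    have := (hN j i h).1
    omega
  induction d with
  | zero => simpa [level, nodeSlice] using (natDegree_slice_lt hD _ _).le
  | succ d ih =>
    refine le_trans ?_ ih
    rw [level]
    generalize level D N d = l
    induction l with
    | nil => simp
    | cons g l ihl =>
      simp only [List.flatMap_cons, List.map_append, List.sum_append, List.map_cons, List.sum_cons]
      exact add_le_add (children_bound hN h0 g).2 ihl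

theorem length_level_le {D W : ℕ} {N : ℕ → ℕ → ZMod q} (hN : ∀ j i, N j i ≠ 0 → j < D ∧ i < W)
    (h0 : ∃ j i, N j i ≠ 0) (d : ℕ) : (level D N d).length ≤ D := by
  cases d with
  | zero =>
    obtain ⟨j, i, h⟩ := h0
    have := (hN j i h).1
    simp only [level, List.length_singleton]
    omega
  | succ d =>
    refine le_trans ?_ (level_degree_sum hN h0 d)
    rw [level]
    generalize level D N d = l
    induction l with
    | nil => simp
    | cons g l ihl =>
      simp only [List.flatMap_cons, List.length_append, List.map_cons, List.sum_cons]
      exact add_le_add (children_bound hN h0 g).1 ihl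

theorem level_spec (D : ℕ) (N : ℕ → ℕ → ZMod q) (d : ℕ) :
    ∀ g ∈ level D N d, g.length = d ∧ ∀ b ∈ g, b < q := by
  induction d with
  | zero => simp [level]
  | succ d ih =>
    intro g hg
    simp only [level, List.mem_flatMap, children, List.mem_map, List.mem_filter,
      List.mem_range] at hg
    obtain ⟨g0, hg0, b, hb, rfl⟩ := hg
    have := ih g0 hg0
    simp only [List.length_append, List.length_singleton, List.mem_append, List.mem_singleton]
    refine ⟨by omega, ?_⟩
    rintro c (hc | rfl)
    · exact this.2 c hc
    · exact hb.1

/-- The polynomial with the given coefficients. -/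
noncomputable def ofCoeffs (cs : List (ZMod q)) : (ZMod q)[X] :=
  cs.foldr (fun c p => C c + X * p) 0

theorem ofCoeffs_ofFn {n : ℕ} (x : Fin n → ZMod q) :
    ofCoeffs (List.ofFn x) = ∑ i : Fin n, C (x i) * X ^ (i : ℕ) := by
  induction n with
  | zero => simp [ofCoeffs]
  | succ n ih =>
    rw [List.ofFn_succ, ofCoeffs, List.foldr_cons, ← ofCoeffs, ih, Fin.sum_univ_succ,
      Finset.mul_sum]
    simp only [Fin.val_zero, pow_zero, mul_one, Fin.val_succ]
    congr 1
    refine Finset.sum_congr rfl fun i _ => ?_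
    ring

/-- Induction on the coefficients not yet found: the lowest one is a root of the slice, so the
search descends to it, and the others form a root of the polynomial at that child. -/
theorem mem_level_of_subst_eq_zero {D W : ℕ} {N : ℕ → ℕ → ZMod q}
    (hN : ∀ j i, N j i ≠ 0 → j < D ∧ i < W) (h0 : ∃ j i, N j i ≠ 0) (cs : List (ZMod q))
    (d : ℕ) (g : List ℕ) (hg : g ∈ level D N d)
    (h : subst D (W + g.length * D) (node D N g) (ofCoeffs cs) = 0) :
    g ++ cs.map ZMod.val ∈ level D N (d + cs.length) := by
  have : NeZero q := ⟨(Fact.out : q.Prime).ne_zero⟩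
  induction cs generalizing d g with
  | nil => simpa using hg
  | cons c cs ih =>
    have h1 : ofCoeffs (c :: cs) = C c + X * ofCoeffs cs := rfl
    rw [h1] at h
    have h2 := slice_eval_eq_zero (node_support hN g) (node_isOrder hN h0 g) h
    have h3 := ih (d + 1) (g ++ [c.val]) ?_ ?_
    · simpa [add_assoc, add_comm 1] using h3
    · rw [level, List.mem_flatMap]
      refine ⟨g, hg, ?_⟩
      simp only [children, List.mem_map, List.mem_filter, List.mem_range, decide_eq_true_eq]
      exact ⟨c.val, ⟨ZMod.val_lt c, by simpa [nodeSlice] using h2⟩, rfl⟩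
    · rw [node_append]
      have h4 := subst_C_add_X_mul c (node_support hN g) (ofCoeffs cs)
      rw [h] at h4
      simpa [add_mul, add_assoc] using h4

end Tree

end ListDecoder

namespace ListDecoder

open Polynomial

/-! ## The decoding program -/

namespace Cmd

/-! ### Loop rules: frames, filling of arrays, sums, searches -/

/-- The variables other than `x`, the arrays and the output that `c` does not change are the same in
both states. -/
structure Frame (c : Cmd) (x : ℕ) (s s' : MState) : Prop where
  vars : ∀ z, z ≠ x → c.wv z = false → s'.vars z = s.vars z
  arr : ∀ k < 16, c.wa k = false → rd s' k = rd s k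
  out : c.silent = true → s'.out = s.out

variable {q l m : ℕ} (U : Matrix (Block q l m) (Block q l m) ℂ)

theorem run_seq (c d : Cmd) (s : MState) : run U (c ;; d) s = run U d (run U c s) := rfl

theorem run_set (x md : ℕ) (e : Expr) (s : MState) :
    run U (set x md e) s = setV s x (e.eval s % s.vars md) := rfl

theorem run_put (k md : ℕ) (a b c d e : Expr) (s : MState) :
    run U (put k md a b c d e) s =
      setC s k (a.eval s) (b.eval s) (c.eval s) (d.eval s) (e.eval s % s.vars md) := rfl

theorem run_rep_frame (I : ℕ → MState → Prop) {x y : ℕ} {c : Cmd} (hx : c.wv x = false)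
    (hw : c.wf = true) {s : MState} (h0 : I 0 (setV s x 0))
    (hstep : ∀ i < s.vars y, ∀ s', Frame c x s s' → s'.vars x = i → I i s' →
      I (i + 1) (setV (run U c s') x (i + 1))) :
    I (s.vars y) (run U (rep x y c) s) := by
  refine (run_rep U (fun i s' => I i s' ∧ Frame c x s s') hx
    ⟨h0, ⟨fun z hz _ => by simp [hz], fun _ _ _ => rfl, fun _ => rfl⟩⟩ ?_).1
  rintro i hi s' ⟨h1, h2⟩ h3
  refine ⟨hstep i hi s' h2 h3 h1, ?_, ?_, ?_⟩
  · intro z hz hz'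
    simp [hz, run_vars U c hz', h2.vars z hz hz']
  · intro k hk hk'
    simp [run_rd U c hw hk hk', h2.arr k hk hk']
  · intro hs
    simp [run_out U c hs, h2.out hs]

/-- A loop that fills cells of the array `k`: the `i`-th round fills the cells in `dom i` with the
values given by `new`. -/
theorem run_rep_fill (k : ℕ) (dom : ℕ → ℕ → ℕ → ℕ → ℕ → Prop) (new : ℕ → ℕ → ℕ → ℕ → ℕ → Prop)
    {x y : ℕ} {c : Cmd} (hx : c.wv x = false) (hw : c.wf = true) {s : MState}
    (hstep : ∀ i < s.vars y, ∀ s', Frame c x s s' → s'.vars x = i →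
      (∀ a b c d, (¬ ∃ i' < i, dom i' a b c d) → rd s' k a b c d = rd s k a b c d) →
      (∀ a b c d, (∃ i' < i, dom i' a b c d) → new a b c d (rd s' k a b c d)) →
      ∀ a b e d, (dom i a b e d → new a b e d (rd (run U c s') k a b e d)) ∧
        (¬ dom i a b e d → rd (run U c s') k a b e d = rd s' k a b e d)) (a b e d : ℕ) :
    ((∃ i < s.vars y, dom i a b e d) → new a b e d (rd (run U (rep x y c) s) k a b e d)) ∧
    ((¬ ∃ i < s.vars y, dom i a b e d) →
      rd (run U (rep x y c) s) k a b e d = rd s k a b e d) := by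
  have := run_rep_frame U (fun i s' => ∀ a b e d,
    ((∃ i' < i, dom i' a b e d) → new a b e d (rd s' k a b e d)) ∧
    ((¬ ∃ i' < i, dom i' a b e d) → rd s' k a b e d = rd s k a b e d)) (y := y) hx hw (s := s)
    (by simp) ?_
  · exact this a b e d
  · intro i hi s' hf hxi hI a b e d
    have h1 := hstep i hi s' hf hxi (fun a b c d => (hI a b c d).2) (fun a b c d => (hI a b c d).1)
      a b e d
    rw [setV_rd]
    constructor
    · rintro ⟨i', hi', hd⟩
      by_cases hdi : dom i a b e d
      · exact h1.1 hdi
      · rw [h1.2 hdi]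
        refine (hI a b e d).1 ⟨i', ?_, hd⟩
        rcases Nat.lt_succ_iff_lt_or_eq.1 hi' with h | rfl
        · exact h
        · exact absurd hd hdi
    · intro hn
      push Not at hn
      rw [h1.2 (hn i (by omega))]
      refine (hI a b e d).2 ?_
      push Not
      exact fun i' hi' => hn i' (by omega)

/-- A double loop that fills cells of the array `k`. -/
theorem run_rep_rep_fill (k : ℕ) (new : ℕ → ℕ → ℕ → Prop) {x y x' y' : ℕ} {c : Cmd}
    (hx : c.wv x = false) (hx' : c.wv x' = false) (hy' : c.wv y' = false) (hxx' : x' ≠ x)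
    (hxy' : y' ≠ x) (hxy : y' ≠ x') (hx1' : x' ≠ 1 ∧ x' ≠ 5)
    (hw : c.wf = true) {s : MState}
    (hstep : ∀ a < s.vars y, ∀ b < s.vars y', ∀ s',
      (∀ z, z ≠ x → z ≠ x' → c.wv z = false → s'.vars z = s.vars z) →
      (∀ j < 16, c.wa j = false → rd s' j = rd s j) → s'.vars x = a → s'.vars x' = b →
      -- The cell about to be written still has its original contents, which makes the rule usable
      -- for updates in place.
      rd s' k a b 0 0 = rd s k a b 0 0 →
      ∃ w, new a b w ∧ ∀ a' b' e d, rd (run U c s') k a' b' e d =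
        if a' = a ∧ b' = b ∧ e = 0 ∧ d = 0 then w else rd s' k a' b' e d)
    {a b : ℕ} (ha : a < s.vars y) (hb : b < s.vars y') :
    new a b (rd (run U (rep x y (rep x' y' c)) s) k a b 0 0) := by
  have hw' : (rep x' y' c).wf = true := by
    simp [wf, hx', hy', hw, hx1', Ne.symm hxy]
  have hxr : (rep x' y' c).wv x = false := by simp [wv, hx, hxx']
  have key := run_rep_fill U k (fun a a' b e d => a' = a ∧ b < s.vars y' ∧ e = 0 ∧ d = 0)
    (fun a b _ _ w => new a b w) (x := x) (y := y) (c := rep x' y' c) hxr hw' (s := s) ?_ a b 0 0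
  · exact key.1 ⟨a, ha, rfl, hb, rfl, rfl⟩
  intro a ha s1 hf1 ha1 hun1 _ a' b' e d
  have e1 : s1.vars y' = s.vars y' := hf1.vars y' hxy' (by simp [wv, hy', Ne.symm hxy])
  have key := run_rep_fill U k (fun b a' b' e d => a' = a ∧ b' = b ∧ e = 0 ∧ d = 0)
    (fun a b _ _ w => new a b w) (x := x') (y := y') (c := c) hx' hw (s := s1) ?_ a' b' e d
  · constructor
    · rintro ⟨h1, h2, h3, h4⟩
      exact key.1 ⟨b', by omega, h1, rfl, h3, h4⟩
    · intro h
      refine key.2 ?_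
      rintro ⟨b, hb, h1, rfl, h3, h4⟩
      exact h ⟨h1, by omega, h3, h4⟩
  intro b hb s2 hf2 hb2 hun2 _ a' b' e d
  obtain ⟨w, hw1, hw2⟩ := hstep a ha b (by omega) s2
    (fun z h1 h2 h3 => (hf2.vars z h2 h3).trans (hf1.vars z h1 (by simp [wv, h3, h2.symm])))
    (fun j hj h => (hf2.arr j hj h).trans (hf1.arr j hj (by simpa [wa] using h)))
    ((hf2.vars x (Ne.symm hxx') hx).trans ha1) hb2
    ((hun2 a b 0 0 (by rintro ⟨_, _, _, h, _⟩; omega)).trans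
      (hun1 a b 0 0 (by rintro ⟨_, _, h, _⟩; omega)))
  constructor
  · rintro ⟨rfl, rfl, rfl, rfl⟩
    simpa [hw2] using hw1
  · intro h
    rw [hw2, if_neg h]

/-- `acc := acc + ∑ e` over the values of the variable `x` less than that of `y`, modulo the
variable 1. -/
def accum (acc x y : ℕ) (e : Expr) : Cmd := rep x y (set acc 1 (.add (.var acc) e))

/-- The reduction modulo `q` in every round is invisible in `ZMod q`, so only the residue class of
the accumulator is tracked. -/
theorem run_accum [NeZero q] {acc x y : ℕ} {e : Expr} (hx : acc ≠ x) (h1 : acc ≠ 1)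
    (hx1 : x ≠ 1) {s : MState} (hq : s.vars 1 = q) (f : ℕ → ZMod q)
    (he : ∀ i < s.vars y, ∀ s', (∀ z, z ≠ x → z ≠ acc → s'.vars z = s.vars z) → rd s' = rd s →
      s'.vars x = i → (e.eval s' : ZMod q) = f i) :
    ((run U (accum acc x y e) s).vars acc : ZMod q) =
      s.vars acc + ∑ i ∈ Finset.range (s.vars y), f i := by
  unfold accum
  refine (run_rep U (fun i s' => (s'.vars acc : ZMod q) = s.vars acc + ∑ i ∈ Finset.range i, f i ∧
    (∀ z, z ≠ x → z ≠ acc → s'.vars z = s.vars z) ∧ rd s' = rd s) (y := y) (by simpa [wv] using hx)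
    ?_ ?_).1
  · refine ⟨by simp [hx], fun z hz _ => by simp [hz], rfl⟩
  · rintro i hi s' ⟨h2, h3, h4⟩ h6
    refine ⟨?_, ?_, ?_⟩
    · simp [run, hx, h3 1 hx1.symm h1.symm, hq, ZMod.natCast_mod, h2, he i hi s' h3 h4 h6,
        Finset.sum_range_succ, add_assoc]
    · intro z hz hz'
      simp [run, hz, hz', h3 z hz hz']
    · simp [run, h4]

/-- A command without effect on the variables and arrays in use. -/
def nop : Cmd := set 39 5 (.const 0)

/-- Search for the last index that satisfies a condition. -/
theorem run_search {e : Expr} {N : ℕ} {s : MState} (h11 : s.vars 11 = N) (hB : N < s.vars 5)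
    (P : ℕ → Prop)
    (he : ∀ g < N, ∀ s', (∀ z, z ≠ 30 → z ≠ 33 → z ≠ 39 → s'.vars z = s.vars z) → rd s' = rd s →
      s'.vars 30 = g → (e.eval s' ≠ 0 ↔ P g)) :
    ((run U (set 33 5 (.const 0) ;;
        rep 30 11 (ite e (set 33 5 (.add (.var 30) (.const 1))) nop)) s).vars 33 = 0 ∧
      ∀ g < N, ¬ P g) ∨
    ∃ p < N, (run U (set 33 5 (.const 0) ;;
        rep 30 11 (ite e (set 33 5 (.add (.var 30) (.const 1))) nop)) s).vars 33 = p + 1 ∧ P p := by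
  have hs1 : run U (set 33 5 (.const 0)) s = setV s 33 0 := by simp [run]
  have h11' : (setV s 33 0).vars 11 = N := by simp [h11]
  rw [run, hs1]
  have key := run_rep U (fun i s' => ((s'.vars 33 = 0 ∧ ∀ g < i, ¬ P g) ∨
      ∃ p < i, s'.vars 33 = p + 1 ∧ P p) ∧
      (∀ z, z ≠ 30 → z ≠ 33 → z ≠ 39 → s'.vars z = s.vars z) ∧ rd s' = rd s)
    (x := 30) (y := 11) (c := ite e (set 33 5 (.add (.var 30) (.const 1))) nop) rfl
    (s := setV s 33 0) ?_ ?_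
  · rw [h11'] at key
    exact key.1
  · refine ⟨Or.inl (by simp), fun z h1 h2 _ => by simp [h1, h2], rfl⟩
  · rintro i hi s' ⟨h1, h2, h3⟩ h4
    rw [h11'] at hi
    have hP := he i hi s' h2 h3 h4
    simp only [run]
    by_cases hPi : P i
    · rw [if_pos (hP.2 hPi)]
      refine ⟨Or.inr ⟨i, by omega, ?_, hPi⟩, fun z a b _ => by simp [a, b, h2 z a b ‹_›], h3⟩
      simp only [setV_vars, eval_add', eval_var, eval_const, h4, h2 5 (by decide) (by decide)
        (by decide)]
      -- The stored value `i + 1` is at most `N < B`, so the reduction modulo `B` has no effect. The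
      -- shift by 1 reserves 0 for "none found".
      simpa using Nat.mod_eq_of_lt (by omega)
    · rw [if_neg (fun hh => hPi (hP.1 hh))]
      refine ⟨?_, fun z a b d => by simp [nop, run, a, d, h2 z a b d], h3⟩
      have e33 : (setV (run U nop s') 30 (i + 1)).vars 33 = s'.vars 33 := by simp [nop, run]
      rw [e33]
      rcases h1 with ⟨h5, h6⟩ | ⟨p, h5, h6, h7⟩
      · refine Or.inl ⟨h5, fun g hg => ?_⟩
        rcases Nat.lt_succ_iff_lt_or_eq.1 hg with h | rfl
        · exact h6 g h
        · exact hPi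
      · exact Or.inr ⟨p, by omega, h6, h7⟩

end Cmd

open Cmd

section Program

local notation "v" => Expr.var
local notation "c" => Expr.const

/-- Computation of one entry of the table. -/
def tableCell : Cmd :=
  ite (v 21)
    (ite (v 22)
      (put 1 1 (v 20) (v 22) (v 21) (c 0)
        (.add (ld 1 (v 20) (.sub (v 22) (c 1)) (.sub (v 21) (c 1)) (c 0))
          (.mul (v 20) (ld 1 (v 20) (v 22) (.sub (v 21) (c 1)) (c 0)))))
      (put 1 1 (v 20) (v 22) (v 21) (c 0)
        (.mul (v 20) (ld 1 (v 20) (v 22) (.sub (v 21) (c 1)) (c 0)))))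
    (put 1 1 (v 20) (v 22) (v 21) (c 0) (.eq (v 22) (c 0)))

/-- The table of the numbers `shiftCoeff a u i` in array 1. -/
def tableCmd : Cmd := rep 20 1 (rep 21 10 (rep 22 10 tableCell))

/-- The coefficient of the current linear functional at the index in variable 32. -/
def functionalE : Expr :=
  .mul (ld 1 (v 40) (v 42) (.mod (v 32) (v 12)) (c 0))
    (ld 1 (v 41) (v 43) (.div (v 32) (v 12)) (c 0))

/-- The value of the current linear functional on one row of array 2. -/
def valueCmd : Cmd :=
  set 31 1 (c 0) ;;
  accum 31 32 11 (.mul (ld 2 (v 30) (v 32) (c 0) (c 0)) functionalE) ;;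
  put 4 1 (v 30) (c 0) (c 0) (c 0) (v 31)

/-- Test whether a row is a pivot. -/
def pivotTest : Cmd :=
  ite (.mul (ld 3 (v 30) (c 0) (c 0) (c 0)) (.mod (ld 4 (v 30) (c 0) (c 0) (c 0)) (v 1)))
    (set 33 5 (.add (v 30) (c 1))) nop

/-- Search for a pivot; variable 33 becomes its successor, or 0 if there is none. -/
def pivotCmd : Cmd := set 33 5 (c 0) ;; rep 30 11 pivotTest

/-- A copy of one entry of the pivot row. -/
def copyPivot : Cmd :=
  put 9 1 (v 32) (c 0) (c 0) (c 0) (ld 2 (.sub (v 33) (c 1)) (v 32) (c 0) (c 0))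

/-- Subtraction of a multiple of the pivot row, one entry. -/
def subtractPivot : Cmd :=
  put 2 1 (v 30) (v 32) (c 0) (c 0)
    (.add (.mul (ld 4 (.sub (v 33) (c 1)) (c 0) (c 0) (c 0)) (ld 2 (v 30) (v 32) (c 0) (c 0)))
      (.mul (.sub (v 1) (c 1))
        (.mul (ld 4 (v 30) (c 0) (c 0) (c 0)) (ld 9 (v 32) (c 0) (c 0) (c 0)))))

/-- Elimination with the pivot found. -/
def reduceCmd : Cmd :=
  put 3 1 (.sub (v 33) (c 1)) (c 0) (c 0) (c 0) (c 0) ;;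
  rep 32 11 copyPivot ;; rep 30 11 (rep 32 11 subtractPivot)

/-- Imposing one linear equation. -/
def equationCmd : Cmd := rep 30 11 valueCmd ;; pivotCmd ;; ite (v 33) reduceCmd nop

/-- Imposing the linear equations for one point and one order of derivation in the first
variable. -/
def equationRow : Cmd := set 45 5 (.sub (v 44) (v 42)) ;; rep 43 45 equationCmd

/-- Imposing the linear equations for one point. -/
def equationPoint : Cmd :=
  set 44 5 (ld 0 (v 40) (v 41) (c 0) (c 0)) ;; rep 42 44 equationRow

/-- Imposing all linear equations. -/
def equationsCmd : Cmd := rep 40 1 (rep 41 1 equationPoint)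

/-- One entry of the unit vectors. -/
def unitCell : Cmd := put 2 1 (v 30) (v 32) (c 0) (c 0) (.eq (v 30) (v 32))

/-- Marking of an admissible row. -/
def markRow : Cmd :=
  put 3 1 (v 30) (c 0) (c 0) (c 0)
    (.lt (.add (.mod (v 30) (v 12)) (.mul (v 6) (.div (v 30) (v 12)))) (v 12))

/-- Unit vectors as rows of array 2; the admissible ones are marked in array 3. -/
def initCmd : Cmd := rep 30 11 (rep 32 11 unitCell) ;; rep 30 11 markRow

/-- Test whether a row remains. -/
def remainingTest : Cmd :=
  ite (ld 3 (v 30) (c 0) (c 0) (c 0)) (set 33 5 (.add (v 30) (c 1))) nop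

/-- Search for a remaining row; variable 33 becomes the successor of its index, or 0. -/
def remainingCmd : Cmd := set 33 5 (c 0) ;; rep 30 11 remainingTest

/-- Interpolation with the degree bound in variable 12. -/
def interpolateCmd : Cmd := initCmd ;; equationsCmd ;; remainingCmd

/-- One coefficient of the polynomial at the root of the search tree. -/
def rootCell : Cmd :=
  put 5 1 (v 50) (v 51) (c 0) (c 0) (.mul (.lt (v 51) (v 12))
    (ld 2 (.sub (v 33) (c 1)) (.add (.mul (v 50) (v 12)) (v 51)) (c 0) (c 0)))

/-- One coefficient of the polynomial at a child. -/
def shiftCell : Cmd :=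
  set 31 1 (c 0) ;;
  accum 31 55 12 (.mul (ld 1 (v 54) (v 50) (v 55) (c 0))
    (ld 5 (v 55) (.sub (v 51) (v 50)) (c 0) (c 0))) ;;
  put 6 1 (v 50) (v 51) (c 0) (c 0) (.mul (.lt (v 50) (.add (v 51) (c 1))) (v 31))

/-- Copying back of one coefficient. -/
def copyCell : Cmd := put 5 1 (v 50) (v 51) (c 0) (c 0) (ld 6 (v 50) (v 51) (c 0) (c 0))

/-- One step down in the search tree. -/
def shiftCmd : Cmd :=
  set 54 5 (ld 7 (v 63) (v 52) (c 0) (c 0)) ;;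
  rep 50 12 (rep 51 13 shiftCell) ;; rep 50 12 (rep 51 13 copyCell)

/-- The polynomial at the node whose number is in variable 63. -/
def nodeCmd : Cmd := rep 50 12 (rep 51 13 rootCell) ;; rep 52 60 shiftCmd

/-- Test of a coefficient in the search for the order. -/
def orderTest : Cmd :=
  ite (.mul (.eq (v 56) (c 0)) (.mod (ld 5 (v 50) (v 51) (c 0) (c 0)) (v 1)))
    (set 56 5 (.add (v 51) (c 1))) nop

/-- The successor of the order of the polynomial, in variable 56. -/
def orderCmd : Cmd := set 56 5 (c 0) ;; rep 51 13 (rep 50 12 orderTest)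

/-- Copying of one entry of a node to its child. -/
def inheritCell : Cmd := put 8 5 (v 62) (v 59) (c 0) (c 0) (ld 7 (v 63) (v 59) (c 0) (c 0))

/-- Appending of a child to the list of nodes in array 8. -/
def appendChild : Cmd :=
  rep 59 60 inheritCell ;; put 8 5 (v 62) (v 60) (c 0) (c 0) (v 58) ;;
  set 62 5 (.add (v 62) (c 1))

/-- The value of the lowest slice at the number in variable 58. -/
def sliceValue : Cmd :=
  set 31 1 (c 0) ;;
  accum 31 55 12 (.mul (ld 5 (v 55) (.sub (v 56) (c 1)) (c 0) (c 0))
    (ld 1 (v 58) (c 0) (v 55) (c 0)))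

/-- Appending of a child if the number in variable 58 is a root of the lowest slice. -/
def childCmd : Cmd := sliceValue ;; ite (v 31) nop appendChild

/-- Appending of all children of a node. -/
def expandCmd : Cmd := nodeCmd ;; orderCmd ;; rep 58 1 childCmd

/-- Copying back of one entry of the list of nodes. -/
def copyNodeCell : Cmd := put 7 5 (v 63) (v 59) (c 0) (c 0) (ld 8 (v 63) (v 59) (c 0) (c 0))

/-- One level of the search tree. -/
def levelCmd : Cmd :=
  set 62 5 (c 0) ;; rep 63 61 expandCmd ;; rep 63 62 (rep 59 0 copyNodeCell) ;; set 61 5 (v 62)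

/-- Output of one symbol. -/
def emitCell : Cmd := emit (ld 7 (v 63) (v 59) (c 0) (c 0))

/-- Output of the list of nodes. -/
def outputCmd : Cmd := rep 63 61 (rep 59 0 emitCell)

/-- Search for all roots. -/
def rootsCmd : Cmd := set 61 5 (c 1) ;; rep 60 0 levelCmd ;; outputCmd

/-- List decoding with the degree bound in variable 12. -/
def decodeDegree : Cmd :=
  set 11 5 (.mul (v 12) (v 12)) ;; set 13 5 (.mul (v 12) (.add (v 0) (c 1))) ;;
  interpolateCmd ;; ite (v 33) rootsCmd nop

/-- List decoding from the multiplicities in array 0. -/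
def decodeCmd : Cmd := tableCmd ;; rep 12 10 decodeDegree

end Program

theorem decodeCmd_wf : decodeCmd.wf = true := by decide

theorem decodeCmd_classical : decodeCmd.classical = true := by decide

theorem decodeCmd_det : decodeCmd.det = true := by decide

end ListDecoder

namespace ListDecoder

open Polynomial Cmd

/-! ### Correctness of the elimination -/

variable {q l m : ℕ} [Fact q.Prime] (U : Matrix (Block q l m) (Block q l m) ℂ)

/-- Array 1 contains the numbers `shiftCoeff a u i`. -/
def Table (q Dm : ℕ) [Fact q.Prime] (s : MState) : Prop :=
  ∀ a < q, ∀ u < Dm, ∀ i < Dm, (rd s 1 a u i 0 : ZMod q) = shiftCoeff (a : ZMod q) u i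

/-- The entries follow the Pascal recursion for `(X + a)^(i+1) = (X + a)(X + a)^i`. The loop over
the exponent `i` encloses the one over `u`, so the previous power is complete when it is used. -/
theorem run_tableCmd {s : MState} (hq : s.vars 1 = q) :
    Table q (s.vars 10) (run U tableCmd s) := by
  set Dm := s.vars 10 with hDm
  have key := run_rep_fill U 1 (fun a a' u i d => a' = a ∧ u < Dm ∧ i < Dm ∧ d = 0)
    (fun a u i _ w => (w : ZMod q) = shiftCoeff (a : ZMod q) u i) (x := 20) (y := 1)
    (c := rep 21 10 (rep 22 10 tableCell)) (by decide) (by decide) (s := s) ?_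
  · intro a ha u hu i hi
    exact (key a u i 0).1 ⟨a, by omega, rfl, hu, hi, rfl⟩
  intro a ha s1 hf1 hx1 _ _ a' u i d
  have e1 : s1.vars 10 = Dm := hf1.vars 10 (by decide) (by decide)
  have key := run_rep_fill U 1 (fun i a' u i' d => a' = a ∧ u < Dm ∧ i' = i ∧ d = 0)
    (fun a u i _ w => (w : ZMod q) = shiftCoeff (a : ZMod q) u i) (x := 21) (y := 10)
    (c := rep 22 10 tableCell) (by decide) (by decide) (s := s1) ?_ a' u i d
  · constructor
    · rintro ⟨h1, h2, h3, h4⟩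
      exact key.1 ⟨i, by omega, h1, h2, rfl, h4⟩
    · intro h
      refine key.2 ?_
      rintro ⟨i', hi', h1, h2, rfl, h4⟩
      exact h ⟨h1, h2, by omega, h4⟩
  intro i hi s2 hf2 hx2 _ hold a' u i' d
  have e2 : s2.vars 10 = Dm := (hf2.vars 10 (by decide) (by decide)).trans e1
  have key := run_rep_fill U 1 (fun u a' u' i' d => a' = a ∧ u' = u ∧ i' = i ∧ d = 0)
    (fun a u i _ w => (w : ZMod q) = shiftCoeff (a : ZMod q) u i) (x := 22) (y := 10)
    (c := tableCell) (by decide) (by decide) (s := s2) ?_ a' u i' d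
  · constructor
    · rintro ⟨h1, h2, h3, h4⟩
      exact key.1 ⟨u, by omega, h1, rfl, h3, h4⟩
    · intro h
      refine key.2 ?_
      rintro ⟨u', hu', h1, rfl, h3, h4⟩
      exact h ⟨h1, by omega, h3, h4⟩
  intro u hu s3 hf3 hx3 hun _ a' u' i' d
  have v20 : s3.vars 20 = a := by
    rw [hf3.vars 20 (by decide) (by decide), hf2.vars 20 (by decide) (by decide), hx1]
  have v21 : s3.vars 21 = i := by
    rw [hf3.vars 21 (by decide) (by decide), hx2]
  have v1 : s3.vars 1 = q := by
    rw [hf3.vars 1 (by decide) (by decide), hf2.vars 1 (by decide) (by decide),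
      hf1.vars 1 (by decide) (by decide), hq]
  have hprev : ∀ j < i, ∀ u' < Dm, (rd s3 1 a u' j 0 : ZMod q) = shiftCoeff (a : ZMod q) u' j := by
    intro j hj u' hu'
    rw [hun a u' j 0 (by rintro ⟨_, _, _, _, h, _⟩; omega)]
    exact hold a u' j 0 ⟨j, hj, rfl, hu', rfl, rfl⟩
  have hcell : ∃ w, run U tableCell s3 = setC s3 1 a u i 0 w ∧
      (w : ZMod q) = shiftCoeff (a : ZMod q) u i := by
    simp only [tableCell, run, eval_var, eval_const, v20, v21, hx3, v1, eval_add', eval_mul',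
      eval_sub', eval_ld, eval_eq']
    rcases Nat.eq_zero_or_pos i with rfl | hi0
    · refine ⟨_, by simp; rfl, ?_⟩
      rw [ZMod.natCast_mod, shiftCoeff_zero]
      split_ifs <;> simp
    · obtain ⟨i, rfl⟩ := Nat.exists_eq_succ_of_ne_zero hi0.ne'
      rcases Nat.eq_zero_or_pos u with rfl | hu0
      · refine ⟨_, by simp; rfl, ?_⟩
        rw [ZMod.natCast_mod, Nat.succ_eq_add_one, shiftCoeff_zero_succ]
        simp [hprev i (by omega) 0 (by omega)]
      · obtain ⟨u, rfl⟩ := Nat.exists_eq_succ_of_ne_zero hu0.ne'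
        refine ⟨_, by simp; rfl, ?_⟩
        rw [ZMod.natCast_mod, Nat.succ_eq_add_one, shiftCoeff_succ_succ]
        simp [hprev i (by omega) u (by omega), hprev i (by omega) (u + 1) (by omega)]
  obtain ⟨w, hw, hw'⟩ := hcell
  rw [hw, rd_setC _ (by decide) (by decide)]
  constructor
  · rintro ⟨rfl, rfl, rfl, rfl⟩
    simpa using hw'
  · intro h
    rw [if_neg]
    rintro ⟨-, h⟩
    exact ‹¬ _› h

/-- The linear functional that gives a coefficient of the polynomial after a shift of the
variables. -/
noncomputable def functional (q D : ℕ) [Fact q.Prime] (r z u w : ℕ) :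
    (ℕ → ZMod q) →ₗ[ZMod q] ZMod q :=
  ∑ h ∈ Finset.range (D * D),
    (shiftCoeff (r : ZMod q) u (h % D) * shiftCoeff (z : ZMod q) w (h / D)) • LinearMap.proj h

theorem functional_apply (D r z u w : ℕ) (x : ℕ → ZMod q) :
    functional q D r z u w x = ∑ h ∈ Finset.range (D * D),
      x h * (shiftCoeff (r : ZMod q) u (h % D) * shiftCoeff (z : ZMod q) w (h / D)) := by
  simp [functional, mul_comm]

/-- The rows of array 2. -/
def rows (q D : ℕ) (s : MState) (g h : ℕ) : ZMod q := if h < D * D then (rd s 2 g h 0 0 : ZMod q) else 0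

/-- The rows marked in array 3. -/
def marked (D : ℕ) (s : MState) : Finset ℕ := {g ∈ Finset.range (D * D) | rd s 3 g 0 0 0 ≠ 0}

/-- The state of the elimination. -/
structure ElimState (q : ℕ) [Fact q.Prime] (B D Dm : ℕ) (μ : ℕ → ℕ → ℕ) (S : Finset ℕ)
    (L : Set ((ℕ → ZMod q) →ₗ[ZMod q] ZMod q)) (d : ℕ) (s : MState) : Prop where
  one : s.vars 1 = q
  five : s.vars 5 = B
  eleven : s.vars 11 = D * D
  twelve : s.vars 12 = D
  lt : D * D < B
  le : D ≤ Dm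
  lt' : Dm < B
  bound : ∀ r < q, ∀ z < q, μ r z ≤ Dm
  table : Table q Dm s
  mult : ∀ r z, rd s 0 r z 0 0 = μ r z
  elim : Eliminated S L d (marked D s) (rows q D s)

/-- Separates the bookkeeping, which depends only on a few variables and on arrays 0 and 1, from the
linear algebra in arrays 2 and 3. -/
theorem ElimState.congr {B D Dm : ℕ} {μ : ℕ → ℕ → ℕ} {S : Finset ℕ}
    {L L' : Set ((ℕ → ZMod q) →ₗ[ZMod q] ZMod q)} {d d' : ℕ} {s s' : MState}
    (h : ElimState q B D Dm μ S L d s)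
    (hv : ∀ x, x = 1 ∨ x = 5 ∨ x = 11 ∨ x = 12 → s'.vars x = s.vars x)
    (h0 : rd s' 0 = rd s 0) (h1 : rd s' 1 = rd s 1)
    (he : Eliminated S L' d' (marked D s') (rows q D s')) :
    ElimState q B D Dm μ S L' d' s' where
  one := (hv 1 (by simp)).trans h.one
  five := (hv 5 (by simp)).trans h.five
  eleven := (hv 11 (by simp)).trans h.eleven
  twelve := (hv 12 (by simp)).trans h.twelve
  lt := h.lt
  le := h.le
  lt' := h.lt'
  bound := h.bound
  table := by have := h.table; unfold Table at this ⊢; rwa [h1]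
  mult := by rw [h0]; exact h.mult
  elim := he

theorem run_valueCmd {B D Dm : ℕ} {μ : ℕ → ℕ → ℕ} {S : Finset ℕ}
    {L : Set ((ℕ → ZMod q) →ₗ[ZMod q] ZMod q)} {d : ℕ} {s : MState}
    (h : ElimState q B D Dm μ S L d s) {r z u w : ℕ} (hr : s.vars 40 = r) (hz : s.vars 41 = z)
    (hu : s.vars 42 = u) (hw : s.vars 43 = w) (hrq : r < q) (hzq : z < q) (hum : u < Dm)
    (hwm : w < Dm) {g : ℕ} (hg : g < D * D) :
    (rd (run U (rep 30 11 valueCmd) s) 4 g 0 0 0 : ZMod q) =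
      functional q D r z u w (rows q D s g) := by
  have : NeZero q := ⟨(Fact.out : q.Prime).ne_zero⟩
  have key := run_rep_fill U 4 (fun g a b e d => a = g ∧ b = 0 ∧ e = 0 ∧ d = 0)
    (fun g _ _ _ x => (x : ZMod q) = functional q D r z u w (rows q D s g)) (x := 30) (y := 11)
    (c := valueCmd) (by decide) (by decide) (s := s) ?_ g 0 0 0
  · exact key.1 ⟨g, by rw [h.eleven]; exact hg, rfl, rfl, rfl, rfl⟩
  intro g hg s1 hf hx _ _ a b e d
  have hv := fun z h1 h2 => hf.vars z h1 h2
  have ha2 := hf.arr 2 (by decide) (by decide)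
  have ha1 := hf.arr 1 (by decide) (by decide)
  have hacc := run_accum U (acc := 31) (x := 32) (y := 11)
    (e := .mul (ld 2 (.var 30) (.var 32) (.const 0) (.const 0)) functionalE) (by decide)
    (by decide) (by decide) (s := setV s1 31 0)
    (by simp [hv 1 (by decide) (by decide), h.one])
    (fun i => rows q D s g i *
      (shiftCoeff (r : ZMod q) u (i % D) * shiftCoeff (z : ZMod q) w (i / D))) ?_
  · have e31 : (setV s1 31 0).vars 11 = D * D := by
      simp [hv 11 (by decide) (by decide), h.eleven]
    rw [e31, ← functional_apply] at hacc
    have hrun : run U valueCmd s1 = setC (run U (accum 31 32 11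
        (.mul (ld 2 (.var 30) (.var 32) (.const 0) (.const 0)) functionalE)) (setV s1 31 0)) 4 g 0 0 0
        ((run U (accum 31 32 11 (.mul (ld 2 (.var 30) (.var 32) (.const 0) (.const 0))
          functionalE)) (setV s1 31 0)).vars 31 % q) := by
      simp only [valueCmd, run, eval_var, eval_const, Nat.zero_mod]
      rw [run_vars U _ (x := 30) (by decide), run_vars U _ (x := 1) (by decide)]
      simp [hv 1 (by decide) (by decide), h.one, hx]
    rw [hrun, rd_setC _ (by decide) (by decide), run_rd U _ (by decide) (by decide) (by decide)]
    constructor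
    · rintro ⟨rfl, rfl, rfl, rfl⟩
      rw [if_pos (by simp), ZMod.natCast_mod, hacc]
      simp
    · intro hne
      rw [if_neg (fun hh => hne hh.2)]
      rfl
  · intro i hi s2 hv2 hr2 hi2
    have hi' : i < D * D := by
      simpa [hv 11 (by decide) (by decide), h.eleven] using hi
    have hD : 0 < D := Nat.pos_of_ne_zero (by rintro rfl; simp at hi')
    have hv3 : ∀ z, z ≠ 30 → z ≠ 31 → z ≠ 32 → s2.vars z = s.vars z := by
      intro z h1 h2 h3
      rw [hv2 z h3 h2]
      simp only [setV_vars, if_neg h2]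
      exact hv z h1 (by
        simp [valueCmd, wv, accum, Ne.symm h2, Ne.symm h3])
    have e30 : s2.vars 30 = g := by rw [hv2 30 (by decide) (by decide)]; simp [hx]
    simp only [functionalE, eval_mul', eval_ld, eval_var, eval_const, eval_mod', eval_div', hr2,
      setV_rd, hi2, e30, hv3 40 (by decide) (by decide) (by decide),
      hv3 41 (by decide) (by decide) (by decide), hv3 42 (by decide) (by decide) (by decide),
      hv3 43 (by decide) (by decide) (by decide), hv3 12 (by decide) (by decide) (by decide),
      hr, hz, hu, hw, h.twelve, ha2, ha1, Nat.cast_mul, rows, if_pos hi']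
    rw [h.table r hrq u hum _ ((Nat.mod_lt _ hD).trans_le h.le),
      h.table z hzq w hwm _ (((Nat.div_lt_iff_lt_mul hD).2 hi').trans_le h.le)]

theorem run_pivotCmd {B D Dm : ℕ} {μ : ℕ → ℕ → ℕ} {S : Finset ℕ}
    {L : Set ((ℕ → ZMod q) →ₗ[ZMod q] ZMod q)} {d : ℕ} {s : MState}
    (h : ElimState q B D Dm μ S L d s) :
    ((run U pivotCmd s).vars 33 = 0 ∧
      ∀ g ∈ marked D s, (rd s 4 g 0 0 0 : ZMod q) = 0) ∨
    ∃ p ∈ marked D s, (run U pivotCmd s).vars 33 = p + 1 ∧ (rd s 4 p 0 0 0 : ZMod q) ≠ 0 := by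
  have key := run_search U (e := .mul (ld 3 (.var 30) (.const 0) (.const 0) (.const 0))
    (.mod (ld 4 (.var 30) (.const 0) (.const 0) (.const 0)) (.var 1))) h.eleven
    (by rw [h.five]; exact h.lt)
    (fun g => rd s 3 g 0 0 0 ≠ 0 ∧ (rd s 4 g 0 0 0 : ZMod q) ≠ 0) ?_
  · rcases key with ⟨h1, h2⟩ | ⟨p, hp, h1, h2⟩
    · refine Or.inl ⟨h1, fun g hg => ?_⟩
      simp only [marked, Finset.mem_filter, Finset.mem_range] at hg
      by_contra hne
      exact h2 g hg.1 ⟨hg.2, hne⟩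
    · exact Or.inr ⟨p, by simpa [marked] using ⟨hp, h2.1⟩, h1, h2.2⟩
  · intro g hg s' hv hr hx
    simp only [eval_mul', eval_ld, eval_var, eval_const, eval_mod', hr, hx,
      hv 1 (by decide) (by decide) (by decide), h.one, mul_ne_zero_iff]
    have hz : (rd s 4 g 0 0 0 : ZMod q) = 0 ↔ rd s 4 g 0 0 0 % q = 0 := by
      rw [ZMod.natCast_eq_zero_iff, Nat.dvd_iff_mod_eq_zero]
    simp only [ne_eq, hz]

/-- All rows are overwritten, including the pivot row and rows discarded before. This is harmless
because the invariant speaks of marked rows only and the pivot has lost its mark. -/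
theorem run_reduceCmd {B D Dm : ℕ} {μ : ℕ → ℕ → ℕ} {S : Finset ℕ}
    {L : Set ((ℕ → ZMod q) →ₗ[ZMod q] ZMod q)} {d : ℕ} {s : MState}
    (h : ElimState q B D Dm μ S L d s) (f : (ℕ → ZMod q) →ₗ[ZMod q] ZMod q)
    (hf : ∀ g < D * D, (rd s 4 g 0 0 0 : ZMod q) = f (rows q D s g)) {p : ℕ}
    (hp : p ∈ marked D s) (h33 : s.vars 33 = p + 1) (hne : (rd s 4 p 0 0 0 : ZMod q) ≠ 0) :
    ElimState q B D Dm μ S (insert f L) (d + 1) (run U reduceCmd s) := by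
  have hq1 : 1 ≤ q := (Fact.out : q.Prime).one_le
  have hpD : p < D * D := by simpa [marked] using (Finset.mem_filter.1 hp).1
  refine h.congr ?_ (run_rd U _ (by decide) (by decide) (by decide) s)
    (run_rd U _ (by decide) (by decide) (by decide) s) ?_
  · rintro x (rfl | rfl | rfl | rfl) <;> exact run_vars U _ (by decide) s
  set s1 := setC s 3 p 0 0 0 0 with hs1
  set s2 := run U (rep 32 11 copyPivot) s1 with hs2
  have hrun : run U reduceCmd s = run U (rep 30 11 (rep 32 11 subtractPivot)) s2 := by
    simp only [reduceCmd, run, eval_sub', eval_var, eval_const, h33, Nat.add_sub_cancel,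
      Nat.zero_mod]
    rfl
  -- The pivot row is itself destroyed in the course of the loop, so the subtraction reads this
  -- copy.
  have h9 : ∀ i < D * D, (rd s2 9 i 0 0 0 : ZMod q) = rows q D s p i := by
    intro i hi
    have key := run_rep_fill U 9 (fun g a b e d => a = g ∧ b = 0 ∧ e = 0 ∧ d = 0)
      (fun g _ _ _ x => (x : ZMod q) = rd s 2 p g 0 0) (x := 32) (y := 11)
      (c := copyPivot) (by decide) (by decide) (s := s1) ?_ i 0 0 0
    · rw [rows, if_pos hi]
      exact key.1 ⟨i, by simpa [hs1, h.eleven] using hi, rfl, rfl, rfl, rfl⟩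
    · intro g hg s' hfr hx _ _ a b e d
      have h2 : rd s' 2 = rd s 2 := by
        rw [hfr.arr 2 (by decide) (by decide), hs1]
        ext a b c d
        rw [rd_setC _ (by decide) (by decide), if_neg (by simp)]
      have e33 : s'.vars 33 = p + 1 := by rw [hfr.vars 33 (by decide) (by decide)]; exact h33
      have e1 : s'.vars 1 = q := by rw [hfr.vars 1 (by decide) (by decide)]; exact h.one
      simp only [copyPivot, run, eval_ld, eval_sub', eval_var, eval_const, e33, hx, e1, h2,
        Nat.add_sub_cancel]
      rw [rd_setC _ (by decide) (by decide)]
      constructor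
      · rintro ⟨rfl, rfl, rfl, rfl⟩
        simp
      · intro hn
        rw [if_neg fun hh => hn hh.2]
  have hrd : ∀ k < 16, k ≠ 3 → k ≠ 9 → rd s2 k = rd s k := by
    intro k hk h3 h9'
    rw [hs2, run_rd U _ (by decide) hk (by simp [wa, copyPivot, Ne.symm h9']), hs1]
    ext a b c d
    rw [rd_setC _ (by decide) hk, if_neg fun hh => h3 hh.1]
  have hv2 : ∀ x, x ≠ 32 → s2.vars x = s.vars x := by
    intro x hx
    rw [hs2, run_vars U _ (by simp [wv, copyPivot, Ne.symm hx])]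
    rfl
  have hmark : marked D (run U reduceCmd s) = (marked D s).erase p := by
    rw [hrun]
    ext g
    simp only [marked, Finset.mem_filter, Finset.mem_erase, Finset.mem_range]
    rw [run_rd U _ (by decide) (by decide) (by decide), hs2,
      run_rd U _ (by decide) (by decide) (by decide), hs1, rd_setC _ (by decide) (by decide)]
    by_cases hgp : g = p
    · simp [hgp]
    · simp [hgp]
  rw [hmark]
  have hfp := hf p hpD
  rw [hfp] at hne
  refine h.elim.pivot f hp hne fun g hg => ?_
  have hgD : g < D * D := by
    have := (Finset.mem_erase.1 hg).2
    simpa [marked] using (Finset.mem_filter.1 this).1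
  ext i
  rw [hrun]
  simp only [rows, Pi.sub_apply, Pi.smul_apply, smul_eq_mul]
  split_ifs with hi
  · have e11 : s2.vars 11 = D * D := by rw [hv2 11 (by decide), h.eleven]
    refine run_rep_rep_fill U 2 (fun g i w => (w : ZMod q) =
      f (rows q D s p) * (rd s 2 g i 0 0 : ZMod q) - f (rows q D s g) * (rd s 2 p i 0 0 : ZMod q))
      (x := 30) (y := 11) (x' := 32) (y' := 11) (c := subtractPivot) (by decide) (by decide)
      (by decide) (by decide) (by decide) (by decide) (by decide) (by decide) (s := s2) ?_
      (by rw [e11]; exact hgD) (by rw [e11]; exact hi)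
    intro a ha b hb s' hv ha' h30 h32 hold
    rw [e11] at ha hb
    have e33 : s'.vars 33 = p + 1 := by
      rw [hv 33 (by decide) (by decide) (by decide), hv2 33 (by decide)]; exact h33
    have e1 : s'.vars 1 = q := by
      rw [hv 1 (by decide) (by decide) (by decide), hv2 1 (by decide)]; exact h.one
    have e4 : rd s' 4 = rd s 4 := by
      rw [ha' 4 (by decide) (by decide), hrd 4 (by decide) (by decide) (by decide)]
    have e9 : rd s' 9 = rd s2 9 := ha' 9 (by decide) (by decide)
    -- The factor `q - 1` represents `-1`, as subtraction of natural numbers is truncated.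
    refine ⟨(rd s' 4 p 0 0 0 * rd s' 2 a b 0 0 + (q - 1) * (rd s' 4 a 0 0 0 * rd s' 9 b 0 0 0)) % q,
      ?_, fun a' b' e d => ?_⟩
    rotate_left
    · simp only [subtractPivot, run, eval_ld, eval_sub', eval_add', eval_mul', eval_var,
        eval_const, e33, e1, h30, h32, Nat.add_sub_cancel]
      rw [rd_setC _ (by decide) (by decide)]
      simp only [true_and]
    · rw [ZMod.natCast_mod]
      simp only [Nat.cast_add, Nat.cast_mul, hold, hrd 2 (by decide) (by decide) (by decide),
        e4, e9, h9 b hb, hf a ha, hf p hpD]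
      rw [Nat.cast_sub hq1, rows, if_pos hb]
      simp
      ring
  · simp

theorem run_equationCmd {B D Dm : ℕ} {μ : ℕ → ℕ → ℕ} {S : Finset ℕ}
    {L : Set ((ℕ → ZMod q) →ₗ[ZMod q] ZMod q)} {d : ℕ} {s : MState}
    (h : ElimState q B D Dm μ S L d s) {r z u w : ℕ} (hr : s.vars 40 = r) (hz : s.vars 41 = z)
    (hu : s.vars 42 = u) (hw : s.vars 43 = w) (hrq : r < q) (hzq : z < q) (hum : u < Dm)
    (hwm : w < Dm) :
    ElimState q B D Dm μ S (insert (functional q D r z u w) L) (d + 1) (run U equationCmd s) := by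
  set s1 := run U (rep 30 11 valueCmd) s with hs1
  set s2 := run U pivotCmd s1 with hs2
  have hval := fun g hg => run_valueCmd U h hr hz hu hw hrq hzq hum hwm (g := g) hg
  have hrd1 : ∀ k < 16, k ≠ 4 → rd s1 k = rd s k := fun k hk h4 =>
    run_rd U _ (by decide) hk (by simp [wa, valueCmd, accum, Ne.symm h4]) s
  have hrows1 : rows q D s1 = rows q D s := by
    unfold rows; rw [hrd1 2 (by decide) (by decide)]
  have hmarked1 : marked D s1 = marked D s := by
    unfold marked; rw [hrd1 3 (by decide) (by decide)]
  have h1 : ElimState q B D Dm μ S L d s1 := by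
    refine h.congr ?_ (hrd1 0 (by decide) (by decide)) (hrd1 1 (by decide) (by decide)) ?_
    · rintro x (rfl | rfl | rfl | rfl) <;> exact run_vars U _ (by decide) s
    · rw [hrows1, hmarked1]; exact h.elim
  have hrd2 : ∀ k < 16, rd s2 k = rd s1 k := fun k hk =>
    run_rd U _ (by decide) hk rfl s1
  have hrows2 : rows q D s2 = rows q D s1 := by
    unfold rows; rw [hrd2 2 (by decide)]
  have hmarked2 : marked D s2 = marked D s1 := by
    unfold marked; rw [hrd2 3 (by decide)]
  have h2 : ElimState q B D Dm μ S L d s2 := by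
    refine h1.congr ?_ (hrd2 0 (by decide)) (hrd2 1 (by decide)) ?_
    · rintro x (rfl | rfl | rfl | rfl) <;> exact run_vars U _ (by decide) s1
    · rw [hrows2, hmarked2]; exact h1.elim
  have hval2 : ∀ g < D * D, (rd s2 4 g 0 0 0 : ZMod q) =
      functional q D r z u w (rows q D s2 g) := by
    intro g hg
    rw [hrd2 4 (by decide), hrows2, hrows1]
    exact hval g hg
  have hrun : run U equationCmd s =
      if s2.vars 33 ≠ 0 then run U reduceCmd s2 else run U nop s2 := rfl
  rw [hrun]
  rcases run_pivotCmd U h1 with ⟨h33, hall⟩ | ⟨p, hp, h33, hne⟩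
  · rw [if_neg (by simpa using h33)]
    refine h2.congr ?_ rfl rfl ?_
    · rintro x (rfl | rfl | rfl | rfl) <;> exact run_vars U _ (by decide) s2
    · refine h2.elim.noPivot _ fun g hg => ?_
      change g ∈ marked D s2 at hg
      have hgD : g < D * D := by simpa [marked] using (Finset.mem_filter.1 hg).1
      rw [hmarked2] at hg
      rw [← hval2 g hgD, hrd2 4 (by decide)]
      exact hall g hg
  · rw [if_pos (by rw [hs2, h33]; omega)]
    refine run_reduceCmd U h2 _ hval2 (by rw [hmarked2]; exact hp) h33 ?_
    rw [hrd2 4 (by decide)]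
    exact hne

/-- Equations and their number accumulate along a loop. Applied once for each of the nested loops
over the point `(r, z)` and the orders `(u, w)`. -/
theorem run_rep_elim {B D Dm : ℕ} {μ : ℕ → ℕ → ℕ} {S : Finset ℕ}
    {L : Set ((ℕ → ZMod q) →ₗ[ZMod q] ZMod q)} {d : ℕ} {s : MState}
    (h : ElimState q B D Dm μ S L d s) {x y : ℕ} {c : Cmd}
    (hx : x ≠ 1 ∧ x ≠ 5 ∧ x ≠ 11 ∧ x ≠ 12) (hxc : c.wv x = false) (hw : c.wf = true)
    (L' : ℕ → Set ((ℕ → ZMod q) →ₗ[ZMod q] ZMod q)) (d' : ℕ → ℕ)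
    (hstep : ∀ i < s.vars y, ∀ s' L d, Frame c x s s' → s'.vars x = i →
      ElimState q B D Dm μ S L d s' → ElimState q B D Dm μ S (L ∪ L' i) (d + d' i) (run U c s')) :
    ElimState q B D Dm μ S (L ∪ {f | ∃ i < s.vars y, f ∈ L' i})
      (d + ∑ i ∈ Finset.range (s.vars y), d' i) (run U (rep x y c) s) := by
  have hset : ∀ {L d s' i}, ElimState q B D Dm μ S L d s' →
      ElimState q B D Dm μ S L d (setV s' x i) := fun h' => by
    refine h'.congr ?_ rfl rfl h'.elim
    rintro z (rfl | rfl | rfl | rfl)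
    · simp [Ne.symm hx.1]
    · simp [Ne.symm hx.2.1]
    · simp [Ne.symm hx.2.2.1]
    · simp [Ne.symm hx.2.2.2]
  refine run_rep_frame U (fun i s' => ElimState q B D Dm μ S (L ∪ {f | ∃ i' < i, f ∈ L' i'})
      (d + ∑ i ∈ Finset.range i, d' i) s') hxc hw ?_ ?_
  · simpa using hset h
  · intro i hi s' hf hxi hI
    have := hset (i := i + 1) (hstep i hi s' _ _ hf hxi hI)
    rw [Finset.sum_range_succ, ← add_assoc]
    convert this using 1
    rw [Set.union_assoc]
    congr 1
    ext f
    simp only [Set.mem_ofPred_eq, Set.mem_union, Nat.lt_succ_iff_lt_or_eq, or_and_right, exists_or,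
      exists_eq_left]

theorem run_equationsCmd {B D Dm : ℕ} {μ : ℕ → ℕ → ℕ} {S : Finset ℕ} {s : MState}
    (h : ElimState q B D Dm μ S ∅ 0 s) :
    ElimState q B D Dm μ S
      {f | ∃ r < q, ∃ z < q, ∃ u < μ r z, ∃ w < μ r z - u, f = functional q D r z u w}
      (∑ r ∈ Finset.range q, ∑ z ∈ Finset.range q, ∑ u ∈ Finset.range (μ r z), (μ r z - u))
      (run U equationsCmd s) := by
  have key := run_rep_elim U h (x := 40) (y := 1) (c := rep 41 1 equationPoint) (by decide)
    (by decide) (by decide)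
    (fun r => {f | ∃ z < q, ∃ u < μ r z, ∃ w < μ r z - u, f = functional q D r z u w})
    (fun r => ∑ z ∈ Finset.range q, ∑ u ∈ Finset.range (μ r z), (μ r z - u)) ?_
  · rw [h.one] at key
    simpa [equationsCmd] using key
  intro r hr s1 L1 d1 hf1 e40 h1
  rw [h.one] at hr
  have key := run_rep_elim U h1 (x := 41) (y := 1) (c := equationPoint) (by decide)
    (by decide) (by decide)
    (fun z => {f | ∃ u < μ r z, ∃ w < μ r z - u, f = functional q D r z u w})
    (fun z => ∑ u ∈ Finset.range (μ r z), (μ r z - u)) ?_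
  · rw [h1.one] at key
    simpa using key
  intro z hz s2 L2 d2 hf2 e41 h2
  rw [h1.one] at hz
  have hb := h.bound r hr z hz
  have hbB := hb.trans_lt h.lt'
  have hrun : run U equationPoint s2 = run U (rep 42 44 equationRow) (setV s2 44 (μ r z)) := by
    simp only [equationPoint, run, eval_ld, eval_var, eval_const,
      hf2.vars 40 (by decide) (by decide), e40, e41, h2.mult, h2.five, Nat.mod_eq_of_lt hbB]
  have h3 : ElimState q B D Dm μ S L2 d2 (setV s2 44 (μ r z)) := by
    refine h2.congr ?_ rfl rfl h2.elim
    rintro x (rfl | rfl | rfl | rfl) <;> simp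
  rw [hrun]
  have key := run_rep_elim U h3 (x := 42) (y := 44) (c := equationRow) (by decide)
    (by decide) (by decide)
    (fun u => {f | ∃ w < μ r z - u, f = functional q D r z u w})
    (fun u => μ r z - u) ?_
  · simpa using key
  intro u hu s3 L3 d3 hf3 e42 h4
  simp only [setV_vars, if_true] at hu
  have e44 : s3.vars 44 = μ r z := by rw [hf3.vars 44 (by decide) (by decide)]; simp
  have hrun : run U equationRow s3 = run U (rep 43 45 equationCmd) (setV s3 45 (μ r z - u)) := by
    simp only [equationRow, run, eval_sub', eval_var, e44, e42, h4.five]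
    rw [Nat.mod_eq_of_lt (by omega)]
  have h5 : ElimState q B D Dm μ S L3 d3 (setV s3 45 (μ r z - u)) := by
    refine h4.congr ?_ rfl rfl h4.elim
    rintro x (rfl | rfl | rfl | rfl) <;> simp
  rw [hrun]
  have key := run_rep_elim U h5 (x := 43) (y := 45) (c := equationCmd) (by decide)
    (by decide) (by decide) (fun w => {functional q D r z u w}) (fun _ => 1) ?_
  · simpa using key
  intro w hw s4 L4 d4 hf4 e43 h6
  simp only [setV_vars, if_true] at hw
  rw [Set.union_singleton]
  have hv4 : ∀ x, x ≠ 43 → x ≠ 45 → equationCmd.wv x = false → s4.vars x = s3.vars x := by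
    intro x hx1 hx2 hx3
    rw [hf4.vars x hx1 hx3]
    simp [hx2]
  refine run_equationCmd U h6 ?_ ?_ ?_ e43 hr hz (by omega) (by omega)
  · rw [hv4 40 (by decide) (by decide) (by decide), hf3.vars 40 (by decide) (by decide)]
    simp [hf2.vars 40 (by decide) (by decide), e40]
  · rw [hv4 41 (by decide) (by decide) (by decide), hf3.vars 41 (by decide) (by decide)]
    simp [e41]
  · rw [hv4 42 (by decide) (by decide) (by decide), e42]

end ListDecoder

namespace ListDecoder

open Polynomial Cmd

/-! ### Correctness of the interpolation -/

variable {q l m : ℕ} [Fact q.Prime] (U : Matrix (Block q l m) (Block q l m) ℂ)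

/-- The indices of the monomials `X^i Y^j` with `i + k j < D`. -/
def monomials (k D : ℕ) : Finset ℕ := {g ∈ Finset.range (D * D) | g % D + k * (g / D) < D}

/-- Used twice: for the number of conditions at a point of multiplicity `w`, and for the lattice
points of a triangle when monomials are counted. -/
theorem two_mul_sum_sub (w : ℕ) : 2 * ∑ u ∈ Finset.range w, (w - u) = w * (w + 1) := by
  induction w with
  | zero => simp
  | succ w ih =>
    rw [Finset.sum_range_succ']
    simp only [Nat.add_sub_add_right, Nat.sub_zero, mul_add, ih]
    ring

/-- The triangle of pairs `(u, i)` with `u + i < D` is mapped to monomials `X^i Y^⌊u/k⌋`. These are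
admissible because `k⌊u/k⌋ ≤ u`, and at most `k` pairs, told apart by `u` modulo `k`, go to the same
monomial. -/
theorem le_card_monomials {k : ℕ} (hk : 0 < k) (D : ℕ) :
    D * (D + 1) ≤ 2 * (k * (monomials k D).card) := by
  rw [← two_mul_sum_sub]
  refine Nat.mul_le_mul_left 2 ?_
  have h1 : ∑ u ∈ Finset.range D, (D - u) =
      ((Finset.range D).sigma fun u => Finset.range (D - u)).card := by simp
  rw [h1]
  refine Finset.card_le_mul_card_image_of_maps_to (f := fun a => a.1 / k * D + a.2) ?_ k ?_
  · rintro ⟨u, i⟩ ha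
    simp only [Finset.mem_sigma, Finset.mem_range] at ha
    have hD : 0 < D := by omega
    have h2 : u / k < D := (Nat.div_le_self u k).trans_lt ha.1
    have h3 : i < D := by omega
    have h4 : (u / k * D + i) % D = i := by
      rw [add_comm, Nat.add_mul_mod_self_right, Nat.mod_eq_of_lt h3]
    have h5 : (u / k * D + i) / D = u / k := by
      rw [add_comm, Nat.add_mul_div_right _ _ hD, Nat.div_eq_of_lt h3, zero_add]
    simp only [monomials, Finset.mem_filter, Finset.mem_range, h4, h5]
    constructor
    · nlinarith
    · have := Nat.mul_div_le u k
      omega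
  · intro b _
    refine (Finset.card_le_card_of_injOn (t := Finset.range k) (fun a => a.1 % k) ?_ ?_).trans
      (by simp)
    · intro a _
      simpa using Nat.mod_lt _ hk
    · rintro ⟨u, i⟩ ha ⟨u', i'⟩ ha' hmod
      obtain ⟨ha, h3⟩ := Finset.mem_filter.1 (Finset.mem_coe.1 ha)
      obtain ⟨ha', h3'⟩ := Finset.mem_filter.1 (Finset.mem_coe.1 ha')
      simp only [Finset.mem_sigma, Finset.mem_range] at ha ha' h3 h3' hmod
      have hD : 0 < D := by omega
      have e1 := congrArg (· % D) (h3.trans h3'.symm)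
      have e2 := congrArg (· / D) (h3.trans h3'.symm)
      simp only [add_comm _ i, add_comm _ i', Nat.add_mul_mod_self_right,
        Nat.add_mul_div_right _ _ hD] at e1 e2
      rw [Nat.mod_eq_of_lt (by omega), Nat.mod_eq_of_lt (by omega)] at e1
      simp only [Nat.div_eq_of_lt (show i < D by omega), Nat.div_eq_of_lt (show i' < D by omega),
        zero_add] at e2
      have hu : u = u' := by
        rw [← Nat.div_add_mod u k, ← Nat.div_add_mod u' k, hmod]
        rw [e2]
      subst hu
      subst e1
      rfl

theorem run_initCmd {B D Dm k : ℕ} {μ : ℕ → ℕ → ℕ} {s : MState}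
    (h1 : s.vars 1 = q) (h5 : s.vars 5 = B) (h11 : s.vars 11 = D * D) (h12 : s.vars 12 = D)
    (h6 : s.vars 6 = k) (hDB : D * D < B) (hDm : D ≤ Dm) (hmB : Dm < B)
    (hμ : ∀ r < q, ∀ z < q, μ r z ≤ Dm) (ht : Table q Dm s) (hm : ∀ r z, rd s 0 r z 0 0 = μ r z) :
    ElimState q B D Dm μ (monomials k D) ∅ 0 (run U initCmd s) := by
  have hq2 : 1 % q = 1 := Nat.mod_eq_of_lt (Fact.out : q.Prime).one_lt
  have hvars : ∀ x, x ≠ 30 → x ≠ 32 → (run U initCmd s).vars x = s.vars x := by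
    intro x hx hx'
    exact run_vars U _ (by simp [initCmd, wv, unitCell, markRow, Ne.symm hx, Ne.symm hx']) s
  have hrd : ∀ k < 16, k ≠ 2 → k ≠ 3 → rd (run U initCmd s) k = rd s k := by
    intro k hk h2 h3
    exact run_rd U _ (by decide) hk
      (by simp [initCmd, wa, unitCell, markRow, Ne.symm h2, Ne.symm h3]) s
  set s1 := run U (rep 30 11 (rep 32 11 unitCell)) s with hs1
  have hrun : run U initCmd s = run U (rep 30 11 markRow) s1 := rfl
  have h2 : ∀ g < D * D, ∀ i < D * D,
      (rd (run U initCmd s) 2 g i 0 0 : ZMod q) = if g = i then 1 else 0 := by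
    intro g hg i hi
    rw [hrun, run_rd U _ (by decide) (by decide) (by decide)]
    refine run_rep_rep_fill U 2 (fun g i w => (w : ZMod q) = if g = i then 1 else 0)
      (x := 30) (y := 11) (x' := 32) (y' := 11) (c := unitCell) (by decide) (by decide)
      (by decide) (by decide) (by decide) (by decide) (by decide) (by decide) (s := s) ?_
      (by rw [h11]; exact hg) (by rw [h11]; exact hi)
    intro a ha b hb s' hv ha' h30 h32 hold
    refine ⟨(if a = b then 1 else 0) % q, ?_, fun a' b' e d => ?_⟩
    · rw [ZMod.natCast_mod]
      split_ifs <;> simp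
    · simp only [unitCell, run, eval_eq', eval_var, eval_const, h30, h32,
        hv 1 (by decide) (by decide) (by decide), h1]
      rw [rd_setC _ (by decide) (by decide)]
      simp only [true_and]
  have h3 : ∀ g < D * D, (rd (run U initCmd s) 3 g 0 0 0 ≠ 0 ↔ g % D + k * (g / D) < D) := by
    intro g hg
    have key := run_rep_fill U 3 (fun g a b e d => a = g ∧ b = 0 ∧ e = 0 ∧ d = 0)
      (fun g _ _ _ x => (x ≠ 0 ↔ g % D + k * (g / D) < D)) (x := 30) (y := 11)
      (c := markRow) (by decide) (by decide) (s := s1) ?_ g 0 0 0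
    · refine key.1 ⟨g, ?_, rfl, rfl, rfl, rfl⟩
      rw [hs1, run_vars U _ (by decide), h11]
      exact hg
    · intro g hg s' hf hx _ _ a b e d
      have e1 : ∀ x, x ≠ 30 → x ≠ 32 → s'.vars x = s.vars x := by
        intro x hx hx'
        rw [hf.vars x hx (by simp [markRow, wv]), hs1,
          run_vars U _ (by simp [wv, unitCell, Ne.symm hx, Ne.symm hx'])]
      simp only [markRow, run, eval_lt', eval_add', eval_mod', eval_mul', eval_div', eval_var,
        eval_const, hx, e1 12 (by decide) (by decide), e1 6 (by decide) (by decide),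
        e1 1 (by decide) (by decide), h1, h6, h12]
      rw [rd_setC _ (by decide) (by decide)]
      constructor
      · rintro ⟨rfl, rfl, rfl, rfl⟩
        rw [if_pos (by simp)]
        split_ifs with hlt
        · simp [hq2, hlt]
        · simp [hlt]
      · intro hn
        rw [if_neg fun hh => hn hh.2]
  have hmark : marked D (run U initCmd s) = monomials k D := by
    unfold marked monomials
    refine Finset.filter_congr fun g hg => h3 g (Finset.mem_range.1 hg)
  refine ⟨?_, ?_, ?_, ?_, hDB, hDm, hmB, hμ, ?_, ?_, ?_⟩
  · rw [hvars 1 (by decide) (by decide), h1]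
  · rw [hvars 5 (by decide) (by decide), h5]
  · rw [hvars 11 (by decide) (by decide), h11]
  · rw [hvars 12 (by decide) (by decide), h12]
  · unfold Table at ht ⊢
    rwa [hrd 1 (by decide) (by decide) (by decide)]
  · rwa [hrd 0 (by decide) (by decide) (by decide)]
  · rw [hmark]
    have hlt : ∀ g ∈ monomials k D, g < D * D := fun g hg => by
      simpa using (Finset.mem_filter.1 hg).1
    refine ⟨?_, ?_, ?_, by simp, by simp⟩
    · intro g hg
      have := hlt g hg
      simp [rows, this, h2 g this g this]
    · intro g hg i hi hne
      have hg' := hlt g hg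
      have hi' := hlt i hi
      simp [rows, hi', h2 g hg' i hi', hne]
    · intro g hg i hne
      have hg' := hlt g hg
      unfold rows at hne
      split_ifs at hne with hi
      · rw [h2 g hg' i hi] at hne
        split_ifs at hne with hgi
        · rwa [← hgi]
        · exact absurd rfl hne
      · exact absurd rfl hne

theorem sum_range_mul_eq {M : Type*} [AddCommMonoid M] (J D : ℕ) (f : ℕ → M) :
    ∑ h ∈ Finset.range (J * D), f h =
      ∑ j ∈ Finset.range J, ∑ i ∈ Finset.range D, f (j * D + i) := by
  induction J with
  | zero => simp
  | succ J ih => rw [Nat.succ_mul, Finset.sum_range_add, ih, Finset.sum_range_succ]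

/-- The coefficients of the polynomial in row `p` of array 2. -/
def rowPoly (q D p : ℕ) (s : MState) (j i : ℕ) : ZMod q :=
  if j < D ∧ i < D then (rd s 2 p (j * D + i) 0 0 : ZMod q) else 0

/-- If no row is left, the number of monomials is at most the number of equations, which gives the
inequality. A remaining row is nonzero because its diagonal entry is; its support and its equations
are those of the elimination invariant. -/
theorem run_interpolateCmd {B D Dm k : ℕ} (hk : 0 < k) {μ : ℕ → ℕ → ℕ} {s : MState}
    (h1 : s.vars 1 = q) (h5 : s.vars 5 = B) (h11 : s.vars 11 = D * D) (h12 : s.vars 12 = D)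
    (h6 : s.vars 6 = k) (hDB : D * D < B) (hDm : D ≤ Dm) (hmB : Dm < B)
    (hμ : ∀ r < q, ∀ z < q, μ r z ≤ Dm) (ht : Table q Dm s) (hm : ∀ r z, rd s 0 r z 0 0 = μ r z) :
    ((run U interpolateCmd s).vars 33 = 0 ∧
      D * (D + 1) ≤ k * ∑ r ∈ Finset.range q, ∑ z ∈ Finset.range q, μ r z * (μ r z + 1)) ∨
    ∃ p, (run U interpolateCmd s).vars 33 = p + 1 ∧
      (∃ j i, rowPoly q D p (run U interpolateCmd s) j i ≠ 0) ∧
      (∀ j i, rowPoly q D p (run U interpolateCmd s) j i ≠ 0 → i + k * j < D) ∧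
      ∀ r < q, ∀ z < q, ∀ u w, u + w < μ r z →
        ∑ j ∈ Finset.range D, ∑ i ∈ Finset.range D, rowPoly q D p (run U interpolateCmd s) j i *
          shiftCoeff (r : ZMod q) u i * shiftCoeff (z : ZMod q) w j = 0 := by
  have e2 := run_equationsCmd U (run_initCmd U h1 h5 h11 h12 h6 hDB hDm hmB hμ ht hm)
  set s2 := run U equationsCmd (run U initCmd s) with hs2
  have hrun : run U interpolateCmd s = run U remainingCmd s2 := rfl
  rw [hrun]
  have hrd : rd (run U remainingCmd s2) 2 = rd s2 2 :=
    run_rd U _ (by decide) (by decide) (by decide) s2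
  have hel := e2.elim
  have key := run_search U (e := ld 3 (.var 30) (.const 0) (.const 0) (.const 0)) e2.eleven
    (by rw [e2.five]; exact e2.lt) (fun g => rd s2 3 g 0 0 0 ≠ 0) (by
      intro g hg s' hv hr hx
      simp only [eval_ld, eval_var, eval_const, hr, hx])
  rcases key with ⟨h33, hno⟩ | ⟨p, hp, h33, hmp⟩
  · left
    refine ⟨h33, ?_⟩
    have hempty : marked D s2 = ∅ := by
      rw [marked, Finset.filter_eq_empty_iff]
      intro g hg
      exact hno g (Finset.mem_range.1 hg)
    have hc := hel.card
    rw [hempty, Finset.card_empty, zero_add] at hc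
    refine (le_card_monomials hk D).trans ?_
    rw [mul_left_comm]
    refine Nat.mul_le_mul_left k ?_
    refine (Nat.mul_le_mul_left 2 hc).trans ?_
    simp only [Finset.mul_sum]
    simp only [← Finset.mul_sum, two_mul_sum_sub, le_refl]
  · right
    have hpm : p ∈ marked D s2 := by simpa [marked] using ⟨hp, hmp⟩
    have hD : 0 < D := Nat.pos_of_ne_zero (by rintro rfl; simp at hp)
    have hidx : ∀ j < D, ∀ i < D, j * D + i < D * D := fun j hj i hi => by nlinarith
    have hmod : ∀ j, ∀ i < D, (j * D + i) % D = i ∧ (j * D + i) / D = j := fun j i hi => by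
      rw [add_comm, Nat.add_mul_mod_self_right, Nat.mod_eq_of_lt hi, Nat.add_mul_div_right _ _ hD,
        Nat.div_eq_of_lt hi, zero_add]
      exact ⟨rfl, rfl⟩
    have hrow : ∀ j < D, ∀ i < D, rowPoly q D p (run U remainingCmd s2) j i =
        rows q D s2 p (j * D + i) := by
      intro j hj i hi
      rw [rowPoly, if_pos ⟨hj, hi⟩, rows, if_pos (hidx j hj i hi), hrd]
    refine ⟨p, h33, ⟨p / D, p % D, ?_⟩, ?_, ?_⟩
    · rw [hrow _ ((Nat.div_lt_iff_lt_mul hD).2 hp) _ (Nat.mod_lt _ hD), Nat.div_add_mod']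
      exact hel.diag p hpm
    · intro j i hne
      have hji : j < D ∧ i < D := by
        by_contra hcon
        exact hne (if_neg hcon)
      rw [hrow j hji.1 i hji.2] at hne
      have := hel.supp p hpm _ hne
      rw [monomials, Finset.mem_filter, (hmod j i hji.2).1, (hmod j i hji.2).2] at this
      exact this.2
    · intro r hr z hz u w huw
      have := hel.eqs p hpm (functional q D r z u w)
        ⟨r, hr, z, hz, u, by omega, w, by omega, rfl⟩
      rw [functional_apply, sum_range_mul_eq] at this
      rw [← this]
      refine Finset.sum_congr rfl fun j hj => Finset.sum_congr rfl fun i hi => ?_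
      have hj := Finset.mem_range.1 hj
      have hi := Finset.mem_range.1 hi
      rw [hrow j hj i hi, (hmod j i hi).1, (hmod j i hi).2, mul_assoc]

end ListDecoder

namespace ListDecoder

open Polynomial Cmd

/-! ### Correctness of the search for roots -/

variable {q l m : ℕ} [Fact q.Prime] (U : Matrix (Block q l m) (Block q l m) ℂ)

/-- The state of the search for roots of the polynomial `N`. -/
structure RootState (q : ℕ) [Fact q.Prime] (n B D Dm p : ℕ) (N : ℕ → ℕ → ZMod q) (s : MState) :
    Prop where
  zero : s.vars 0 = n
  one : s.vars 1 = q
  five : s.vars 5 = B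
  twelve : s.vars 12 = D
  thirteen : s.vars 13 = D * (n + 1)
  row : s.vars 33 = p + 1
  le : D ≤ Dm
  lt : D * (n + 1) < B
  ltq : q < B
  table : Table q Dm s
  poly : rowPoly q D p s = N

theorem RootState.congr {n B D Dm p : ℕ} {N : ℕ → ℕ → ZMod q} {s s' : MState}
    (h : RootState q n B D Dm p N s)
    (hv : ∀ x ∈ [0, 1, 5, 12, 13, 33], s'.vars x = s.vars x)
    (h1 : rd s' 1 = rd s 1) (h2 : rd s' 2 = rd s 2) : RootState q n B D Dm p N s' where
  zero := (hv 0 (by simp)).trans h.zero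
  one := (hv 1 (by simp)).trans h.one
  five := (hv 5 (by simp)).trans h.five
  twelve := (hv 12 (by simp)).trans h.twelve
  thirteen := (hv 13 (by simp)).trans h.thirteen
  row := (hv 33 (by simp)).trans h.row
  le := h.le
  lt := h.lt
  ltq := h.ltq
  table := by have := h.table; unfold Table at this ⊢; rwa [h1]
  poly := by have := h.poly; unfold rowPoly at this ⊢; rwa [h2]

/-- The command does not change what a `RootState` is about. -/
def keepsRoot (c : Cmd) : Bool :=
  ([0, 1, 5, 12, 13, 33].all fun x => !c.wv x) && !c.wa 1 && !c.wa 2 && c.wf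

theorem RootState.run {n B D Dm p : ℕ} {N : ℕ → ℕ → ZMod q} {s : MState}
    (h : RootState q n B D Dm p N s) (c : Cmd) (hc : keepsRoot c = true) :
    RootState q n B D Dm p N (run U c s) := by
  simp only [keepsRoot, Bool.and_eq_true, List.all_eq_true, Bool.not_eq_true'] at hc
  exact h.congr (fun x hx => run_vars U c (hc.1.1.1 x hx) s)
    (run_rd U c hc.2 (by decide) hc.1.1.2 s) (run_rd U c hc.2 (by decide) hc.1.2 s)

theorem RootState.frame {n B D Dm p : ℕ} {N : ℕ → ℕ → ZMod q} {s s' : MState}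
    (h : RootState q n B D Dm p N s) {c : Cmd} (hc : keepsRoot c = true) {x : ℕ}
    (hx : x ∉ [0, 1, 5, 12, 13, 33]) (hf : Frame c x s s') : RootState q n B D Dm p N s' := by
  simp only [keepsRoot, Bool.and_eq_true, List.all_eq_true, Bool.not_eq_true'] at hc
  exact h.congr (fun z hz => hf.vars z (fun e => hx (e ▸ hz)) (hc.1.1.1 z hz))
    (hf.arr 1 (by decide) hc.1.1.2) (hf.arr 2 (by decide) hc.1.2)

theorem RootState.setV {n B D Dm p : ℕ} {N : ℕ → ℕ → ZMod q} {s : MState}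
    (h : RootState q n B D Dm p N s) {x w : ℕ} (hx : x ∉ [0, 1, 5, 12, 13, 33]) :
    RootState q n B D Dm p N (setV s x w) := by
  refine h.congr (fun z hz => ?_) rfl rfl
  have : z ≠ x := fun e => hx (e ▸ hz)
  simp [this]

/-- Array 5 contains the coefficients of `N`. -/
def Stores (q D W : ℕ) (N : ℕ → ℕ → ZMod q) (s : MState) : Prop :=
  ∀ j < D, ∀ i < W, (rd s 5 j i 0 0 : ZMod q) = N j i

/-- The array is padded with zeros up to width `D(n+1)`, the room needed for `n` shifts. -/
theorem run_rootCell {n B D Dm p : ℕ} {N : ℕ → ℕ → ZMod q} {s : MState}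
    (h : RootState q n B D Dm p N s) :
    Stores q D (D * (n + 1)) N (run U (rep 50 12 (rep 51 13 rootCell)) s) := by
  intro j hj i hi
  refine run_rep_rep_fill U 5 (fun j i w => (w : ZMod q) = N j i)
    (x := 50) (y := 12) (x' := 51) (y' := 13) (c := rootCell) (by decide) (by decide)
    (by decide) (by decide) (by decide) (by decide) (by decide) (by decide) (s := s) ?_
    (by rw [h.twelve]; exact hj) (by rw [h.thirteen]; exact hi)
  intro a ha b hb s' hv ha' h50 h51 _
  rw [h.twelve] at ha
  refine ⟨((if b < D then 1 else 0) * rd s 2 p (a * D + b) 0 0) % q, ?_, fun a' b' e d => ?_⟩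
  · rw [ZMod.natCast_mod, ← h.poly, rowPoly]
    by_cases hbD : b < D
    · simp [hbD, ha]
    · simp [hbD]
  · simp only [rootCell, run, eval_lt', eval_ld, eval_sub', eval_mul', eval_add', eval_var,
      eval_const, h50, h51, hv 1 (by decide) (by decide) (by decide), h.one,
      hv 12 (by decide) (by decide) (by decide), h.twelve,
      hv 33 (by decide) (by decide) (by decide), h.row, ha' 2 (by decide) (by decide),
      Nat.add_sub_cancel]
    rw [rd_setC _ (by decide) (by decide)]
    simp only [true_and]

/-- Each new coefficient draws on many old ones, so the result is built up in array 6 and copied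
back only when it is complete. -/
theorem run_shiftCmd {n B D Dm p : ℕ} {N N' : ℕ → ℕ → ZMod q} {s : MState}
    (h : RootState q n B D Dm p N s) (hN' : Stores q D (D * (n + 1)) N' s) {a e b : ℕ}
    (h63 : s.vars 63 = a) (h52 : s.vars 52 = e) (hb : rd s 7 a e 0 0 = b) (hbq : b < q) :
    Stores q D (D * (n + 1)) (shiftStep D (b : ZMod q) N') (run U shiftCmd s) := by
  have : NeZero q := ⟨(Fact.out : q.Prime).ne_zero⟩
  have hbB : b < B := hbq.trans h.ltq
  set s1 := setV s 54 b with hs1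
  set s2 := run U (rep 50 12 (rep 51 13 shiftCell)) s1 with hs2
  have hrun : run U shiftCmd s = run U (rep 50 12 (rep 51 13 copyCell)) s2 := by
    simp only [shiftCmd, run, eval_ld, eval_var, eval_const, h63, h52, hb, h.five,
      Nat.mod_eq_of_lt hbB]
    rfl
  have r1 : RootState q n B D Dm p N s1 := h.setV (by decide)
  have r2 : RootState q n B D Dm p N s2 := r1.run U _ (by decide)
  have h6 : ∀ j < D, ∀ i < D * (n + 1), (rd s2 6 j i 0 0 : ZMod q) =
      shiftStep D (b : ZMod q) N' j i := by
    intro j hj i hi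
    refine run_rep_rep_fill U 6 (fun j i w => (w : ZMod q) = shiftStep D (b : ZMod q) N' j i)
      (x := 50) (y := 12) (x' := 51) (y' := 13) (c := shiftCell) (by decide) (by decide)
      (by decide) (by decide) (by decide) (by decide) (by decide) (by decide) (s := s1) ?_
      (by rw [r1.twelve]; exact hj) (by rw [r1.thirteen]; exact hi)
    intro j hj i hi s' hv ha' h50 h51 _
    rw [r1.twelve] at hj
    rw [r1.thirteen] at hi
    set e1 : Expr := .mul (ld 1 (.var 54) (.var 50) (.var 55) (.const 0))
      (ld 5 (.var 55) (.sub (.var 51) (.var 50)) (.const 0) (.const 0)) with he1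
    have hacc := run_accum U (acc := 31) (x := 55) (y := 12) (e := e1) (by decide)
      (by decide) (by decide) (s := setV s' 31 0)
      (by simp [hv 1 (by decide) (by decide) (by decide), r1.one])
      (fun k => shiftCoeff (b : ZMod q) j k * N' k (i - j)) ?_
    · have e12 : (setV s' 31 0).vars 12 = D := by
        simp [hv 12 (by decide) (by decide) (by decide), r1.twelve]
      rw [e12] at hacc
      set s3 := run U (accum 31 55 12 e1) (setV s' 31 0) with hs3
      have hv3 : ∀ x, x ≠ 31 → x ≠ 55 → s3.vars x = s'.vars x := by
        intro x hx hx'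
        rw [hs3, run_vars U _ (by simp [accum, wv, Ne.symm hx, Ne.symm hx'])]
        simp [hx]
      have hrun3 : run U shiftCell s' = setC s3 6 j i 0 0
          ((if j < i + 1 then 1 else 0) * s3.vars 31 % q) := by
        have e50 := hv3 50 (by decide) (by decide)
        have e51 := hv3 51 (by decide) (by decide)
        have e1' := hv3 1 (by decide) (by decide)
        rw [h50] at e50
        rw [h51] at e51
        rw [hv 1 (by decide) (by decide) (by decide), r1.one] at e1'
        simp only [shiftCell, run, eval_mul', eval_lt', eval_add', eval_var, eval_const,
          Nat.zero_mod, ← he1]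
        rw [← hs3, e50, e51, e1']
      refine ⟨(if j < i + 1 then 1 else 0) * s3.vars 31 % q, ?_, fun a' b' e d => ?_⟩
      · rw [ZMod.natCast_mod, Nat.cast_mul, hacc, shiftStep]
        by_cases hji : j ≤ i
        · simp [hji, Nat.lt_succ_of_le hji]
        · simp [hji, show ¬ j < i + 1 by omega]
      · rw [hrun3, rd_setC _ (by decide) (by decide)]
        have : rd s3 6 = rd s' 6 := run_rd U _ (by decide) (by decide) (by decide) _
        simp only [true_and, this]
    · intro k hk s3 hv3 hr3 hk3
      have hk' : k < D := by
        simpa [hv 12 (by decide) (by decide) (by decide), r1.twelve] using hk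
      have e54 : s3.vars 54 = b := by
        rw [hv3 54 (by decide) (by decide)]
        simp [hv 54 (by decide) (by decide) (by decide), hs1]
      have e50 : s3.vars 50 = j := by rw [hv3 50 (by decide) (by decide)]; simpa using h50
      have e51 : s3.vars 51 = i := by rw [hv3 51 (by decide) (by decide)]; simpa using h51
      simp only [he1, eval_mul', eval_ld, eval_var, eval_sub', eval_const, hr3, setV_rd, e54, e50,
        e51, hk3, ha' 1 (by decide) (by decide), ha' 5 (by decide) (by decide), Nat.cast_mul]
      rw [r1.table b hbq j (hj.trans_le h.le) k (hk'.trans_le h.le)]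
      congr 1
      exact hN' k hk' (i - j) (by omega)
  rw [hrun]
  intro j hj i hi
  refine run_rep_rep_fill U 5 (fun j i w => (w : ZMod q) = shiftStep D (b : ZMod q) N' j i)
    (x := 50) (y := 12) (x' := 51) (y' := 13) (c := copyCell) (by decide) (by decide)
    (by decide) (by decide) (by decide) (by decide) (by decide) (by decide) (s := s2) ?_
    (by rw [r2.twelve]; exact hj) (by rw [r2.thirteen]; exact hi)
  intro j hj i hi s' hv ha' h50 h51 _
  rw [r2.twelve] at hj
  rw [r2.thirteen] at hi
  refine ⟨rd s2 6 j i 0 0 % q, ?_, fun a' b' e d => ?_⟩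
  · rw [ZMod.natCast_mod, h6 j hj i hi]
  · simp only [copyCell, run, eval_ld, eval_var, eval_const, h50, h51,
      hv 1 (by decide) (by decide) (by decide), r2.one, ha' 6 (by decide) (by decide)]
    rw [rd_setC _ (by decide) (by decide)]
    simp only [true_and]

/-- The polynomial at a node is recomputed from the root along the path, so only the paths have to
be stored. -/
theorem run_nodeCmd {n B D Dm p : ℕ} {N : ℕ → ℕ → ZMod q} {s : MState}
    (h : RootState q n B D Dm p N s) {a : ℕ} {g : List ℕ} (h63 : s.vars 63 = a)
    (h60 : s.vars 60 = g.length) (hg : ∀ e < g.length, rd s 7 a e 0 0 = g.getD e 0)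
    (hgq : ∀ b ∈ g, b < q) :
    Stores q D (D * (n + 1)) (node D N g) (run U nodeCmd s) := by
  set s1 := run U (rep 50 12 (rep 51 13 rootCell)) s with hs1
  have hrun : run U nodeCmd s = run U (rep 52 60 shiftCmd) s1 := rfl
  have r1 : RootState q n B D Dm p N s1 := h.run U _ (by decide)
  have e60 : s1.vars 60 = g.length := by rw [hs1, run_vars U _ (by decide), h60]
  have key := run_rep_frame U (fun e s' => Stores q D (D * (n + 1)) (node D N (g.take e)) s')
    (x := 52) (y := 60) (c := shiftCmd) (by decide) (by decide) (s := s1) ?_ ?_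
  · rw [e60, List.take_length] at key
    exact key
  · exact run_rootCell U h
  · intro e he s' hf h52 hI
    rw [e60] at he
    have r' := r1.frame (by decide) (by decide) hf
    have e63 : s'.vars 63 = a := by
      rw [hf.vars 63 (by decide) (by decide), hs1, run_vars U _ (by decide), h63]
    have e7 : rd s' 7 a e 0 0 = g[e] := by
      rw [hf.arr 7 (by decide) (by decide), hs1, run_rd U _ (by decide) (by decide) (by decide),
        hg e he, List.getD_eq_getElem _ _ he]
    have := run_shiftCmd U r' hI e63 h52 e7 (hgq _ (List.getElem_mem he))
    rw [← node_append, List.take_append_getElem] at this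
    exact this

/-- The outer loop runs through the exponents of `X` in increasing order, and the variable is set
only while it is 0. So it keeps the first exponent that has a nonzero coefficient. -/
theorem run_orderCmd {n B D Dm p : ℕ} {N N' : ℕ → ℕ → ZMod q} {s : MState}
    (h : RootState q n B D Dm p N s) (hN' : Stores q D (D * (n + 1)) N' s) {o : ℕ}
    (ho : IsOrder N' o) (hs : ∀ j i, N' j i ≠ 0 → j < D ∧ i < D * (n + 1)) :
    (run U orderCmd s).vars 56 = o + 1 := by
  have hs1 : run U (set 56 5 (.const 0)) s = setV s 56 0 := by simp [run]
  have hrun : run U orderCmd s = run U (rep 51 13 (rep 50 12 orderTest)) (setV s 56 0) := by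
    rw [orderCmd, run, hs1]
  have r1 : RootState q n B D Dm p N (setV s 56 0) := h.setV (by decide)
  have ho' : o < D * (n + 1) := by
    obtain ⟨j, hj⟩ := ho.1
    exact (hs j o hj).2
  have key := run_rep_frame U (fun i s' => s'.vars 56 = if o < i then o + 1 else 0)
    (x := 51) (y := 13) (c := rep 50 12 orderTest) (by decide) (by decide) (s := setV s 56 0)
    (by simp) ?_
  · rw [r1.thirteen, ← hrun, if_pos ho'] at key
    exact key
  intro i hi s1 hf1 h51 hI1
  rw [r1.thirteen] at hi
  have r2 := r1.frame (by decide) (by decide) hf1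
  have key := run_rep_frame U (fun j s' => s'.vars 56 = if o < i ∨ (o = i ∧ ∃ j' < j, N' j' i ≠ 0)
      then o + 1 else 0)
    (x := 50) (y := 12) (c := orderTest) (by decide) (by decide) (s := s1) (by simp [hI1]) ?_
  · rw [r2.twelve] at key
    simp only [setV_vars]
    rw [if_neg (by decide), key]
    congr 1
    rw [Nat.lt_succ_iff_lt_or_eq, eq_iff_iff]
    refine or_congr_right ⟨fun hh => hh.1, fun hh => ⟨hh, ?_⟩⟩
    obtain ⟨j, hj⟩ := ho.1
    exact ⟨j, (hs j o hj).1, hh ▸ hj⟩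
  · intro j hj s2 hf2 h50 hI2
    rw [r2.twelve] at hj
    have r3 := r2.frame (by decide) (by decide) hf2
    have e51 : s2.vars 51 = i := by rw [hf2.vars 51 (by decide) (by decide), h51]
    have e5 : (rd s2 5 j i 0 0 : ZMod q) = N' j i := by
      rw [hf2.arr 5 (by decide) (by decide), hf1.arr 5 (by decide) (by decide)]
      exact hN' j hj i hi
    have hz : rd s2 5 j i 0 0 % q = 0 ↔ N' j i = 0 := by
      rw [← e5, ZMod.natCast_eq_zero_iff, Nat.dvd_iff_mod_eq_zero]
    have htest : (run U orderTest s2).vars 56 =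
        if s2.vars 56 = 0 ∧ N' j i ≠ 0 then i + 1 else s2.vars 56 := by
      simp only [orderTest, run, eval_mul', eval_eq', eval_var, eval_const, eval_mod', eval_ld,
        h50, e51, r3.one, r3.five, eval_add']
      by_cases hc : s2.vars 56 = 0 ∧ N' j i ≠ 0
      · rw [if_pos hc, if_pos (by simp [hc.1, hz, hc.2])]
        simpa using Nat.mod_eq_of_lt (by have := h.lt; omega)
      · rw [if_neg hc, if_neg]
        · simp [nop, run]
        · rw [not_not]
          by_cases h56 : s2.vars 56 = 0
          · have : N' j i = 0 := by
              by_contra hne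
              exact hc ⟨h56, hne⟩
            simp [hz.2 this]
          · simp [h56]
    simp only [setV_vars]
    rw [if_neg (by decide), htest, hI2]
    by_cases hoi : o < i
    · simp [hoi]
    · by_cases hne : N' j i = 0
      · have : (∃ j' < j + 1, N' j' i ≠ 0) ↔ ∃ j' < j, N' j' i ≠ 0 := by
          constructor
          · rintro ⟨j', hj', hh⟩
            rcases Nat.lt_succ_iff_lt_or_eq.1 hj' with h | rfl
            · exact ⟨j', h, hh⟩
            · exact absurd hne hh
          · rintro ⟨j', hj', hh⟩
            exact ⟨j', by omega, hh⟩
        simp only [this]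
        simp [hne]
      · have hio : o = i := by
          by_contra hcon
          exact hne (ho.2 i (by omega) j)
        subst hio
        have : ∃ j' < j + 1, N' j' o ≠ 0 := ⟨j, by omega, hne⟩
        simp only [lt_irrefl, true_and, false_or, if_pos this]
        split_ifs with h1 h2 <;> simp_all

end ListDecoder

/-! ### Lists of nodes: children, levels and output -/

namespace ListDecoder

open Polynomial Cmd

variable {q l m : ℕ} (U : Matrix (Block q l m) (Block q l m) ℂ)

/-- The array `k` contains the first `d` entries of each of the lists in `ls`. -/
def Nodes (k d : ℕ) (ls : List (List ℕ)) (s : MState) : Prop :=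
  ∀ a < ls.length, ∀ e < d, rd s k a e 0 0 = (ls.getD a []).getD e 0

theorem run_appendChild {B d a b : ℕ} {g : List ℕ} {ls : List (List ℕ)} {s : MState}
    (h5 : s.vars 5 = B) (h60 : s.vars 60 = d) (h62 : s.vars 62 = ls.length) (h63 : s.vars 63 = a)
    (h58 : s.vars 58 = b) (hb : b < B) (hgl : g.length = d)
    (hg : ∀ e < d, rd s 7 a e 0 0 = g.getD e 0) (hgB : ∀ e < d, g.getD e 0 < B)
    (hls : Nodes 8 (d + 1) ls s) (hlen : ls.length + 1 < B) :
    (run U appendChild s).vars 62 = (ls ++ [g ++ [b]]).length ∧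
      Nodes 8 (d + 1) (ls ++ [g ++ [b]]) (run U appendChild s) := by
  set s1 := run U (rep 59 60 inheritCell) s with hs1
  have hv1 : ∀ x, x ≠ 59 → s1.vars x = s.vars x := fun x hx =>
    run_vars U _ (by simp [wv, inheritCell, Ne.symm hx]) s
  have hrun : run U appendChild s =
      setV (setC s1 8 ls.length d 0 0 b) 62 (ls.length + 1) := by
    simp only [appendChild, run_seq, run_set, run_put, eval_var, eval_const, eval_add', ← hs1, setC_vars,
      hv1 62 (by decide), hv1 60 (by decide), hv1 58 (by decide), hv1 5 (by decide), h62, h60, h58,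
      h5, Nat.mod_eq_of_lt hb, Nat.mod_eq_of_lt hlen]
  have h1 : ∀ x e, (x = ls.length ∧ e < d → rd s1 8 x e 0 0 = g.getD e 0) ∧
      (¬ (x = ls.length ∧ e < d) → rd s1 8 x e 0 0 = rd s 8 x e 0 0) := by
    intro x e
    have key := run_rep_fill U 8 (fun e x e' i j => x = ls.length ∧ e' = e ∧ i = 0 ∧ j = 0)
      (fun _ e _ _ w => w = g.getD e 0) (x := 59) (y := 60)
      (c := inheritCell) (by decide) (by decide) (s := s) ?_ x e 0 0
    · rw [h60] at key
      constructor
      · rintro ⟨h1, h2⟩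
        exact key.1 ⟨e, h2, h1, rfl, rfl, rfl⟩
      · intro hn
        refine key.2 ?_
        rintro ⟨e', h1, h2, rfl, -⟩
        exact hn ⟨h2, h1⟩
    · intro e he s' hf h59 _ _ x e' i j
      rw [h60] at he
      simp only [inheritCell, run, eval_ld, eval_var, eval_const, h59,
        hf.vars 62 (by decide) (by decide), hf.vars 63 (by decide) (by decide),
        hf.vars 5 (by decide) (by decide), h62, h63, h5, hf.arr 7 (by decide) (by decide), hg e he,
        Nat.mod_eq_of_lt (hgB e he)]
      rw [rd_setC _ (by decide) (by decide)]
      constructor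
      · rintro ⟨rfl, rfl, rfl, rfl⟩
        simp
      · intro hn
        rw [if_neg fun hh => hn hh.2]
  rw [hrun]
  refine ⟨by simp, ?_⟩
  intro x hx e he
  rw [setV_rd, rd_setC _ (by decide) (by decide)]
  simp only [List.length_append, List.length_singleton] at hx
  by_cases hxl : x = ls.length
  · subst hxl
    rw [List.getD_append_right _ _ _ _ le_rfl]
    simp only [Nat.sub_self, List.getD_cons_zero, true_and, and_true]
    by_cases hed : e = d
    · subst hed
      rw [if_pos rfl, List.getD_append_right _ _ _ _ hgl.le]
      simp [hgl]
    · rw [if_neg hed, (h1 _ e).1 ⟨rfl, by omega⟩, List.getD_append _ _ _ _ (by omega)]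
  · rw [if_neg (by simp [hxl]), (h1 x e).2 (by simp [hxl]), hls x (by omega) e he,
      List.getD_append _ _ _ _ (by omega)]

theorem run_outputCmd {n : ℕ} {ls : List (List ℕ)} {s : MState} (h0 : s.vars 0 = n)
    (h61 : s.vars 61 = ls.length) (hls : Nodes 7 n ls s) (hlen : ∀ g ∈ ls, g.length = n) :
    (run U outputCmd s).out = s.out ++ ls.flatten := by
  have key := run_rep_frame U (fun a s' => s'.out = s.out ++ (ls.take a).flatten) (x := 63)
    (y := 61) (c := rep 59 0 emitCell) (by decide) (by decide) (s := s) (by simp) ?_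
  · rw [h61, List.take_length] at key
    exact key
  intro a ha s1 hf1 h63 hI1
  rw [h61] at ha
  have e0 : s1.vars 0 = n := by rw [hf1.vars 0 (by decide) (by decide), h0]
  have hl : ls[a].length = n := hlen _ (List.getElem_mem ha)
  have key := run_rep_frame U (fun e s' => s'.out = s1.out ++ ls[a].take e) (x := 59)
    (y := 0) (c := emitCell) (by decide) (by decide) (s := s1) (by simp) ?_
  · rw [e0, ← hl, List.take_length] at key
    rw [setV_out, key, hI1, ← List.take_append_getElem ha, List.flatten_append]
    simp
  intro e he s2 hf2 h59 hI2
  rw [e0] at he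
  have e7 : rd s2 7 a e 0 0 = ls[a][e] := by
    rw [hf2.arr 7 (by decide) (by decide), hf1.arr 7 (by decide) (by decide), hls a ha e he,
      List.getD_eq_getElem _ _ ha, List.getD_eq_getElem _ _ (by omega)]
  simp only [emitCell, run, eval_ld, eval_var, eval_const, h59,
    hf2.vars 63 (by decide) (by decide), h63, e7, setV_out]
  rw [hI2, List.append_assoc, List.take_append_getElem]

variable [Fact q.Prime]

/-- The powers of `b` are the table entries with `u = 0`. The accumulator is a reduced residue, so
testing the number for 0 is the same as testing the field element. -/
theorem run_sliceValue {n B D Dm p : ℕ} {N N' : ℕ → ℕ → ZMod q} {s : MState}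
    (h : RootState q n B D Dm p N s) (hN' : Stores q D (D * (n + 1)) N' s) {o b : ℕ}
    (h56 : s.vars 56 = o + 1) (ho : o < D * (n + 1)) (h58 : s.vars 58 = b) (hb : b < q) :
    (run U sliceValue s).vars 31 = 0 ↔ (slice D N' o).eval (b : ZMod q) = 0 := by
  have : NeZero q := ⟨(Fact.out : q.Prime).ne_zero⟩
  set e1 : Expr := .mul (ld 5 (.var 55) (.sub (.var 56) (.const 1)) (.const 0) (.const 0))
    (ld 1 (.var 58) (.const 0) (.var 55) (.const 0)) with he1
  have hrun : run U sliceValue s = run U (accum 31 55 12 e1) (setV s 31 0) := by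
    simp [sliceValue, run, ← he1]
  have hlt : (run U sliceValue s).vars 31 < q := by
    rw [hrun, accum]
    refine (run_rep U (fun _ s' => s'.vars 31 < q ∧ s'.vars 1 = q) (by simp [wv]) ?_ ?_).1
    · simpa [h.one] using (Fact.out : q.Prime).pos
    · rintro i _ s' ⟨_, h2⟩ _
      simp only [run, setV_vars]
      simp only [h2]
      exact ⟨by simpa using Nat.mod_lt _ (Fact.out : q.Prime).pos, by simp⟩
  have hacc := run_accum U (acc := 31) (x := 55) (y := 12) (e := e1) (by decide)
    (by decide) (by decide) (s := setV s 31 0) (by simp [h.one])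
    (fun j => N' j o * (b : ZMod q) ^ j) ?_
  · rw [← hrun] at hacc
    have e12 : (setV s 31 0).vars 12 = D := by simp [h.twelve]
    rw [e12] at hacc
    rw [eval_slice]
    simp only [setV_vars, if_true, Nat.cast_zero, zero_add] at hacc
    rw [← hacc, ZMod.natCast_eq_zero_iff]
    exact ⟨fun h0 => h0 ▸ dvd_zero q, fun hd => Nat.eq_zero_of_dvd_of_lt hd hlt⟩
  · intro j hj s' hv hr hj'
    have hjD : j < D := by simpa [h.twelve] using hj
    simp only [he1, eval_mul', eval_ld, eval_var, eval_sub', eval_const, hr, setV_rd, hj',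
      hv 56 (by decide) (by decide), hv 58 (by decide) (by decide), setV_vars, Nat.cast_mul]
    rw [if_neg (by decide), if_neg (by decide), h56, h58, Nat.add_sub_cancel, hN' j hjD o ho,
      h.table b hb 0 (by have := h.le; omega) j (hjD.trans_le h.le), shiftCoeff_zero_left]

theorem run_childCmd {n B D Dm p : ℕ} {N : ℕ → ℕ → ZMod q} {s : MState}
    (h : RootState q n B D Dm p N s) {a : ℕ} {g : List ℕ} {ls : List (List ℕ)}
    (hst : Stores q D (D * (n + 1)) (node D N g) s)
    (h56 : s.vars 56 = order (node D N g) + 1) (ho : order (node D N g) < D * (n + 1))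
    (h60 : s.vars 60 = g.length) (h62 : s.vars 62 = ls.length) (h63 : s.vars 63 = a)
    (hg : ∀ e < g.length, rd s 7 a e 0 0 = g.getD e 0) (hgq : ∀ b ∈ g, b < q)
    (hls : Nodes 8 (g.length + 1) ls s) (hlen : ls.length + (children D N g).length < B) :
    (run U (rep 58 1 childCmd) s).vars 62 = (ls ++ children D N g).length ∧
      Nodes 8 (g.length + 1) (ls ++ children D N g) (run U (rep 58 1 childCmd) s) := by
  classical
  set P : ℕ → Bool := fun b => decide ((nodeSlice D N g).eval (b : ZMod q) = 0) with hP
  have hch : children D N g = ((List.range q).filter P).map fun b => g ++ [b] := rfl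
  set pre : ℕ → List (List ℕ) := fun i => ls ++ ((List.range i).filter P).map fun b => g ++ [b]
    with hpre
  have hpre0 : pre 0 = ls := by simp [hpre]
  have key := run_rep_frame U (fun i s' => s'.vars 62 = (pre i).length ∧
      Nodes 8 (g.length + 1) (pre i) s') (x := 58) (y := 1) (c := childCmd) (by decide) (by decide)
    (s := s) (by rw [hpre0]; exact ⟨h62, hls⟩) ?_
  · rw [h.one] at key
    exact key
  rintro b hb s' hf h58 ⟨hI1, hI2⟩
  rw [h.one] at hb
  have r' := h.frame (by decide) (by decide) hf
  set s1 := run U sliceValue s' with hs1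
  have hv1 : ∀ x, x ≠ 31 → x ≠ 55 → s1.vars x = s'.vars x := fun x hx hx' =>
    run_vars U _ (by simp [sliceValue, wv, accum, Ne.symm hx, Ne.symm hx']) s'
  have hrd1 : ∀ k < 16, rd s1 k = rd s' k := fun k hk => run_rd U _ (by decide) hk rfl s'
  have hst' : Stores q D (D * (n + 1)) (node D N g) s' := by
    unfold Stores at hst ⊢
    rwa [hf.arr 5 (by decide) (by decide)]
  have hval := run_sliceValue U r' hst' ((hf.vars 56 (by decide) (by decide)).trans h56) ho h58 hb
  have hrun : run U childCmd s' = if s1.vars 31 ≠ 0 then run U nop s1 else run U appendChild s1 := rfl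
  have hpres : pre (b + 1) = pre b ++ if P b then [g ++ [b]] else [] := by
    simp only [hpre, List.range_succ, List.filter_append, List.map_append, List.append_assoc]
    congr 2
    by_cases hPb : P b <;> simp [hPb]
  have hn1 : Nodes 8 (g.length + 1) (pre b) s1 := by
    unfold Nodes at hI2 ⊢
    rwa [hrd1 8 (by decide)]
  by_cases hPb : P b
  · have h0 : s1.vars 31 = 0 := hval.2 (of_decide_eq_true hPb)
    rw [hrun, if_neg (by simpa using h0), hpres, if_pos hPb]
    -- The children found so far, with the new one, are among all children, so the counter stays
    -- below the modulus `B`.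
    have hle : (pre b).length + 1 ≤ ls.length + (children D N g).length := by
      have h1 : (pre (b + 1)).length ≤ ls.length + (children D N g).length := by
        rw [hch]
        simp only [hpre, List.length_append, List.length_map]
        refine Nat.add_le_add_left (List.Sublist.length_le ?_) _
        exact List.Sublist.filter _ (List.range_sublist.2 hb)
      rw [hpres, if_pos hPb] at h1
      simpa using h1
    have := run_appendChild U (B := B) (d := g.length) (a := a) (b := b) (g := g) (ls := pre b)
      (s := s1) (by rw [hv1 5 (by decide) (by decide), r'.five])
      (by rw [hv1 60 (by decide) (by decide), hf.vars 60 (by decide) (by decide), h60])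
      (by rw [hv1 62 (by decide) (by decide), hI1])
      (by rw [hv1 63 (by decide) (by decide), hf.vars 63 (by decide) (by decide), h63])
      (by rw [hv1 58 (by decide) (by decide), h58]) (hb.trans h.ltq) rfl
      (by
        intro e he
        rw [hrd1 7 (by decide), hf.arr 7 (by decide) (by decide), hg e he])
      (by
        intro e he
        rw [List.getD_eq_getElem _ _ he]
        exact (hgq _ (List.getElem_mem he)).trans h.ltq)
      hn1 (by omega)
    exact this
  · have h0 : s1.vars 31 ≠ 0 := fun h0 => hPb (decide_eq_true (hval.1 h0))
    rw [hrun, if_pos h0, hpres, if_neg hPb, List.append_nil]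
    refine ⟨?_, hn1⟩
    rw [← hI1, ← hv1 62 (by decide) (by decide)]
    simp [nop, run]

theorem run_expandCmd {n B D Dm p : ℕ} {N : ℕ → ℕ → ZMod q} {s : MState}
    (h : RootState q n B D Dm p N s) (hN : ∀ j i, N j i ≠ 0 → j < D ∧ i < D)
    (h0 : ∃ j i, N j i ≠ 0) {a : ℕ} {g : List ℕ} {ls : List (List ℕ)} (hgn : g.length ≤ n)
    (h60 : s.vars 60 = g.length) (h62 : s.vars 62 = ls.length) (h63 : s.vars 63 = a)
    (hg : ∀ e < g.length, rd s 7 a e 0 0 = g.getD e 0) (hgq : ∀ b ∈ g, b < q)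
    (hls : Nodes 8 (g.length + 1) ls s) (hlen : ls.length + (children D N g).length < B) :
    (run U expandCmd s).vars 62 = (ls ++ children D N g).length ∧
      Nodes 8 (g.length + 1) (ls ++ children D N g) (run U expandCmd s) := by
  have hsupp : ∀ j i, node D N g j i ≠ 0 → j < D ∧ i < D * (n + 1) := by
    intro j i hne
    have h1 := node_support hN g j i hne
    have h2 : g.length * D ≤ n * D := Nat.mul_le_mul_right D hgn
    refine ⟨h1.1, h1.2.trans_le ?_⟩
    rw [mul_add, mul_one, mul_comm D n]
    omega
  have hord := node_isOrder hN h0 g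
  have ho : order (node D N g) < D * (n + 1) := by
    obtain ⟨j, hj⟩ := hord.1
    exact (hsupp _ _ hj).2
  set s1 := run U nodeCmd s with hs1
  set s2 := run U orderCmd s1 with hs2
  have r1 : RootState q n B D Dm p N s1 := h.run U _ (by decide)
  have r2 : RootState q n B D Dm p N s2 := r1.run U _ (by decide)
  have hst1 := run_nodeCmd U h h63 h60 hg hgq
  have h56 := run_orderCmd U r1 hst1 hord hsupp
  have hrd2 : ∀ k < 16, nodeCmd.wa k = false → orderCmd.wa k = false → rd s2 k = rd s k := by
    intro k hk e1 e2
    rw [hs2, run_rd U _ (by decide) hk e2, hs1, run_rd U _ (by decide) hk e1]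
  have hv2 : ∀ x, nodeCmd.wv x = false → orderCmd.wv x = false → s2.vars x = s.vars x := by
    intro x e1 e2
    rw [hs2, run_vars U _ e2, hs1, run_vars U _ e1]
  refine run_childCmd U (s := s2) r2 (a := a) ?_ h56 ho ?_ ?_ ?_ ?_ hgq ?_ hlen
  · unfold Stores at hst1 ⊢
    rw [hs2, run_rd U _ (by decide) (by decide) (by decide)]
    exact hst1
  · rw [hv2 60 (by decide) (by decide), h60]
  · rw [hv2 62 (by decide) (by decide), h62]
  · rw [hv2 63 (by decide) (by decide), h63]
  · intro e he
    rw [hrd2 7 (by decide) (by decide) (by decide), hg e he]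
  · unfold Nodes at hls ⊢
    rwa [hrd2 8 (by decide) (by decide) (by decide)]

/-- The new level is collected in array 8 while array 7 is still being read. Every level has at most
`D < B` nodes, so the counters are not affected by the reduction. -/
theorem run_levelCmd {n B D Dm p : ℕ} {N : ℕ → ℕ → ZMod q} {s : MState}
    (h : RootState q n B D Dm p N s) (hN : ∀ j i, N j i ≠ 0 → j < D ∧ i < D)
    (h0 : ∃ j i, N j i ≠ 0) {d : ℕ} (hd : d < n) (h60 : s.vars 60 = d)
    (h61 : s.vars 61 = (level D N d).length) (hls : Nodes 7 d (level D N d) s) :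
    (run U levelCmd s).vars 61 = (level D N (d + 1)).length ∧
      Nodes 7 (d + 1) (level D N (d + 1)) (run U levelCmd s) := by
  have hDB : D < B := by have := h.lt; nlinarith
  have hlenD : ∀ d, (level D N d).length < B := fun d =>
    (length_level_le hN h0 d).trans_lt hDB
  set ls := level D N d with hlsd
  set s1 := run U (rep 63 61 expandCmd) (setV s 62 0) with hs1
  set s2 := run U (rep 63 62 (rep 59 0 copyNodeCell)) s1 with hs2
  have hrun : run U levelCmd s = setV s2 61 (s2.vars 62 % s2.vars 5) := by
    simp only [levelCmd, run_seq, run_set, eval_var, eval_const, Nat.zero_mod, ← hs1, ← hs2]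
  have r0 : RootState q n B D Dm p N (setV s 62 0) := h.setV (by decide)
  have r1 : RootState q n B D Dm p N s1 := r0.run U _ (by decide)
  have r2 : RootState q n B D Dm p N s2 := r1.run U _ (by decide)
  have key := run_rep_frame U (fun a s' => s'.vars 62 = ((ls.take a).flatMap (children D N)).length ∧
      Nodes 8 (d + 1) ((ls.take a).flatMap (children D N)) s') (x := 63) (y := 61) (c := expandCmd)
    (by decide) (by decide) (s := setV s 62 0) (by simp [Nodes]) ?_
  · have e61 : (setV s 62 0).vars 61 = ls.length := by simp [h61]
    rw [e61, List.take_length] at key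
    have hlev : level D N (d + 1) = ls.flatMap (children D N) := rfl
    rw [← hlev] at key
    obtain ⟨k1, k2⟩ := key
    have e62 : s2.vars 62 = (level D N (d + 1)).length := by
      rw [hs2, run_vars U _ (by decide)]
      exact k1
    rw [hrun, e62, r2.five, Nat.mod_eq_of_lt (hlenD _)]
    refine ⟨by simp, ?_⟩
    intro a ha e he
    rw [setV_rd]
    have hspec := level_spec D N (d + 1) ((level D N (d + 1)).getD a []) (by
      rw [List.getD_eq_getElem _ _ ha]; exact List.getElem_mem ha)
    have hlt : ((level D N (d + 1)).getD a []).getD e 0 < B := by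
      rw [List.getD_eq_getElem _ _ (by rw [hspec.1]; exact he)]
      exact (hspec.2 _ (List.getElem_mem _)).trans h.ltq
    have h8 : rd s1 8 a e 0 0 = ((level D N (d + 1)).getD a []).getD e 0 := k2 a ha e he
    rw [← Nat.mod_eq_of_lt hlt, ← h8]
    refine run_rep_rep_fill U 7 (fun a e w => w = rd s1 8 a e 0 0 % B)
      (x := 63) (y := 62) (x' := 59) (y' := 0) (c := copyNodeCell) (by decide) (by decide)
      (by decide) (by decide) (by decide) (by decide) (by decide) (by decide) (s := s1) ?_
      (by rw [k1]; exact ha) (by rw [r1.zero]; omega)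
    intro a _ e _ s' hv ha' h63 h59 _
    refine ⟨_, rfl, fun a' b' i j => ?_⟩
    simp only [copyNodeCell, run, eval_ld, eval_var, eval_const, h63, h59,
      hv 5 (by decide) (by decide) (by decide), r1.five, ha' 8 (by decide) (by decide)]
    rw [rd_setC _ (by decide) (by decide)]
    simp only [true_and]
  · rintro a ha s' hf h63 ⟨hI1, hI2⟩
    simp only [setV_vars] at ha
    rw [if_neg (by decide), h61] at ha
    have r' := r0.frame (by decide) (by decide) hf
    have hmem : ls[a] ∈ level D N d := List.getElem_mem ha
    have hspec := level_spec D N d ls[a] hmem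
    have htake : (ls.take (a + 1)).flatMap (children D N) =
        (ls.take a).flatMap (children D N) ++ children D N ls[a] := by
      rw [← List.take_append_getElem ha, List.flatMap_append]
      simp
    have hlen : ((ls.take a).flatMap (children D N)).length + (children D N ls[a]).length < B := by
      rw [← List.length_append, ← htake]
      refine lt_of_le_of_lt ?_ (hlenD (d + 1))
      rw [level]
      refine List.Sublist.length_le ?_
      exact (List.take_sublist _ _).flatMap _
    have := run_expandCmd U r' hN h0 (a := a) (g := ls[a])
      (ls := (ls.take a).flatMap (children D N)) (by rw [hspec.1]; omega)
      (by rw [hf.vars 60 (by decide) (by decide), hspec.1]; simpa using h60) hI1 h63 ?_ hspec.2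
      (by rw [hspec.1]; exact hI2) hlen
    · rw [hspec.1, ← htake] at this
      exact this
    · intro e he
      rw [hspec.1] at he
      rw [hf.arr 7 (by decide) (by decide), setV_rd, hls a ha e he, List.getD_eq_getElem _ _ ha]

theorem run_rootsCmd {n B D Dm p : ℕ} {N : ℕ → ℕ → ZMod q} {s : MState}
    (h : RootState q n B D Dm p N s) (hN : ∀ j i, N j i ≠ 0 → j < D ∧ i < D)
    (h0 : ∃ j i, N j i ≠ 0) :
    (run U rootsCmd s).out = s.out ++ (level D N n).flatten := by
  have hB : 1 < B := (Fact.out : q.Prime).one_lt.trans h.ltq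
  have r0 : RootState q n B D Dm p N (setV s 61 1) := h.setV (by decide)
  set s1 := run U (rep 60 0 levelCmd) (setV s 61 1) with hs1
  have hrun : run U rootsCmd s = run U outputCmd s1 := by
    simp only [rootsCmd, run, eval_const, h.five, Nat.mod_eq_of_lt hB]
    rfl
  have key := run_rep_frame U (fun d s' => s'.vars 61 = (level D N d).length ∧
      Nodes 7 d (level D N d) s') (x := 60) (y := 0) (c := levelCmd)
    (by decide) (by decide) (s := setV s 61 1) (by simp [Nodes, level]) ?_
  · rw [r0.zero] at key
    have r1 : RootState q n B D Dm p N s1 := r0.run U _ (by decide)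
    have e1 : s1.out = s.out := by rw [hs1, run_out U _ (by decide)]; rfl
    rw [hrun, run_outputCmd U r1.zero key.1 key.2 fun g hg => (level_spec D N n g hg).1, e1]
  · rintro d hd s' hf h60 ⟨hI1, hI2⟩
    rw [r0.zero] at hd
    have r' := r0.frame (by decide) (by decide) hf
    have := run_levelCmd U r' hN h0 hd h60 hI1 hI2
    refine ⟨?_, ?_⟩
    · simpa using this.1
    · exact this.2

end ListDecoder

namespace ListDecoder

open Polynomial Cmd

/-! ### Correctness of the decoding program -/

variable {q l m : ℕ} [Fact q.Prime] (U : Matrix (Block q l m) (Block q l m) ℂ)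

/-- The number of agreements of a message with the multiplicities `μ`. -/
noncomputable def agreement (q n : ℕ) [Fact q.Prime] (μ : ℕ → ℕ → ℕ) (x : Fin n → ZMod q) : ℕ :=
  ∑ r : ZMod q, μ r.val (GRS q n x r).val

/-- The message with the given symbols. -/
def toMessage (q n : ℕ) (g : List ℕ) (i : Fin n) : ZMod q := (g.getD i 0 : ZMod q)

/-- The symbols of a message. -/
def symbols {q n : ℕ} (x : Fin n → ZMod q) : List ℕ := List.ofFn fun i => (x i).val

theorem symbols_toMessage {n : ℕ} {g : List ℕ} (hl : g.length = n) (hg : ∀ b ∈ g, b < q) :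
    symbols (toMessage q n g) = g := by
  have : NeZero q := ⟨(Fact.out : q.Prime).ne_zero⟩
  subst hl
  refine List.ext_getElem (by simp [symbols]) fun i h1 h2 => ?_
  simp only [symbols, toMessage, List.getElem_ofFn]
  rw [List.getD_eq_getElem _ _ h2, ZMod.val_cast_of_lt (hg _ (List.getElem_mem h2))]

theorem toMessage_symbols {n : ℕ} (x : Fin n → ZMod q) : toMessage q n (symbols x) = x := by
  have : NeZero q := ⟨(Fact.out : q.Prime).ne_zero⟩
  ext i
  simp [toMessage, symbols]

/-- Agreement at least `D` makes the message polynomial a root of `N`, and every root of degree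
below `n` is a node at depth `n`. The converse is not needed: the list may contain other messages.
-/
theorem mem_level_of_agreement {n D : ℕ} (hn : 0 < n) {N : ℕ → ℕ → ZMod q} {μ : ℕ → ℕ → ℕ}
    (h0 : ∃ j i, N j i ≠ 0) (hND : ∀ j i, N j i ≠ 0 → j < D ∧ i < D)
    (hN : ∀ j i, N j i ≠ 0 → i + (n - 1) * j < D)
    (hc : ∀ r < q, ∀ z < q, ∀ u w, u + w < μ r z →
      ∑ j ∈ Finset.range D, ∑ i ∈ Finset.range D, N j i *
        shiftCoeff (r : ZMod q) u i * shiftCoeff (z : ZMod q) w j = 0)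
    {x : Fin n → ZMod q} (hx : D ≤ agreement q n μ x) : symbols x ∈ level D N n := by
  have : NeZero q := ⟨(Fact.out : q.Prime).ne_zero⟩
  set f : (ZMod q)[X] := ∑ i : Fin n, C (x i) * X ^ (i : ℕ) with hf
  have hdeg : f.natDegree ≤ n - 1 := by
    refine natDegree_sum_le_of_forall_le _ _ fun i _ => ?_
    refine (natDegree_C_mul_X_pow_le _ _).trans ?_
    have := i.2
    omega
  have hev : ∀ a, f.eval a = GRS q n x a := by
    intro a
    simp [hf, GRS, eval_finsetSum]
  have h1 : subst D D N f = 0 := by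
    refine subst_eq_zero hdeg hN (fun a b => μ a.val b.val) ?_ ?_
    · intro a b u w huw
      have := hc a.val (ZMod.val_lt a) b.val (ZMod.val_lt b) u w huw
      simpa using this
    · simpa only [hev, agreement] using hx
  have h2 := mem_level_of_subst_eq_zero hND h0 (List.ofFn x) 0 [] (by simp [level])
    (by simpa [node, ofCoeffs_ofFn] using h1)
  simpa [symbols, List.map_ofFn, Function.comp_def] using h2

theorem run_decodeDegree {n B D Dm : ℕ} (hn : 2 ≤ n) {μ : ℕ → ℕ → ℕ} {s : MState}
    (e0 : s.vars 0 = n) (e1 : s.vars 1 = q) (e5 : s.vars 5 = B) (e6 : s.vars 6 = n - 1)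
    (e12 : s.vars 12 = D) (hDm : D ≤ Dm) (hB1 : Dm * Dm < B) (hB2 : Dm * (n + 1) < B) (hqB : q < B)
    (hμ : ∀ r < q, ∀ z < q, μ r z ≤ Dm) (ht : Table q Dm s) (hm : ∀ r z, rd s 0 r z 0 0 = μ r z) :
    ∃ ys : List (Fin n → ZMod q), (run U decodeDegree s).out = s.out ++ ys.flatMap symbols ∧
      ∀ x : Fin n → ZMod q, D ≤ agreement q n μ x →
        (n - 1) * ∑ r ∈ Finset.range q, ∑ z ∈ Finset.range q, μ r z * (μ r z + 1) < D * (D + 1) →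
        x ∈ ys := by
  have hDD : D * D < B := (Nat.mul_le_mul hDm hDm).trans_lt hB1
  have hDn : D * (n + 1) < B := (Nat.mul_le_mul_right _ hDm).trans_lt hB2
  have hDmB : Dm < B := by nlinarith
  set s1 := setV (setV s 11 (D * D)) 13 (D * (n + 1)) with hs1
  set s2 := run U interpolateCmd s1 with hs2
  have hrun : run U decodeDegree s =
      if s2.vars 33 ≠ 0 then run U rootsCmd s2 else run U nop s2 := by
    have : run U (set 11 5 (.mul (.var 12) (.var 12)) ;;
        set 13 5 (.mul (.var 12) (.add (.var 0) (.const 1)))) s = s1 := by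
      simp only [run_seq, run_set, eval_mul', eval_var, eval_add', eval_const, setV_vars]
      simp [e12, e5, e0, Nat.mod_eq_of_lt hDD, Nat.mod_eq_of_lt hDn, hs1]
    rw [hs2, ← this]
    rfl
  have hv1 : ∀ x, x ≠ 11 → x ≠ 13 → s1.vars x = s.vars x := by
    intro x h h'
    simp [hs1, h, h']
  have key := run_interpolateCmd U (s := s1) (B := B) (D := D) (Dm := Dm) (k := n - 1) (μ := μ)
    (by omega) (by rw [hv1 1 (by decide) (by decide), e1])
    (by rw [hv1 5 (by decide) (by decide), e5]) (by simp [hs1])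
    (by rw [hv1 12 (by decide) (by decide), e12]) (by rw [hv1 6 (by decide) (by decide), e6])
    hDD hDm hDmB hμ ht hm
  have hout2 : s2.out = s.out := by
    rw [hs2, run_out U _ (by decide)]
    rfl
  rw [hrun]
  rcases key with ⟨h33, hle⟩ | ⟨p, h33, hne, hsupp, heqs⟩
  · rw [if_neg (by simpa using h33)]
    refine ⟨[], by simpa [nop, run] using hout2, fun x _ hlt => ?_⟩
    exact absurd hle (not_le.2 hlt)
  · rw [if_pos (by rw [h33]; omega)]
    set N := rowPoly q D p s2 with hN
    have hND : ∀ j i, N j i ≠ 0 → j < D ∧ i < D := by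
      intro j i h
      by_contra hcon
      exact h (if_neg hcon)
    have hv2 : ∀ x, interpolateCmd.wv x = false → s2.vars x = s1.vars x := fun x h =>
      run_vars U _ h s1
    have hr : RootState q n B D Dm p N s2 := by
      refine ⟨?_, ?_, ?_, ?_, ?_, h33, hDm, hDn, hqB, ?_, rfl⟩
      · rw [hv2 0 (by decide), hv1 0 (by decide) (by decide), e0]
      · rw [hv2 1 (by decide), hv1 1 (by decide) (by decide), e1]
      · rw [hv2 5 (by decide), hv1 5 (by decide) (by decide), e5]
      · rw [hv2 12 (by decide), hv1 12 (by decide) (by decide), e12]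
      · rw [hv2 13 (by decide)]
        simp [hs1]
      · unfold Table at ht ⊢
        rw [hs2, run_rd U _ (by decide) (by decide) (by decide)]
        exact ht
    refine ⟨(level D N n).map (toMessage q n), ?_, fun x hx _ => ?_⟩
    · rw [run_rootsCmd U hr hND hne, hout2, List.flatMap_map]
      congr 1
      have : ∀ ls : List (List ℕ), (∀ g ∈ ls, g ∈ level D N n) →
          ls.flatten = ls.flatMap fun g => symbols (toMessage q n g) := by
        intro ls
        induction ls with
        | nil => simp
        | cons g ls ih =>
          intro h
          have hg := level_spec D N n g (h g List.mem_cons_self)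
          simp only [List.flatten_cons, List.flatMap_cons]
          rw [ih fun g' hg' => h g' (List.mem_cons_of_mem _ hg'), symbols_toMessage hg.1 hg.2]
      exact this _ fun _ h => h
    · rw [List.mem_map]
      exact ⟨symbols x, mem_level_of_agreement (by omega) hne hND hsupp heqs hx,
        toMessage_symbols x⟩

/-- The agreement of a message is not known to the program, so all degree bounds are tried and their
lists concatenated. A message enters the list in the round in which `D` equals its agreement. -/
theorem run_decodeCmd {n B Dm : ℕ} (hn : 2 ≤ n) {μ : ℕ → ℕ → ℕ} {s : MState}
    (e0 : s.vars 0 = n) (e1 : s.vars 1 = q) (e5 : s.vars 5 = B) (e6 : s.vars 6 = n - 1)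
    (e10 : s.vars 10 = Dm) (hB1 : Dm * Dm < B) (hB2 : Dm * (n + 1) < B) (hqB : q < B)
    (hμ : ∀ r < q, ∀ z < q, μ r z ≤ Dm) (hm : ∀ r z, rd s 0 r z 0 0 = μ r z) (hout : s.out = []) :
    ∃ xs : List (Fin n → ZMod q), (run U decodeCmd s).out = xs.flatMap symbols ∧
      ∀ x : Fin n → ZMod q, agreement q n μ x < Dm →
        (n - 1) * ∑ r ∈ Finset.range q, ∑ z ∈ Finset.range q, μ r z * (μ r z + 1) <
          agreement q n μ x * (agreement q n μ x + 1) →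
        x ∈ xs := by
  set s1 := run U tableCmd s with hs1
  have ht : Table q Dm s1 := e10 ▸ run_tableCmd U e1
  have hv1 : ∀ x, tableCmd.wv x = false → s1.vars x = s.vars x := fun x h => run_vars U _ h s
  have key := run_rep_frame U (fun D s' => ∃ xs : List (Fin n → ZMod q),
      s'.out = xs.flatMap symbols ∧ ∀ x : Fin n → ZMod q, agreement q n μ x < D →
        (n - 1) * ∑ r ∈ Finset.range q, ∑ z ∈ Finset.range q, μ r z * (μ r z + 1) <
          agreement q n μ x * (agreement q n μ x + 1) → x ∈ xs) (x := 12) (y := 10)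
      (c := decodeDegree) (by decide) (by decide) (s := s1) ?_ ?_
  · rw [hv1 10 (by decide), e10] at key
    exact key
  · refine ⟨[], ?_, by simp⟩
    rw [setV_out, hs1, run_out U _ (by decide), hout]
    rfl
  · rintro D hD s' hf h12 ⟨xs, hxs, hmem⟩
    rw [hv1 10 (by decide), e10] at hD
    have hv : ∀ x, x ≠ 12 → decodeDegree.wv x = false → tableCmd.wv x = false →
        s'.vars x = s.vars x := fun x h1 h2 h3 => (hf.vars x h1 h2).trans (hv1 x h3)
    obtain ⟨ys, hys, hmem'⟩ := run_decodeDegree U hn (μ := μ) (s := s') (Dm := Dm) (B := B)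
      (by rw [hv 0 (by decide) (by decide) (by decide), e0])
      (by rw [hv 1 (by decide) (by decide) (by decide), e1])
      (by rw [hv 5 (by decide) (by decide) (by decide), e5])
      (by rw [hv 6 (by decide) (by decide) (by decide), e6]) h12 hD.le hB1 hB2 hqB hμ
      (by
        unfold Table at ht ⊢
        rw [hf.arr 1 (by decide) (by decide)]
        exact ht)
      (by
        rw [hf.arr 0 (by decide) (by decide), hs1, run_rd U _ (by decide) (by decide) (by decide)]
        exact hm)
    refine ⟨xs ++ ys, by rw [setV_out, hys, hxs, List.flatMap_append], fun x hx hlt => ?_⟩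
    rw [List.mem_append]
    rcases Nat.lt_succ_iff_lt_or_eq.1 hx with h | h
    · exact Or.inl (hmem x h hlt)
    · exact Or.inr (hmem' x h.ge (h ▸ hlt))

end ListDecoder

namespace ListDecoder

/-! ## Weighted sums over quantum states -/

/-- The sum of `H` over the basis states, weighted with the squared amplitudes. -/
noncomputable def wsum (ψ : QState) (H : QBasis → ℝ) : ℝ := ψ.sum fun b a => ‖a‖ ^ 2 * H b

theorem wsum_one (ψ : QState) : wsum ψ (fun _ => 1) = ψ.normSq := by
  simp [wsum, QState.normSq]

theorem wsum_congr {ψ : QState} {H H' : QBasis → ℝ} (h : ∀ b ∈ ψ.support, H b = H' b) :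
    wsum ψ H = wsum ψ H' :=
  Finset.sum_congr rfl fun b hb => by simp only [h b hb]

theorem wsum_const (ψ : QState) (a : ℝ) : wsum ψ (fun _ => a) = ψ.normSq * a := by
  simp [wsum, QState.normSq, Finsupp.sum, Finset.sum_mul]

theorem normSq_nonneg (ψ : QState) : 0 ≤ ψ.normSq :=
  Finset.sum_nonneg fun _ _ => by positivity

/-- The two measurement results partition the support. As states are not renormalised, expectations
are just sums over the outcomes. -/
theorem wsum_project (ψ : QState) (a : Qubit) (H : QBasis → ℝ) :
    wsum (ψ.project a false) H + wsum (ψ.project a true) H = wsum ψ H := by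
  classical
  have h : ∀ v, wsum (ψ.project a v) H =
      ∑ b ∈ ψ.support.filter (fun b => b a = v), ‖ψ b‖ ^ 2 * H b := by
    intro v
    unfold wsum QState.project
    rw [Finsupp.sum, Finsupp.support_filter]
    refine Finset.sum_congr rfl fun b hb => ?_
    rw [Finsupp.filter_apply_pos (fun b : QBasis => b a = v) _ (Finset.mem_filter.1 hb).2]
  rw [h, h, add_comm, wsum, Finsupp.sum,
    ← Finset.sum_filter_add_sum_filter_not ψ.support (fun b => b a = true)]
  simp only [Bool.not_eq_true]

theorem mem_support_project {ψ : QState} {a : Qubit} {v : Bool} {b : QBasis}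
    (h : b ∈ (ψ.project a v).support) : b ∈ ψ.support ∧ b a = v := by
  classical
  unfold QState.project at h
  rw [Finsupp.support_filter, Finset.mem_filter] at h
  exact h

/-- The weighted sum over a superposition of distinct basis states. -/
theorem wsum_sum_single {ι : Type*} (S : Finset ι) (e : ι → QBasis) (he : Set.InjOn e S)
    (a : ι → ℂ) (H : QBasis → ℝ) :
    wsum (∑ i ∈ S, Finsupp.single (e i) (a i)) H = ∑ i ∈ S, ‖a i‖ ^ 2 * H (e i) := by
  classical
  set ψ : QState := ∑ i ∈ S, Finsupp.single (e i) (a i) with hψ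
  have hval : ∀ i ∈ S, ψ (e i) = a i := by
    intro i hi
    rw [hψ, Finsupp.finsetSum_apply, Finset.sum_eq_single i]
    · simp
    · intro j hj hji
      rw [Finsupp.single_apply, if_neg]
      exact fun h => hji (he hj hi h)
    · exact fun h => absurd hi h
  have hsub : ψ.support ⊆ S.image e := by
    intro b hb
    by_contra hcon
    rw [Finsupp.mem_support_iff, hψ, Finsupp.finsetSum_apply] at hb
    refine hb (Finset.sum_eq_zero fun i hi => ?_)
    rw [Finsupp.single_apply, if_neg]
    rintro rfl
    exact hcon (Finset.mem_image_of_mem e hi)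
  rw [wsum, Finsupp.sum_of_support_subset _ hsub _ (by simp), Finset.sum_image he]
  exact Finset.sum_congr rfl fun i hi => by rw [hval i hi]

theorem mem_support_sum_single {ι : Type*} {S : Finset ι} {e : ι → QBasis} {a : ι → ℂ} {b : QBasis}
    (h : b ∈ (∑ i ∈ S, Finsupp.single (e i) (a i) : QState).support) :
    ∃ i ∈ S, a i ≠ 0 ∧ b = e i := by
  classical
  rw [Finsupp.mem_support_iff, Finsupp.finsetSum_apply] at h
  obtain ⟨i, hi, h⟩ := Finset.exists_ne_zero_of_sum_ne_zero h
  rw [Finsupp.single_apply] at h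
  split_ifs at h with hb
  · exact ⟨i, hi, h, hb.symm⟩
  · exact absurd rfl h

/-- Inversion of a bit. -/
def flipBit (a : Qubit) (b : QBasis) : QBasis := Function.update b a (!b a)

theorem flipBit_flipBit (a : Qubit) (b : QBasis) : flipBit a (flipBit a b) = b := by
  simp [flipBit]

theorem gate_X (a : Qubit) (ψ : QState) :
    ψ.gate .X a = ∑ b ∈ ψ.support, Finsupp.single (flipBit a b) (ψ b) := by
  refine Finset.sum_congr rfl fun b _ => ?_
  cases h : b a <;> simp [Gate.mat, flipBit, h]

theorem normSq_gate_X (a : Qubit) (ψ : QState) : (ψ.gate .X a).normSq = ψ.normSq := by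
  rw [← wsum_one, ← wsum_one, gate_X, wsum_sum_single]
  · rfl
  · exact fun x _ y _ h => by rw [← flipBit_flipBit a x, h, flipBit_flipBit]

theorem mem_support_gate_X {a : Qubit} {ψ : QState} {b : QBasis}
    (h : b ∈ (ψ.gate .X a).support) : ∃ b' ∈ ψ.support, b = flipBit a b' := by
  rw [gate_X] at h
  obtain ⟨i, hi, -, hb⟩ := mem_support_sum_single h
  exact ⟨i, hi, hb⟩

/-! ### Answer bits and their probabilities -/

/-- The number with the first `c` bits `f`. -/
def bitsVal (f : ℕ → Bool) (c : ℕ) : ℕ := ∑ i ∈ Finset.range c, (f i).toNat * 2 ^ i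

theorem bitsVal_testBit (a c : ℕ) : bitsVal a.testBit c = a % 2 ^ c := by
  induction c with
  | zero => simp [bitsVal, Nat.mod_one]
  | succ c ih =>
    unfold bitsVal at ih ⊢
    rw [Finset.sum_range_succ, ih, Nat.mod_pow_succ, Nat.toNat_testBit, mul_comm]

/-- The bits of `z`, followed by zeros. -/
def extend {l : ℕ} (z : Bits l) (i : ℕ) : Bool := if h : i < l then z ⟨i, h⟩ else false

theorem extend_toBits {l a : ℕ} (h : a < 2 ^ l) : extend (toBits l a) = a.testBit := by
  ext i
  unfold extend toBits
  split_ifs with hi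
  · rfl
  · exact (Nat.testBit_lt_two_pow (h.trans_le (Nat.pow_le_pow_right (by omega) (by omega)))).symm

variable {q l m : ℕ}

/-- The probability that the first `⌈log₂ q⌉` bits of the answer to the query `r` represent `y`. -/
noncomputable def answerProb (O : CorruptedCodeword q l m) (r : ZMod q) (y : ℕ) : ℝ :=
  ∑ z, if bitsVal (extend z) (Nat.clog 2 q) = y then ‖O.α r z‖ ^ 2 else 0

theorem bxor_false {k : ℕ} (z : Bits k) : bxor (fun _ => false) z = z := by
  ext i
  simp [bxor]

theorem oracle_apply (O : CorruptedCodeword q l m) (r : ZMod q) (v : Block q l m) :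
    (O.U : Matrix (Block q l m) (Block q l m) ℂ) v
        (toBits _ r.val, fun _ => false, fun _ => false) =
      if v.1 = toBits _ r.val then O.α r v.2.1 * O.φ r v.2.1 v.2.2 else 0 := by
  have h := congrFun (O.apply_ket r (fun _ => false) (fun _ => false)) v
  simp only [ket, Matrix.mulVec_single_one, Matrix.col_apply, bxor_false] at h
  rw [h]
  obtain ⟨x, z, w⟩ := v
  simp only [Finset.sum_apply, Pi.smul_apply, Pi.single_apply, Prod.mk.injEq, smul_eq_mul]
  by_cases hx : x = toBits _ r.val
  · simp only [hx, true_and, if_true]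
    rw [Finset.sum_eq_single z, Finset.sum_eq_single w]
    · simp
    · intro w' _ hw
      simp [Ne.symm hw]
    · simp
    · intro z' _ hz
      simp [Ne.symm hz]
    · simp
  · simp [hx]

theorem sum_oracle (O : CorruptedCodeword q l m) (r : ZMod q) (G : Bits l → ℝ) :
    ∑ v : Block q l m, ‖(O.U : Matrix (Block q l m) (Block q l m) ℂ) v
        (toBits _ r.val, fun _ => false, fun _ => false)‖ ^ 2 * G v.2.1 =
      ∑ z, ‖O.α r z‖ ^ 2 * G z := by
  simp only [oracle_apply]
  rw [Fintype.sum_prod_type, Finset.sum_eq_single (toBits _ r.val)]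
  · simp only [if_true]
    rw [Fintype.sum_prod_type]
    refine Finset.sum_congr rfl fun z _ => ?_
    simp only [norm_mul, mul_pow]
    rw [← Finset.sum_mul, ← Finset.mul_sum, O.φ_unit, mul_one]
  · intro x _ hx
    simp [hx]
  · simp

/-- The column of the unitary matrix at the basis state with index `r` and zeros has norm 1, and the
unit vectors `φ` sum out. -/
theorem sum_normSq_alpha (O : CorruptedCodeword q l m) (r : ZMod q) :
    ∑ z, ‖O.α r z‖ ^ 2 = 1 := by
  have h := sum_oracle O r (fun _ => 1)
  simp only [mul_one] at h
  rw [← h]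
  set u : Block q l m := (toBits _ r.val, fun _ => false, fun _ => false)
  have hU := congrFun (congrFun (Matrix.UnitaryGroup.star_mul_self O.U) u) u
  rw [Matrix.mul_apply, Matrix.one_apply_eq] at hU
  have h2 : ((∑ v, ‖(O.U : Matrix (Block q l m) (Block q l m) ℂ) v u‖ ^ 2 : ℝ) : ℂ) = 1 := by
    rw [← hU]
    push_cast
    refine Finset.sum_congr rfl fun v _ => ?_
    exact (RCLike.conj_mul ((O.U : Matrix (Block q l m) (Block q l m) ℂ) v u)).symm
  exact_mod_cast h2

theorem sum_answerProb_le (O : CorruptedCodeword q l m) (r : ZMod q) (S : Finset ℕ) :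
    ∑ y ∈ S, answerProb O r y ≤ 1 := by
  unfold answerProb
  rw [Finset.sum_comm, ← sum_normSq_alpha O r]
  refine Finset.sum_le_sum fun z _ => ?_
  rw [Finset.sum_ite_eq]
  split_ifs
  · exact le_rfl
  · positivity

/-- The string that represents `a` is one of those with the right low bits. Strings that differ from
it in higher bits only add to the probability, so spurious answers do no harm. -/
theorem le_answerProb [NeZero q] (hl : q ≤ 2 ^ l) (O : CorruptedCodeword q l m) (r a : ZMod q) :
    ‖O.α r (toBits l a.val)‖ ^ 2 ≤ answerProb O r a.val := by
  have ha := ZMod.val_lt a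
  have h : bitsVal (extend (toBits l a.val)) (Nat.clog 2 q) = a.val := by
    rw [extend_toBits (ha.trans_le hl), bitsVal_testBit, Nat.mod_eq_of_lt]
    exact ha.trans_le (Nat.le_pow_clog (by decide) q)
  unfold answerProb
  refine le_trans ?_ (Finset.single_le_sum (fun z _ => ?_) (Finset.mem_univ (toBits l a.val)))
  · rw [if_pos h]
  · split_ifs <;> positivity

/-! ### Queries to fresh blocks -/

/-- All qubits of the blocks from `g` on are `|0⟩`. -/
def Clean (g : ℕ) (ψ : QState) : Prop :=
  ∀ b ∈ ψ.support, ∀ R j i, g ≤ j → b (R, j, i) = false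

/-- The registers of block `g` contain the query `r`, and all the qubits of later blocks
are `|0⟩`. -/
def Prepared (g r c : ℕ) (ψ : QState) : Prop :=
  ∀ b ∈ ψ.support, ∀ R j i, g ≤ j →
    b (R, j, i) = (decide (R = .index ∧ j = g ∧ i < c) && r.testBit i)

theorem Prepared.read {g : ℕ} {r : ZMod q} {ψ : QState}
    (h : Prepared g r.val (Nat.clog 2 q) ψ) {b : QBasis} (hb : b ∈ ψ.support) :
    (b.read g : Block q l m) = (toBits _ r.val, fun _ => false, fun _ => false) := by
  unfold QBasis.read
  refine Prod.ext ?_ (Prod.ext ?_ ?_)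
  · ext i
    simp [h b hb, toBits]
  · ext i
    simp [h b hb]
  · ext i
    simp [h b hb]

theorem query_eq {g : ℕ} {r : ZMod q} {ψ : QState} (h : Prepared g r.val (Nat.clog 2 q) ψ)
    (U : Matrix (Block q l m) (Block q l m) ℂ) :
    ψ.query U g = ∑ i ∈ ψ.support ×ˢ (Finset.univ : Finset (Block q l m)),
      Finsupp.single (i.1.write g i.2)
        (U i.2 (toBits _ r.val, fun _ => false, fun _ => false) * ψ i.1) := by
  rw [Finset.sum_product]
  refine Finset.sum_congr rfl fun b hb => ?_
  simp only [h.read hb]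

theorem write_answer {g : ℕ} {r : ZMod q} {ψ : QState}
    (h : Prepared g r.val (Nat.clog 2 q) ψ) {b : QBasis} (hb : b ∈ ψ.support) (v : Block q l m) :
    (fun i => b.write g v (.answer, g, i)) = extend v.2.1 := by
  ext i
  simp only [QBasis.write, extend, true_and]
  split_ifs
  · rfl
  · simp [h b hb]

theorem write_read {b : QBasis} {g : ℕ} (v : Block q l m) : (b.write g v).read g = v := by
  obtain ⟨x, z, w⟩ := v
  simp [QBasis.write, QBasis.read]

/-- Before the query block `g` has the same contents in every branch, so the pair of branch and
oracle output can be recovered from the result. Different branches therefore do not interfere, and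
squared amplitudes simply multiply. -/
theorem write_injOn {g : ℕ} {r : ZMod q} {ψ : QState}
    (h : Prepared g r.val (Nat.clog 2 q) ψ) :
    Set.InjOn (fun i : QBasis × Block q l m => i.1.write g i.2)
      (ψ.support ×ˢ (Finset.univ : Finset (Block q l m)) : Finset _) := by
  rintro ⟨b, v⟩ hb ⟨b', v'⟩ hb' heq
  simp only [Finset.coe_product, Finset.coe_univ, Set.mem_prod, Set.mem_univ, and_true,
    Finset.mem_coe] at hb hb'
  dsimp only at heq
  have hv : v = v' := by rw [← write_read (b := b) (g := g) v, heq, write_read]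
  subst hv
  refine Prod.ext ?_ rfl
  ext ⟨R, j, i⟩
  by_cases hj : j = g
  · exact (h b hb R j i hj.ge).trans (h b' hb' R j i hj.ge).symm
  · have := congrFun heq (R, j, i)
    cases R <;> simpa [QBasis.write, hj] using this

/-- The answer is distributed according to `|α_{r,z}|²`, independently of the state of the earlier
blocks. -/
theorem wsum_query {g : ℕ} {r : ZMod q} {ψ : QState} (O : CorruptedCodeword q l m)
    (h : Prepared g r.val (Nat.clog 2 q) ψ) (G : ℕ → ℝ) :
    wsum (ψ.query (O.U : Matrix (Block q l m) (Block q l m) ℂ) g)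
        (fun b => G (bitsVal (fun i => b (.answer, g, i)) (Nat.clog 2 q))) =
      ψ.normSq * ∑ z, ‖O.α r z‖ ^ 2 * G (bitsVal (extend z) (Nat.clog 2 q)) := by
  rw [query_eq h, wsum_sum_single _ _ (write_injOn h), Finset.sum_product,
    ← sum_oracle O r (fun z => G (bitsVal (extend z) (Nat.clog 2 q))), QState.normSq, Finsupp.sum,
    Finset.sum_mul_sum]
  refine Finset.sum_congr rfl fun b hb => Finset.sum_congr rfl fun v _ => ?_
  simp only
  rw [write_answer h hb, norm_mul, mul_pow]
  ring

theorem clean_query {g : ℕ} {r : ZMod q} {ψ : QState}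
    (h : Prepared g r.val (Nat.clog 2 q) ψ) (U : Matrix (Block q l m) (Block q l m) ℂ) :
    Clean (g + 1) (ψ.query U g) := by
  intro b hb R j i hj
  rw [query_eq h] at hb
  obtain ⟨⟨b', v⟩, hi, -, rfl⟩ := mem_support_sum_single hb
  have hb' := (Finset.mem_product.1 hi).1
  have hj' : j ≠ g := by omega
  have := h b' hb' R j i (by omega)
  simp only [hj', false_and, and_false, decide_false, Bool.false_and] at this
  cases R <;> simpa [QBasis.write, hj'] using this

end ListDecoder

namespace ListDecoder

open Cmd

/-! ## The sampling program -/

/-- Write the index `v₇₀ mod q` into the registers of block `v₇₀`. -/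
def prepareCmd : Cmd :=
  set 71 5 (.mod (.var 70) (.var 1)) ;; set 72 5 (.var 71) ;;
  rep 73 9 (ite (.mod (.var 72) (.const 2)) (flip ⟨.index, .var 70, .var 73⟩) nop ;;
    set 72 5 (.div (.var 72) (.const 2)))

/-- Query block `v₇₀`. -/
def askCmd : Cmd := prepareCmd ;; query (.var 70) ;; set 74 5 (.const 0) ;; set 75 5 (.const 1)

/-- Measure one bit of the answer. -/
def measureBit : Cmd :=
  meas 72 ⟨.answer, .var 70, .var 73⟩ ;;
  (set 74 5 (.add (.var 74) (.mul (.var 72) (.var 75))) ;;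
  set 75 5 (.mul (.const 2) (.var 75)))

/-- Count the answer. -/
def countCmd : Cmd :=
  put 0 5 (.var 71) (.var 74) (.const 0) (.const 0)
    (.add (ld 0 (.var 71) (.var 74) (.const 0) (.const 0)) (.const 1))

/-- Take one sample. -/
def sampleCmd : Cmd := askCmd ;; rep 73 9 measureBit ;; countCmd

variable {q l m : ℕ}

theorem Prepared.flip {g r i : ℕ} {ψ : QState} (h : Prepared g r i ψ) (hr : r.testBit i = true) :
    Prepared g r (i + 1) (ψ.gate .X (.index, g, i)) := by
  intro b hb R j i' hj
  obtain ⟨b', hb', rfl⟩ := mem_support_gate_X hb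
  unfold flipBit
  rw [Function.update_apply, h b' hb' _ _ _ le_rfl]
  split_ifs with heq
  · simp only [Prod.mk.injEq] at heq
    obtain ⟨rfl, rfl, rfl⟩ := heq
    simp [hr]
  · rw [h b' hb' _ _ _ hj]
    congr 1
    simp only [Prod.mk.injEq, not_and] at heq
    have : (R = .index ∧ j = g ∧ i' < i) ↔ (R = .index ∧ j = g ∧ i' < i + 1) := by
      constructor
      · rintro ⟨h1, h2, h3⟩; exact ⟨h1, h2, by omega⟩
      · rintro ⟨h1, h2, h3⟩
        exact ⟨h1, h2, by have := heq h1 h2; omega⟩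
    simp only [this]

theorem Prepared.skip {g r i : ℕ} {ψ : QState} (h : Prepared g r i ψ)
    (hr : r.testBit i = false) : Prepared g r (i + 1) ψ := by
  intro b hb R j i' hj
  rw [h b hb _ _ _ hj]
  by_cases hi : i' = i
  · subst hi
    simp [hr]
  · have : i' < i ↔ i' < i + 1 := by omega
    simp only [this]

/-- The bits of the index are peeled off by halving, and a not gate is applied for each 1. The index
is classical; no superposition is ever prepared. -/
theorem run_prepareCmd (U : Matrix (Block q l m) (Block q l m) ℂ) {s : MState} {B c g : ℕ}
    (h1 : s.vars 1 = q) (h5 : s.vars 5 = B) (h9 : s.vars 9 = c) (h70 : s.vars 70 = g)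
    (hqB : q < B) (hq : 0 < q) (hc : Clean g s.psi) :
    (run U prepareCmd s).psi.normSq = s.psi.normSq ∧
      Prepared g (g % q) c (run U prepareCmd s).psi ∧
      (run U prepareCmd s).vars 71 = g % q := by
  have hr : g % q < B := (Nat.mod_lt _ hq).trans hqB
  set s1 := setV (setV s 71 (g % q)) 72 (g % q) with hs1
  have e1 : run U prepareCmd s = run U (rep 73 9 (ite (.mod (.var 72) (.const 2))
      (flip ⟨.index, .var 70, .var 73⟩) nop ;; set 72 5 (.div (.var 72) (.const 2)))) s1 := by
    simp only [prepareCmd, run_seq, run_set, eval_mod', eval_var, h70, h1, h5, setV_vars,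
      Nat.mod_eq_of_lt hr, if_true]
    simp [Nat.mod_eq_of_lt hr, hs1]
  have e9 : s1.vars 9 = c := by simp [hs1, h9]
  have key := run_rep_frame U (fun i s' => s'.psi.normSq = s.psi.normSq ∧
      Prepared g (g % q) i s'.psi ∧ s'.vars 72 = g % q / 2 ^ i) (x := 73) (y := 9)
      (c := ite (.mod (.var 72) (.const 2))
      (flip ⟨.index, .var 70, .var 73⟩) nop ;; set 72 5 (.div (.var 72) (.const 2)))
      (by decide) (by decide) (s := s1) ?_ ?_
  · rw [e9, ← e1] at key
    refine ⟨key.1, key.2.1, ?_⟩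
    rw [e1, run_vars U _ (by decide)]
    simp [hs1]
  · refine ⟨by simp [hs1], ?_, by simp [hs1]⟩
    intro b hb R j i hj
    simpa using hc b hb R j i hj
  · rintro i - s' hf h73 ⟨hn, hp, h72⟩
    have f70 : s'.vars 70 = g := by
      rw [hf.vars 70 (by decide) (by decide)]
      simp [hs1, h70]
    have f5 : s'.vars 5 = B := by
      rw [hf.vars 5 (by decide) (by decide)]
      simp [hs1, h5]
    have hdiv : g % q / 2 ^ i / 2 % B = g % q / 2 ^ (i + 1) := by
      rw [Nat.div_div_eq_div_mul, pow_succ, Nat.mod_eq_of_lt]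
      exact (Nat.div_le_self _ _).trans_lt hr
    have hbit : s'.vars 72 % 2 = ((g % q).testBit i).toNat := by
      rw [h72, Nat.toNat_testBit]
    rw [run_seq, run_set]
    simp only [run, eval_mod', eval_var, eval_const, hbit]
    cases hb : (g % q).testBit i
    · simp only [Bool.toNat_false, ne_eq, not_true_eq_false, if_false, nop, run, setV_psi]
      refine ⟨hn, hp.skip hb, ?_⟩
      simp [f5, h72, hdiv]
    · simp only [Bool.toNat_true, ne_eq, one_ne_zero, not_false_eq_true, if_true, setV_psi,
        QRef.eval, eval_var, f70, h73]
      refine ⟨(normSq_gate_X _ _).trans hn, hp.flip hb, ?_⟩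
      simp [f5, h72, hdiv]

/-! ### Sums over outcomes -/

theorem sum_map_flatMap {α β : Type*} (L : List α) (f : α → List β) (F : β → ℝ) :
    ((L.flatMap f).map F).sum = (L.map fun a => ((f a).map F).sum).sum := by
  induction L with
  | nil => simp
  | cons a L ih => simp [ih]

/-- A quantity whose total over the outcomes of one round does not decrease. -/
theorem outsIter_sum {G : MState → List MState} {x : ℕ} (I : ℕ → MState → Prop)
    (F : ℕ → MState → ℝ) {N : ℕ}
    (h : ∀ j < N, ∀ s, I j s → (∀ s' ∈ G s, I (j + 1) (inc x s')) ∧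
      F j s ≤ ((G s).map fun s' => F (j + 1) (inc x s')).sum)
    {s : MState} (hs : I 0 s) :
    (∀ s' ∈ outsIter G x N s, I N s') ∧ F 0 s ≤ ((outsIter G x N s).map (F N)).sum := by
  have key : ∀ k j, j + k = N → ∀ s, I j s →
      (∀ s' ∈ outsIter G x k s, I N s') ∧ F j s ≤ ((outsIter G x k s).map (F N)).sum := by
    intro k
    induction k with
    | zero =>
      rintro j rfl s hs
      simpa [outsIter] using hs
    | succ k ih =>
      intro j hj s hs
      obtain ⟨h1, h2⟩ := h j (by omega) s hs
      have h3 := fun s' hs' => ih (j + 1) (by omega) _ (h1 s' hs')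
      constructor
      · intro s' hs'
        simp only [outsIter, List.mem_flatMap] at hs'
        obtain ⟨a, ha, hs'⟩ := hs'
        exact (h3 a ha).1 _ hs'
      · rw [outsIter, sum_map_flatMap]
        exact h2.trans (List.sum_le_sum fun s' hs' => (h3 s' hs').2)
  exact key N 0 (by omega) s hs

/-- What the measurement of the answer does not change. -/
structure SameClassical (s s' : MState) : Prop where
  vars : ∀ x, x ≠ 72 → x ≠ 73 → x ≠ 74 → x ≠ 75 → s'.vars x = s.vars x
  mem : s'.mem = s.mem
  out : s'.out = s.out
  supp : s'.psi.support ⊆ s.psi.support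

/-- Each projection preserves the weighted sum over its two results. After the last bit the whole
support agrees with the number read, so the weight becomes a constant. -/
theorem outs_measure (U : Matrix (Block q l m) (Block q l m) ℂ) {s : MState} {B c g : ℕ}
    (h5 : s.vars 5 = B) (h9 : s.vars 9 = c) (h70 : s.vars 70 = g) (h74 : s.vars 74 = 0)
    (h75 : s.vars 75 = 1) (hB : 2 ^ c < B) (G : ℕ → ℝ) :
    (∀ s' ∈ outs U (rep 73 9 measureBit) s, SameClassical s s') ∧
    wsum s.psi (fun b => G (bitsVal (fun i => b (.answer, g, i)) c)) ≤
      ((outs U (rep 73 9 measureBit) s).map fun s' => s'.psi.normSq * G (s'.vars 74)).sum := by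
  have key := outsIter_sum (G := outs U measureBit) (x := 73) (N := c)
    (fun j s' => SameClassical s s' ∧ s'.vars 73 = j ∧ s'.vars 75 = 2 ^ j ∧ s'.vars 74 < 2 ^ j ∧
      ∀ b ∈ s'.psi.support, s'.vars 74 = bitsVal (fun i => b (.answer, g, i)) j)
    (fun j s' => wsum s'.psi (fun b => G (bitsVal (fun i => b (.answer, g, i)) c)))
    ?_ (s := setV s 73 0) ?_
  · rw [outs, h9]
    refine ⟨fun s' hs' => (key.1 s' hs').1, key.2.trans (List.sum_le_sum fun s' hs' => ?_)⟩
    rw [← wsum_const]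
    refine (wsum_congr fun b hb => ?_).le
    rw [(key.1 s' hs').2.2.2.2 b hb]
  · rintro j hj s' ⟨hs, h73', h75', h74', hbits⟩
    have f5 : s'.vars 5 = B := by
      rw [hs.vars 5 (by decide) (by decide) (by decide) (by decide), h5]
    have f70 : s'.vars 70 = g := by
      rw [hs.vars 70 (by decide) (by decide) (by decide) (by decide), h70]
    have hpow : 2 ^ (j + 1) < B := (Nat.pow_le_pow_right (by omega) hj).trans_lt hB
    have hpow' := hpow
    rw [pow_succ] at hpow'
    set T : Bool → MState := fun v => setV (setV (s'.measured 72
      ⟨.answer, .var 70, .var 73⟩ v) 74 (s'.vars 74 + v.toNat * 2 ^ j)) 75 (2 ^ (j + 1)) with hT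
    have hlt : ∀ v : Bool, s'.vars 74 + v.toNat * 2 ^ j < 2 ^ (j + 1) := by
      intro v
      have := Nat.mul_le_mul_right (2 ^ j) (Bool.toNat_le v)
      rw [pow_succ]
      omega
    have htail : ∀ v : Bool, outs U (set 74 5 (.add (.var 74) (.mul (.var 72) (.var 75))) ;;
        set 75 5 (.mul (.const 2) (.var 75))) (s'.measured 72 ⟨.answer, .var 70, .var 73⟩ v) =
        [T v] := by
      intro v
      rw [outs_eq_run U _ (by decide), run_seq, run_set, run_set]
      have h1 := Nat.mod_eq_of_lt ((hlt v).trans hpow)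
      have h2 := Nat.mod_eq_of_lt hpow
      rw [pow_succ'] at h2
      simp [hT, MState.measured, f5, h75', h1, h2, pow_succ']
    have houts : outs U measureBit s' = [T false, T true] := by
      rw [measureBit, outs, show ∀ x a s, outs U (meas x a) s =
        [s.measured x a false, s.measured x a true] from fun _ _ _ => rfl]
      simp only [List.flatMap_cons, htail, List.flatMap_nil, List.append_nil, List.cons_append,
        List.nil_append]
    have hpsi : ∀ v, (T v).psi = s'.psi.project (.answer, g, j) v := by
      intro v
      simp [hT, MState.measured, QRef.eval, f70, h73']
    rw [houts]
    constructor
    · have : ∀ v, SameClassical s (inc 73 (T v)) ∧ (inc 73 (T v)).vars 73 = j + 1 ∧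
          (inc 73 (T v)).vars 75 = 2 ^ (j + 1) ∧ (inc 73 (T v)).vars 74 < 2 ^ (j + 1) ∧
          ∀ b ∈ (inc 73 (T v)).psi.support,
            (inc 73 (T v)).vars 74 = bitsVal (fun i => b (.answer, g, i)) (j + 1) := by
        intro v
        refine ⟨⟨?_, ?_, ?_, ?_⟩, ?_, ?_, ?_, ?_⟩
        · intro x a1 a2 a3 a4
          simp [hT, MState.measured, a1, a2, a3, a4, hs.vars x a1 a2 a3 a4]
        · exact hs.mem
        · exact hs.out
        · intro b hb
          rw [inc_psi, hpsi] at hb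
          exact hs.supp (mem_support_project hb).1
        · simp [hT, MState.measured, h73']
        · simp [hT]
        · simpa [hT] using hlt v
        · intro b hb
          rw [inc_psi, hpsi] at hb
          obtain ⟨hb1, hb2⟩ := mem_support_project hb
          have := hbits b hb1
          simp only [bitsVal] at this ⊢
          simp [hT, this, Finset.sum_range_succ, hb2]
      intro s'' hs''
      simp only [List.mem_cons, List.not_mem_nil, or_false] at hs''
      rcases hs'' with rfl | rfl
      · exact this false
      · exact this true
    · simp only [List.map_cons, List.map_nil, List.sum_cons, List.sum_nil, inc_psi, hpsi, add_zero]
      exact (wsum_project _ _ _).ge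
  · refine ⟨⟨fun x _ h _ _ => by simp [h], rfl, rfl, subset_rfl⟩, by simp, by simp [h75],
      by simp [h74], ?_⟩
    simp [h74, bitsVal]

/-- The conditions on the state before a sample is taken. -/
structure Ready (q B g : ℕ) (s : MState) : Prop where
  modulus : s.vars 1 = q
  bound : s.vars 5 = B
  clog : s.vars 9 = Nat.clog 2 q
  round : s.vars 70 = g
  out : s.out = []
  clean : Clean g s.psi

theorem outs_sampleCmd [NeZero q] (O : CorruptedCodeword q l m) {s : MState} {B g : ℕ}
    (hs : Ready q B g s) (hqB : 2 * q < B) (hcnt : ∀ r z, rd s 0 r z 0 0 + 1 < B) (G : ℕ → ℝ) :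
    (∀ s' ∈ outs (O.U : Matrix (Block q l m) (Block q l m) ℂ) sampleCmd s,
      Ready q B (g + 1) (inc 70 s') ∧ ∀ r z, rd s' 0 r z 0 0 =
        rd s 0 r z 0 0 + if r = g % q ∧ z = s'.vars 74 then 1 else 0) ∧
    s.psi.normSq * ∑ z, ‖O.α g z‖ ^ 2 * G (bitsVal (extend z) (Nat.clog 2 q)) ≤
      ((outs (O.U : Matrix (Block q l m) (Block q l m) ℂ) sampleCmd s).map
        fun s' => s'.psi.normSq * G (s'.vars 74)).sum := by
  set U := (O.U : Matrix (Block q l m) (Block q l m) ℂ) with hU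
  have hq : 0 < q := NeZero.pos q
  obtain ⟨hn, hp, h71⟩ := run_prepareCmd U hs.modulus hs.bound hs.clog hs.round (by omega) hq
    hs.clean
  rw [← ZMod.val_natCast] at hp
  -- The answers may be as large as `2^⌈log₂ q⌉ - 1`, which can exceed `q` but stays below `2q`.
  have hpow : 2 ^ Nat.clog 2 q < B := by
    rcases Nat.lt_or_ge 1 q with h | h
    · have h1 := Nat.pow_pred_clog_lt_self (b := 2) (by decide) h
      have h2 := Nat.clog_pos (b := 2) (by decide) h
      obtain ⟨c, hc⟩ := Nat.exists_eq_succ_of_ne_zero h2.ne'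
      rw [hc, Nat.pred_succ] at h1
      rw [hc, Nat.pow_succ]
      omega
    · have : q = 1 := by omega
      subst this
      simpa using by omega
  set s0 := run U prepareCmd s with hs0
  have hv0 : ∀ x, prepareCmd.wv x = false → s0.vars x = s.vars x := fun x h => run_vars U _ h s
  have hm0 : ∀ k < 16, rd s0 k = rd s k := fun k hk =>
    run_rd U _ (by decide) hk rfl s
  have ho0 : s0.out = s.out := run_out U _ (by decide) s
  set s1 := run U askCmd s with hs1
  have e1 : s1 = setV (setV { s0 with psi := s0.psi.query U g } 74 0) 75 1 := by
    have e5 : s0.vars 5 = B := by rw [hv0 5 (by decide), hs.bound]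
    have e70 : s0.vars 70 = g := by rw [hv0 70 (by decide), hs.round]
    rw [hs1, askCmd, run_seq, run_seq, run_seq, run_set, run_set, ← hs0]
    simp [run, e5, e70, Nat.mod_eq_of_lt (show 1 < B by omega)]
  have hv1 : ∀ x, askCmd.wv x = false → s1.vars x = s.vars x := fun x h => run_vars U _ h s
  have hm := outs_measure U (s := s1) (B := B) (c := Nat.clog 2 q) (g := g)
    (by rw [hv1 5 (by decide), hs.bound]) (by rw [hv1 9 (by decide), hs.clog])
    (by rw [hv1 70 (by decide), hs.round]) (by simp [e1]) (by simp [e1]) hpow G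
  have hpsi1 : s1.psi = s0.psi.query U g := by simp [e1]
  rw [hpsi1, wsum_query O hp G, hn] at hm
  have houts : outs U sampleCmd s =
      (outs U (rep 73 9 measureBit) s1).map (run U countCmd) := by
    rw [sampleCmd, outs, outs_eq_run U askCmd (by decide), ← hs1]
    simp only [List.flatMap_cons, List.flatMap_nil, List.append_nil]
    rw [outs, show outs U countCmd = fun s' => [run U countCmd s'] from rfl]
    exact (List.map_eq_flatMap ..).symm
  rw [houts]
  constructor
  · intro s' hs'
    obtain ⟨s2, hs2, rfl⟩ := List.mem_map.1 hs'
    have hsame := hm.1 s2 hs2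
    have hv2 : ∀ x, x ≠ 72 → x ≠ 73 → x ≠ 74 → x ≠ 75 → askCmd.wv x = false →
        s2.vars x = s.vars x := fun x a b c d h => (hsame.vars x a b c d).trans (hv1 x h)
    have e71 : s2.vars 71 = g % q := by
      rw [hsame.vars 71 (by decide) (by decide) (by decide) (by decide), e1]
      simpa using h71
    have hrd2 : rd s2 0 = rd s 0 := by
      have : rd s2 0 = rd s1 0 := by
        unfold rd
        rw [hsame.mem]
      rw [this, e1]
      exact hm0 0 (by decide)
    have e5 : s2.vars 5 = B := by
      rw [hv2 5 (by decide) (by decide) (by decide) (by decide) (by decide), hs.bound]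
    constructor
    · refine ⟨?_, ?_, ?_, ?_, ?_, ?_⟩
      · simpa [countCmd, run_put] using
          (hv2 1 (by decide) (by decide) (by decide) (by decide) (by decide)).trans hs.modulus
      · simpa [countCmd, run_put] using e5
      · simpa [countCmd, run_put] using
          (hv2 9 (by decide) (by decide) (by decide) (by decide) (by decide)).trans hs.clog
      · simpa [countCmd, run_put] using
          (hv2 70 (by decide) (by decide) (by decide) (by decide) (by decide)).trans hs.round
      · rw [inc_out, run_out U _ (by decide), hsame.out, e1]
        exact ho0.trans hs.out
      · rw [inc_psi, run_psi U _ (by decide)]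
        intro b hb
        refine clean_query hp U b ?_
        rw [← hpsi1]
        exact hsame.supp hb
    · intro r z
      rw [countCmd, run_put, rd_setC _ (by decide) (by decide)]
      simp only [eval_var, eval_add', eval_ld, eval_const, setC_vars, e71, e5, hrd2, true_and,
        and_true]
      split_ifs with h
      · rw [h.1, h.2, Nat.mod_eq_of_lt (hcnt _ _)]
      · rfl
  · rw [List.map_map]
    refine hm.2.trans (le_of_eq ?_)
    congr 1

theorem sampleCmd_wf : sampleCmd.wf = true := by decide

end ListDecoder

namespace ListDecoder

open Cmd

/-! ## The distribution of the samples -/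

variable {q l m : ℕ}

/-- The number of samples for the index `r` among the first `g`. -/
def rounds (q r g : ℕ) : ℕ := Nat.count (fun i => i % q = r) g

theorem rounds_succ (q r g : ℕ) :
    rounds q r (g + 1) = rounds q r g + if g % q = r then 1 else 0 :=
  Nat.count_succ _ _

/-- Round `g` queries the index `g` modulo `q`, so after `qM` rounds each index has been queried
equally often. -/
theorem rounds_mul [NeZero q] {r : ℕ} (hr : r < q) (M : ℕ) : rounds q r (q * M) = M := by
  have h := Nat.count_modEq_card (q * M) (NeZero.pos q) r
  rw [Nat.mul_mod_right, Nat.mul_div_cancel_left _ (NeZero.pos q), if_neg (by omega)] at h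
  unfold rounds
  refine Eq.trans ?_ h
  congr 1
  ext i
  rw [Nat.ModEq, Nat.mod_eq_of_lt hr]

/-- The squared distance between the numbers of the answers and their expectations. -/
noncomputable def deviation (O : CorruptedCodeword q l m) [NeZero q] (g : ℕ) (μ : ℕ → ℕ → ℕ) : ℝ :=
  ∑ r : ZMod q, ∑ z ∈ Finset.range q,
    ((μ r.val z : ℝ) - rounds q r.val g * answerProb O r z) ^ 2

/-- In the mean, one answer adds at most 1 to the squared distance. -/
theorem row_deviation_le (O : CorruptedCodeword q l m) (r : ZMod q) (S : Finset ℕ) (d : ℕ → ℝ) :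
    ∑ w, ‖O.α r w‖ ^ 2 * ∑ z ∈ S,
      (d z + (if z = bitsVal (extend w) (Nat.clog 2 q) then 1 else 0) - answerProb O r z) ^ 2 ≤
    ∑ z ∈ S, d z ^ 2 + 1 := by
  have h : ∀ z, ∑ w, ‖O.α r w‖ ^ 2 * (d z + (if z = bitsVal (extend w) (Nat.clog 2 q) then 1 else 0)
      - answerProb O r z) ^ 2 ≤ d z ^ 2 + answerProb O r z := by
    intro z
    set p := answerProb O r z with hp
    have h1 : ∀ w, ‖O.α r w‖ ^ 2 *
        (d z + (if z = bitsVal (extend w) (Nat.clog 2 q) then 1 else 0) - p) ^ 2 =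
        ‖O.α r w‖ ^ 2 * (d z - p) ^ 2 +
        (if bitsVal (extend w) (Nat.clog 2 q) = z then ‖O.α r w‖ ^ 2 else 0) *
          (2 * (d z - p) + 1) := by
      intro w
      by_cases h : z = bitsVal (extend w) (Nat.clog 2 q)
      · rw [if_pos h, if_pos h.symm]; ring
      · rw [if_neg h, if_neg (Ne.symm h)]; ring
    rw [Finset.sum_congr rfl fun w _ => h1 w, Finset.sum_add_distrib, ← Finset.sum_mul,
      ← Finset.sum_mul, sum_normSq_alpha,
      show ∑ w, (if bitsVal (extend w) (Nat.clog 2 q) = z then ‖O.α r w‖ ^ 2 else 0) = p from rfl]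
    -- The exact value is `d² + p - p²`: adding an answer with mean `p` and subtracting `p` leaves
    -- the mean and adds the variance.
    nlinarith [sq_nonneg p]
  simp only [Finset.mul_sum]
  rw [Finset.sum_comm]
  refine (Finset.sum_le_sum fun z _ => h z).trans ?_
  rw [Finset.sum_add_distrib]
  have := sum_answerProb_le O r S
  linarith

/-- Only the row of the index being queried changes, in its counts and in its expectations; the
other rows are averaged over a constant. -/
theorem deviation_step (O : CorruptedCodeword q l m) [NeZero q] (g : ℕ) (μ : ℕ → ℕ → ℕ) :
    ∑ w, ‖O.α g w‖ ^ 2 * deviation O (g + 1)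
      (fun r z => μ r z + if r = g % q ∧ z = bitsVal (extend w) (Nat.clog 2 q) then 1 else 0) ≤
    deviation O g μ + 1 := by
  unfold deviation
  simp only [Finset.mul_sum (Finset.univ : Finset (ZMod q))]
  rw [Finset.sum_comm]
  have hrow : ∀ r : ZMod q, ∑ w, ‖O.α g w‖ ^ 2 * ∑ z ∈ Finset.range q,
      (((μ r.val z + if r.val = g % q ∧ z = bitsVal (extend w) (Nat.clog 2 q) then 1 else 0 : ℕ) : ℝ)
        - rounds q r.val (g + 1) * answerProb O r z) ^ 2 ≤
      ∑ z ∈ Finset.range q, ((μ r.val z : ℝ) - rounds q r.val g * answerProb O r z) ^ 2 +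
        if r = g then 1 else 0 := by
    intro r
    by_cases hr : r = (g : ZMod q)
    · subst hr
      have hv : (g : ZMod q).val = g % q := ZMod.val_natCast q g
      rw [if_pos rfl]
      refine le_trans (le_of_eq ?_) (row_deviation_le O g (Finset.range q)
        (fun z => (μ (g : ZMod q).val z : ℝ) - rounds q (g : ZMod q).val g * answerProb O g z))
      refine Finset.sum_congr rfl fun w _ => ?_
      congr 1
      refine Finset.sum_congr rfl fun z _ => ?_
      rw [rounds_succ, if_pos hv.symm]
      simp only [hv, true_and]
      push_cast
      ring
    · have hv : r.val ≠ g % q := by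
        rw [← ZMod.val_natCast]
        exact fun h => hr (ZMod.val_injective q h)
      simp only [hv, false_and, if_false, add_zero, rounds_succ, Ne.symm hv, hr]
      rw [← Finset.sum_mul, sum_normSq_alpha, one_mul]
  refine (Finset.sum_le_sum fun r _ => hrow r).trans ?_
  rw [Finset.sum_add_distrib]
  simp

/-- The number of the answers `z` to the query `r` so far. -/
def tally (s : MState) (r z : ℕ) : ℕ := rd s 0 r z 0 0

theorem outs_samples [NeZero q] (O : CorruptedCodeword q l m) {s : MState} {B N : ℕ} (K : ℝ)
    (hs : Ready q B 0 (setV s 70 0)) (hqB : 2 * q < B) (hNB : N < B) (h8 : s.vars 8 = N)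
    (h0 : ∀ r z, tally s r z = 0) :
    (∀ s' ∈ outs (O.U : Matrix (Block q l m) (Block q l m) ℂ) (rep 70 8 sampleCmd) s,
      s'.out = [] ∧ (∀ r z, tally s' r z ≤ N) ∧
      ∀ r, ∑ z ∈ Finset.range q, tally s' r z ≤ rounds q r N) ∧
    s.psi.normSq * (K - N) ≤
      ((outs (O.U : Matrix (Block q l m) (Block q l m) ℂ) (rep 70 8 sampleCmd) s).map
        fun s' => s'.psi.normSq * (K - deviation O N (tally s'))).sum := by
  have key := outsIter_sum
    (G := outs (O.U : Matrix (Block q l m) (Block q l m) ℂ) sampleCmd) (x := 70) (N := N)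
    (fun j s' => Ready q B j s' ∧ (∀ r z, tally s' r z ≤ j) ∧
      ∀ r, ∑ z ∈ Finset.range q, tally s' r z ≤ rounds q r j)
    -- The potential allows an increase of the deviation by 1 for each of the `N - j` samples to
    -- come, so its total over the outcomes does not decrease.
    (fun j s' => s'.psi.normSq * (K - (N - j) - deviation O j (tally s')))
    ?_ (s := setV s 70 0) ?_
  · rw [outs, h8]
    refine ⟨fun s' hs' => ?_, ?_⟩
    · obtain ⟨h1, h2, h3⟩ := key.1 s' hs'
      exact ⟨h1.out, h2, h3⟩
    · have h2 := key.2
      have hdev : deviation O 0 (tally (setV s 70 0)) = 0 := by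
        have : ∀ r z, tally (setV s 70 0) r z = 0 := h0
        simp [deviation, this, rounds]
      rw [hdev] at h2
      simpa using h2
  · rintro j hj s' ⟨hr, hle, hrow⟩
    have hstep := outs_sampleCmd O hr hqB (fun r z => by have := hle r z; unfold tally at this; omega)
      (fun y => K - (N - (j + 1 : ℕ)) - deviation O (j + 1)
        (fun r z => tally s' r z + if r = j % q ∧ z = y then 1 else 0))
    have htally : ∀ s'' ∈ outs (O.U : Matrix (Block q l m) (Block q l m) ℂ) sampleCmd s',
        ∀ r z, tally (inc 70 s'') r z =
          tally s' r z + if r = j % q ∧ z = s''.vars 74 then 1 else 0 := fun s'' h =>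
      (hstep.1 s'' h).2
    constructor
    · intro s'' h
      refine ⟨(hstep.1 s'' h).1, fun r z => ?_, fun r => ?_⟩
      · rw [htally s'' h]
        have := hle r z
        split_ifs <;> omega
      · simp only [htally s'' h, Finset.sum_add_distrib, rounds_succ]
        refine Nat.add_le_add (hrow r) ?_
        by_cases hrj : r = j % q
        · simp only [hrj, true_and, if_true]
          rw [Finset.sum_ite_eq']
          split_ifs <;> omega
        · simp [hrj]
    · have h2 := hstep.2
      have h3 : ((outs (O.U : Matrix (Block q l m) (Block q l m) ℂ) sampleCmd s').map fun s'' =>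
          (inc 70 s'').psi.normSq * (K - (N - (j + 1 : ℕ)) -
            deviation O (j + 1) (tally (inc 70 s'')))) =
          ((outs (O.U : Matrix (Block q l m) (Block q l m) ℂ) sampleCmd s').map fun s'' =>
          s''.psi.normSq * (K - (N - (j + 1 : ℕ)) - deviation O (j + 1)
            (fun r z => tally s' r z + if r = j % q ∧ z = s''.vars 74 then 1 else 0))) := by
        refine List.map_congr_left fun s'' h => ?_
        rw [show tally (inc 70 s'') = _ from funext fun r => funext fun z => htally s'' h r z]
        rfl
      rw [h3]
      refine le_trans ?_ h2
      refine mul_le_mul_of_nonneg_left ?_ (normSq_nonneg _)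
      have h4 := deviation_step O j (tally s')
      simp only [mul_sub (_ : ℝ) (K - _), Finset.sum_sub_distrib]
      rw [← Finset.sum_mul, sum_normSq_alpha]
      push_cast
      linarith
  · exact ⟨hs, fun r z => (h0 r z).le, fun r =>
      (Finset.sum_eq_zero fun z _ => h0 r z).le.trans (Nat.zero_le _)⟩

/-! ## The decoding radius -/

/-- After multiplication by `a` the claim is `a/8 ≤ a³ + b(s² - a² - as)`, linear in `b`. If the
coefficient of `b` is nonnegative, `a ≤ a³` suffices. Otherwise the worst case is `b = a`, where the
right side is `a·s(s - a)`. That is enough unless `a` is very close to `s`, and then the gap between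
`b` and `s` is used. -/
theorem radius_aux {a b s : ℝ} (hb : 1 ≤ b) (hba : b ≤ a) (has : a ≤ s) (hbs : b ^ 2 ≤ s ^ 2 - 1) :
    b * s + 1 / 8 ≤ a ^ 2 + (s ^ 2 - a ^ 2) * (b / a) := by
  have ha : 0 < a := by linarith
  have hs : 0 < s := by linarith
  suffices h : (b * s + 1 / 8) * a ≤ a ^ 3 + (s ^ 2 - a ^ 2) * b by
    rw [← mul_le_mul_iff_of_pos_right ha]
    refine h.trans (le_of_eq ?_)
    field_simp
  rcases le_or_gt 0 (s ^ 2 - a ^ 2 - a * s) with h | h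
  · have h1 : a ≤ a ^ 3 := le_self_pow₀ (by linarith) (by norm_num)
    nlinarith [mul_nonneg (by linarith : (0 : ℝ) ≤ b) h]
  rcases le_or_gt (1 / 8) (s * (s - a)) with h' | h'
  · nlinarith [mul_le_mul_of_nonneg_left h' ha.le, mul_nonneg (sub_nonneg.2 hba) (neg_nonneg.2 h.le)]
  · -- here `a` is close to `s`, and `b` is not
    obtain ⟨x, rfl⟩ : ∃ x, a = s - x := ⟨s - a, by ring⟩
    have hx0 : 0 ≤ x := by linarith
    obtain ⟨y, rfl⟩ : ∃ y, b = s - y := ⟨s - b, by ring⟩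
    -- From `b² ≤ s² - 1` one gets `y(2s - y) ≥ 1`.
    have hy : 1 / 2 ≤ s * y := by nlinarith
    have hy0 : 0 < y := by
      by_contra hcon
      nlinarith
    have hsx : s * x < 1 / 8 := by nlinarith
    have hs1 : 1 ≤ s := by linarith
    have hxs : x ≤ 1 / 8 := by nlinarith
    have hid : (s - x) ^ 3 + (s ^ 2 - (s - x) ^ 2) * (s - y) - ((s - y) * s + 1 / 8) * (s - x) =
        (2 * s - x) * x ^ 2 + s * y * (s - 3 * x) + x ^ 2 * y - (s - x) / 8 := by ring
    have h1 : 0 ≤ (2 * s - x) * x ^ 2 := mul_nonneg (by linarith) (by positivity)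
    have h2 : 1 / 2 * (s - 3 * x) ≤ s * y * (s - 3 * x) :=
      mul_le_mul_of_nonneg_right hy (by linarith)
    have h3 : 0 ≤ x ^ 2 * y := by positivity
    linarith

/-- Put `a² = 1 + qε'`, `b² = n - 1` and `s² = q`. Multiplied by `q`, the hypothesis on `ε` reads
`a² + (s² - a²) b/a < 1 + qε`, and the bounds on `qε'` say `b ≤ a ≤ s`. So the parameter `ε'` never
yields a radius beyond `√((n-1)q)`, and the program need not know it. -/
theorem radius_gap {n q : ℕ} {ε ε' : ℝ} (hn : 2 ≤ n) (hnq : n ≤ q)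
    (h1 : (n : ℝ) - 2 ≤ q * ε') (h2 : q * ε' ≤ (q : ℝ) - 1)
    (h3 : ε' + (1 - 1 / (q : ℝ) - ε') * Real.sqrt (((n : ℝ) - 1) / (1 + q * ε')) < ε) :
    Real.sqrt ((n - 1) * q) + 1 / 8 ≤ 1 + q * ε := by
  have hn' : (2 : ℝ) ≤ n := by exact_mod_cast hn
  have hnq' : (n : ℝ) ≤ q := by exact_mod_cast hnq
  have hq : (0 : ℝ) < q := by linarith
  have hk : (0 : ℝ) ≤ n - 1 := by linarith
  have hT : (0 : ℝ) ≤ 1 + q * ε' := by linarith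
  rw [Real.sqrt_div hk] at h3
  have key := radius_aux (a := Real.sqrt (1 + q * ε')) (b := Real.sqrt (n - 1)) (s := Real.sqrt q)
    (Real.one_le_sqrt.2 (by linarith)) (Real.sqrt_le_sqrt (by linarith))
    (Real.sqrt_le_sqrt (by linarith))
    (by rw [Real.sq_sqrt hk, Real.sq_sqrt hq.le]; linarith)
  rw [Real.sq_sqrt hT, Real.sq_sqrt hq.le] at key
  rw [Real.sqrt_mul hk]
  have h4 := mul_lt_mul_of_pos_left h3 hq
  have h5 : (q : ℝ) * (ε' + (1 - 1 / q - ε') * (Real.sqrt (n - 1) / Real.sqrt (1 + q * ε'))) =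
      q * ε' + (q - (1 + q * ε')) * (Real.sqrt (n - 1) / Real.sqrt (1 + q * ε')) := by
    field_simp
    ring
  linarith

/-- If the samples are close to their expectations, then the codewords with large presence satisfy
the condition for soft-decision decoding. -/
theorem agreement_large [Fact q.Prime] {n C M : ℕ} {ε : ℝ} (hl : q ≤ 2 ^ l)
    (O : CorruptedCodeword q l m) (hn : 2 ≤ n) (hnq : n ≤ q) (hC : 0 < C)
    (hM : M = 256 * q ^ 2 * C)
    (hgap : Real.sqrt ((n - 1) * q) + 1 / 8 ≤ 1 + q * ε) {μ : ℕ → ℕ → ℕ}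
    (hrow : ∀ r < q, ∑ z ∈ Finset.range q, μ r z ≤ M)
    (hdev : deviation O (q * M) μ < (q * M * C : ℕ)) {x : Fin n → ZMod q}
    (hx : 1 / (q : ℝ) + ε ≤ presence O (GRS q n x)) :
    (n - 1) * ∑ r ∈ Finset.range q, ∑ z ∈ Finset.range q, μ r z * (μ r z + 1) <
      agreement q n μ x * (agreement q n μ x + 1) := by
  have hq : 0 < q := NeZero.pos q
  have hq' : (0 : ℝ) < q := by exact_mod_cast hq
  have hMpos : 0 < M := by rw [hM]; positivity
  have hM' : (0 : ℝ) < M := by exact_mod_cast hMpos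
  have hMr : (M : ℝ) = 256 * q ^ 2 * C := by rw [hM]; push_cast; ring
  have hn' : (2 : ℝ) ≤ n := by exact_mod_cast hn
  have hnq' : (n : ℝ) ≤ q := by exact_mod_cast hnq
  set w := Real.sqrt ((n - 1) * q) with hw
  have hw2 : w ^ 2 = (n - 1) * q := Real.sq_sqrt (by nlinarith)
  have hw1 : 1 ≤ w := Real.one_le_sqrt.2 (by nlinarith)
  have hwq : w ≤ q := Real.sqrt_le_iff.2 ⟨hq'.le, by nlinarith⟩
  -- The crude bound `μ ≤ M` within a row with sum at most `M`; it already suffices for the radius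
  -- `√((n-1)q)`.
  have hsq : ∑ r ∈ Finset.range q, ∑ z ∈ Finset.range q, μ r z * (μ r z + 1) ≤
      q * (M * (M + 1)) := by
    calc _ ≤ ∑ r ∈ Finset.range q, M * (M + 1) := by
          refine Finset.sum_le_sum fun r hr => ?_
          have hr' := hrow r (Finset.mem_range.1 hr)
          calc _ ≤ ∑ z ∈ Finset.range q, μ r z * (M + 1) := by
                refine Finset.sum_le_sum fun z hz => Nat.mul_le_mul_left _ (Nat.succ_le_succ ?_)
                exact (Finset.single_le_sum (fun _ _ => Nat.zero_le _) hz).trans hr'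
            _ = (∑ z ∈ Finset.range q, μ r z) * (M + 1) := by rw [Finset.sum_mul]
            _ ≤ _ := Nat.mul_le_mul_right _ hr'
      _ = _ := by simp
  set e : ZMod q → ℝ := fun r => (μ r.val (GRS q n x r).val : ℝ) -
    M * answerProb O r (GRS q n x r).val with he
  have hesq : ∑ r, e r ^ 2 ≤ deviation O (q * M) μ := by
    refine Finset.sum_le_sum fun r _ => ?_
    rw [rounds_mul (ZMod.val_lt r)]
    exact Finset.single_le_sum (f := fun z => ((μ r.val z : ℝ) - M * answerProb O r z) ^ 2)
      (fun _ _ => sq_nonneg _) (Finset.mem_range.2 (ZMod.val_lt (GRS q n x r)))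
  have hcs : (∑ r, e r) ^ 2 ≤ q * ∑ r, e r ^ 2 := by
    have := sq_sum_le_card_mul_sum_sq (s := (Finset.univ : Finset (ZMod q))) (f := e)
    rwa [Finset.card_univ, ZMod.card] at this
  -- By Cauchy–Schwarz the square is less than `q · qMC`, which equals `M²/256` by the choice of
  -- `M`.
  have hnoise : -(M / 16 : ℝ) < ∑ r, e r := by
    have h1 : (∑ r, e r) ^ 2 < (M / 16 : ℝ) ^ 2 := by
      refine (hcs.trans (mul_le_mul_of_nonneg_left hesq hq'.le)).trans_lt ?_
      refine (mul_lt_mul_of_pos_left hdev hq').trans_le (le_of_eq ?_)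
      push_cast
      rw [div_pow, sq (M : ℝ)]
      nth_rewrite 2 [hMr]
      ring
    exact (abs_lt.1 (abs_lt_of_sq_lt_sq h1 (by positivity))).1
  have hpres : w + 1 / 8 ≤ ∑ r, answerProb O r (GRS q n x r).val := by
    refine hgap.trans ?_
    have h1 : 1 + q * ε = q * (1 / (q : ℝ) + ε) := by field_simp
    rw [h1]
    refine (mul_le_mul_of_nonneg_left hx hq'.le).trans ?_
    unfold presence
    rw [← mul_assoc, mul_one_div_cancel hq'.ne', one_mul]
    exact Finset.sum_le_sum fun r _ => le_answerProb hl O r _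
  have hA : M * (w + 1 / 16) ≤ (agreement q n μ x : ℝ) := by
    have h1 : (agreement q n μ x : ℝ) = ∑ r, e r + M * ∑ r, answerProb O r (GRS q n x r).val := by
      simp only [agreement, he, Finset.sum_sub_distrib, ← Finset.mul_sum]
      push_cast
      ring
    have := mul_le_mul_of_nonneg_left hpres hM'.le
    rw [h1]
    linarith
  -- Needed because `w² M`, the lower-order part of `w² M(M+1)`, must not exceed `w M²/8`, the cross
  -- term of `M²(w + 1/16)²`.
  have hwM : 8 * w ≤ M := by
    have h1 : (1 : ℝ) ≤ q := by exact_mod_cast hq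
    have h2 : (1 : ℝ) ≤ C := by exact_mod_cast hC
    have h3 : (q : ℝ) ≤ q ^ 2 * C := by nlinarith [mul_le_mul h1 h2 (by norm_num) hq'.le]
    rw [hMr]
    nlinarith
  have hreal : ((n : ℝ) - 1) * (q * (M * (M + 1))) <
      (agreement q n μ x : ℝ) * (agreement q n μ x + 1) := by
    have h1 : ((n : ℝ) - 1) * (q * (M * (M + 1))) = w ^ 2 * M * (M + 1) := by rw [hw2]; ring
    have hA0 : 0 < M * (w + 1 / 16) := by positivity
    have h2 : (M * (w + 1 / 16)) * (M * (w + 1 / 16) + 1) ≤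
        (agreement q n μ x : ℝ) * (agreement q n μ x + 1) := by
      apply mul_le_mul hA <;> linarith
    refine lt_of_lt_of_le ?_ h2
    rw [h1]
    have h3 : w ^ 2 * M ≤ w * M ^ 2 / 8 := by
      nlinarith [mul_le_mul_of_nonneg_left hwM (by positivity : 0 ≤ w * M)]
    nlinarith [sq_nonneg (M : ℝ)]
  have hnat : (n - 1) * (q * (M * (M + 1))) < agreement q n μ x * (agreement q n μ x + 1) := by
    have h1 : ((n - 1 : ℕ) : ℝ) = (n : ℝ) - 1 := by
      rw [Nat.cast_sub (by omega)]
      simp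
    rw [← h1] at hreal
    exact_mod_cast hreal
  exact (Nat.mul_le_mul_left _ hsq).trans_lt hnat

end ListDecoder

namespace ListDecoder

open Polynomial Cmd

/-! ## The list decoder -/

/-- Compute the parameters. -/
def setupCmd : Cmd :=
  set 6 5 (.sub (.var 0) (.const 1)) ;;
  set 7 5 (.mul (.const 256) (.mul (.mul (.var 1) (.var 1)) (.var 4))) ;;
  set 8 5 (.mul (.var 1) (.var 7)) ;;
  set 10 5 (.add (.var 8) (.const 1)) ;;
  set 9 5 (.const 0) ;;
  set 75 5 (.const 1) ;;
  rep 73 1 (ite (.lt (.var 75) (.var 1))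
    (set 75 5 (.mul (.const 2) (.var 75)) ;; set 9 5 (.add (.var 9) (.const 1))) nop)

/-- Setup, sampling and decoding. -/
def mainCmd : Cmd := setupCmd ;; rep 70 8 sampleCmd ;; decodeCmd

theorem setupCmd_wf : setupCmd.wf = true := by decide

theorem setupCmd_det : setupCmd.det = true := by decide

theorem mainCmd_wf : mainCmd.wf = true := by
  simp only [mainCmd, Cmd.wf, setupCmd_wf, sampleCmd_wf, decodeCmd_wf]
  decide

/-- A bound for the input. -/
def sizeE : Expr := .add (.add (.add (.var 0) (.var 1)) (.var 4)) (.const 10)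

/-- The square of an expression. -/
def sqE (e : Expr) : Expr := .mul e e

/-- A bound for the numbers in the machine. -/
def boundE : Expr := sqE (sqE (sqE (sqE sizeE)))

theorem eval_boundE (s : MState) :
    boundE.eval s = (s.vars 0 + s.vars 1 + s.vars 4 + 10) ^ 16 := by
  simp only [boundE, sqE, sizeE, eval_mul', eval_add', eval_var, eval_const]
  generalize s.vars 0 + s.vars 1 + s.vars 4 + 10 = S
  ring

/-- The list decoder. -/
def decoder : Program :=
  .seq (.assign 2 (.const 0)) (.seq (.assign 3 (.const 0)) (.seq (.assign 5 boundE)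
    mainCmd.compile))

/-- A bound for the running time. -/
noncomputable def decoderCost : ℕ[X] := 5 + exprCost boundE + mainCmd.cost.comp (X ^ 16)

/-- The state after the first assignments. -/
noncomputable def startState (n q a b C : ℕ) : MState :=
  setV (setV (setV (initState [n, q, a, b, C]) 2 0) 3 0) 5 ((n + q + C + 10) ^ 16)

theorem startState_vars (n q a b C x : ℕ) : (startState n q a b C).vars x =
    if x = 0 then n else if x = 1 then q else if x = 4 then C else
      if x = 5 then (n + q + C + 10) ^ 16 else 0 := by
  rcases x with _ | _ | _ | _ | _ | _ | x <;> simp [startState, initState]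

variable {q l m : ℕ}

theorem reaches_decoder (U : Matrix (Block q l m) (Block q l m) ℂ) (hq : 0 < q) (n a b C : ℕ) :
    Reaches U decoder (initState [n, q, a, b, C]) (outs U mainCmd (startState n q a b C))
      (decoderCost.eval (n + q + C + 10)) (fun _ => True) := by
  set S := n + q + C + 10 with hS
  have hSB : S ≤ S ^ 16 := Nat.le_self_pow (by decide) S
  have hb : Bounded (S ^ 16) (startState n q a b C) := by
    -- Variables 2 and 3, which held `⌈1/ε⌉` and `⌈1/δ⌉`, have been cleared. They are not used and
    -- need not be bounded in terms of the other inputs.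
    refine ⟨by omega, fun x => ?_, fun x => Nat.zero_le _, ?_, ?_⟩
    · rw [startState_vars, ← hS]
      split_ifs <;> omega
    · simp [startState_vars, hS]
    · simpa [startState_vars] using hq
  set s2 := setV (setV (initState [n, q, a, b, C]) 2 0) 3 0 with hs2
  have hv2 : ∀ x, s2.vars x ≤ S := by
    intro x
    rcases x with _ | _ | _ | _ | _ | x <;> simp [hs2, initState] <;> omega
  have heval : boundE.eval s2 = S ^ 16 := by
    rw [eval_boundE]
    simp [hs2, initState, hS]
  have h1 : Reaches U (.assign 2 (.const 0)) (initState [n, q, a, b, C])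
      [setV (initState [n, q, a, b, C]) 2 0] 2
      (fun s => s = setV (initState [n, q, a, b, C]) 2 0) :=
    Reaches.single (Exec.assign _ _ _) (by simp [Expr.time]) rfl
  have h2 : Reaches U (.assign 3 (.const 0)) (setV (initState [n, q, a, b, C]) 2 0)
      [s2] 2 (fun s => s = s2) :=
    Reaches.single (Exec.assign _ _ _) (by simp [Expr.time]) rfl
  have h3 : Reaches U (.assign 5 boundE) s2 [startState n q a b C]
      (1 + (exprCost boundE).eval S) (fun s => s = startState n q a b C) := by
    have h := Exec.assign (U := U) 5 boundE s2
    rw [heval] at h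
    exact Reaches.single h (Nat.add_le_add_left (time_le (by omega) hv2
      (fun _ => Nat.zero_le _) _) _) rfl
  have h4 := reaches_outs (U := U) mainCmd mainCmd_wf _ hb
  have h5 := h1.seq (R := fun _ => outs U mainCmd (startState n q a b C)) fun s _ hs => by
    subst hs
    have h6 := h2.seq (R := fun _ => outs U mainCmd (startState n q a b C)) fun s _ hs => by
      subst hs
      have h7 := h3.seq (R := fun _ => outs U mainCmd (startState n q a b C)) fun s _ hs => by
        subst hs
        exact h4
      simpa using h7
    simpa using h6
  simp only [List.flatMap_cons, List.flatMap_nil, List.append_nil] at h5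
  refine h5.mono (le_of_eq ?_) fun _ _ _ => trivial
  simp only [decoderCost, eval_add, eval_comp, eval_pow, eval_X, eval_ofNat]
  ring

/-- With `S = n + q + C + 10` one has `D ≤ 256 S⁴ + 1 ≤ S⁷`, as `S³ ≥ 1000`. So even `D²` is at most
`S¹⁴`, below the modulus `S¹⁶` that four squarings produce; no reduction ever alters a counter or an
index. -/
theorem samples_lt {n q C D : ℕ} (hD : D = q * (256 * q ^ 2 * C) + 1) :
    D * D < (n + q + C + 10) ^ 16 ∧ D * (n + 1) < (n + q + C + 10) ^ 16 ∧
      D < (n + q + C + 10) ^ 16 ∧ 2 * q < (n + q + C + 10) ^ 16 := by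
  generalize hS : n + q + C + 10 = S
  have hS1 : 10 ≤ S := by omega
  have h3 : 1000 ≤ S ^ 3 := (Nat.pow_le_pow_left hS1 3)
  have h7 : D ≤ S ^ 7 := by
    have h1 : q * (256 * q ^ 2 * C) ≤ S * (256 * S ^ 2 * S) := by
      gcongr <;> omega
    have h2 : 0 < S ^ 4 := by positivity
    have h4 : S * (256 * S ^ 2 * S) = 256 * S ^ 4 := by ring
    have h5 : S ^ 7 = S ^ 3 * S ^ 4 := by ring
    nlinarith
  have hlt : ∀ k < 16, S ^ k < S ^ 16 := fun k hk => Nat.pow_lt_pow_right (by omega) hk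
  refine ⟨?_, ?_, h7.trans_lt (hlt 7 (by decide)), ?_⟩
  · calc D * D ≤ S ^ 7 * S ^ 7 := Nat.mul_le_mul h7 h7
      _ = S ^ 14 := by ring
      _ < _ := hlt 14 (by decide)
  · calc D * (n + 1) ≤ S ^ 7 * S := Nat.mul_le_mul h7 (by omega)
      _ = S ^ 8 := by ring
      _ < _ := hlt 8 (by decide)
  · calc 2 * q ≤ S * S := Nat.mul_le_mul (by omega) (by omega)
      _ = S ^ 2 := by ring
      _ < _ := hlt 2 (by decide)

theorem run_setupCmd (U : Matrix (Block q l m) (Block q l m) ℂ) (n a b C : ℕ) :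
    (run U setupCmd (startState n q a b C)).vars 6 = n - 1 ∧
    (run U setupCmd (startState n q a b C)).vars 8 = q * (256 * q ^ 2 * C) ∧
    (run U setupCmd (startState n q a b C)).vars 9 = Nat.clog 2 q ∧
    (run U setupCmd (startState n q a b C)).vars 10 = q * (256 * q ^ 2 * C) + 1 := by
  set s := startState n q a b C with hs
  set B := (n + q + C + 10) ^ 16 with hB
  set M := 256 * q ^ 2 * C with hM
  obtain ⟨-, -, hDB, hqB⟩ := samples_lt (n := n) (q := q) (C := C) rfl
  rw [← hB, ← hM] at hDB
  rw [← hB] at hqB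
  have hnB : n + q + C + 10 ≤ B := Nat.le_self_pow (by decide) _
  have hMB : M < B := by
    rcases Nat.eq_zero_or_pos q with h | h
    · have : M = 0 := by simp [hM, h]
      omega
    · exact (Nat.le_mul_of_pos_left M h).trans_lt (by omega)
  have e0 : s.vars 0 = n := by simp [hs, startState_vars]
  have e1 : s.vars 1 = q := by simp [hs, startState_vars]
  have e4 : s.vars 4 = C := by simp [hs, startState_vars]
  have e5 : s.vars 5 = B := by simp [hs, startState_vars, hB]
  set s1 := setV (setV (setV (setV (setV (setV s 6 (n - 1)) 7 M) 8 (q * M)) 10 (q * M + 1)) 9 0)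
    75 1 with hs1
  have hrun : run U setupCmd s = run U (rep 73 1 (ite (.lt (.var 75) (.var 1))
      (set 75 5 (.mul (.const 2) (.var 75)) ;; set 9 5 (.add (.var 9) (.const 1))) nop)) s1 := by
    have hMe : 256 * (q * q * C) = M := by rw [hM]; ring
    simp only [setupCmd, run_seq, run_set, eval_sub', eval_mul', eval_add', eval_var, eval_const,
      setV_vars, e0, e1, e4, e5]
    simp only [Nat.reduceEqDiff, if_true, if_false, hMe,
      Nat.mod_eq_of_lt hMB, Nat.mod_eq_of_lt hDB, Nat.mod_eq_of_lt (show n - 1 < B by omega),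
      Nat.mod_eq_of_lt (show q * M < B by omega), Nat.mod_eq_of_lt (show 1 < B by omega),
      Nat.zero_mod, OfNat.one_ne_ofNat]
    rfl
  rw [hrun]
  refine ⟨?_, ?_, ?_, ?_⟩
  · rw [run_vars U _ (by decide)]
    simp [hs1]
  · rw [run_vars U _ (by decide)]
    simp [hs1]
  -- Doubling stops once the power of two reaches `q`. As `q ≤ 2^q`, the `q` rounds available are
  -- enough.
  · have key := run_rep_frame U (fun i s' => s'.vars 9 = min i (Nat.clog 2 q) ∧
        s'.vars 75 = 2 ^ s'.vars 9) (x := 73) (y := 1) (c := ite (.lt (.var 75) (.var 1))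
      (set 75 5 (.mul (.const 2) (.var 75)) ;; set 9 5 (.add (.var 9) (.const 1))) nop)
      (by decide) (by decide) (s := s1) (by simp [hs1]) ?_
    · rw [key.1, min_eq_right]
      refine (Nat.clog_le_of_le_pow ?_)
      simpa [hs1, e1] using Nat.lt_two_pow_self.le
    · rintro i hi s' hf h73 ⟨h9, h75⟩
      have f1 : s'.vars 1 = q := by
        rw [hf.vars 1 (by decide) (by decide)]
        simp [hs1, e1]
      have f5 : s'.vars 5 = B := by
        rw [hf.vars 5 (by decide) (by decide)]
        simp [hs1, e5]
      have hclog : ∀ j, j < Nat.clog 2 q ↔ 2 ^ j < q := fun j =>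
        Nat.lt_clog_iff_pow_lt (by decide)
      have hiq : i < q := by simpa [hs1, e1] using hi
      rw [run]
      simp only [eval_lt', eval_var, f1, h75]
      by_cases hlt : 2 ^ s'.vars 9 < q
      · have h := (hclog _).2 hlt
        rw [if_pos (by simp [hlt]), run_seq, run_set, run_set]
        have hi9 : s'.vars 9 = i := by omega
        have h2 : 2 * 2 ^ i % B = 2 * 2 ^ i := Nat.mod_eq_of_lt (by rw [hi9] at hlt; omega)
        have h3 : (i + 1) % B = i + 1 := Nat.mod_eq_of_lt (by omega)
        simp only [setV_vars, eval_mul', eval_const, eval_var, eval_add', h75, hi9, f5]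
        simp [h2, h3, pow_succ']
        omega
      · have h := mt (hclog _).1 hlt
        rw [if_neg (by simp [hlt]), nop, run_set]
        simp [h75]
        omega
  · rw [run_vars U _ (by decide)]
    simp [hs1]

theorem normSq_initState (w : List ℕ) : (initState w).psi.normSq = 1 := by
  simp [initState, QState.normSq, Finsupp.sum_single_index]

open Classical in
/-- The list decoder succeeds with sufficient probability. -/
theorem decoder_prob [Fact q.Prime] {n C : ℕ} {ε δ : ℝ} (hl : q ≤ 2 ^ l)
    (O : CorruptedCodeword q l m) (hn : 2 ≤ n) (hnq : n ≤ q)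
    (hgap : Real.sqrt ((n - 1) * q) + 1 / 8 ≤ 1 + q * ε) (hδ : δ < 1) (hC : 1 / (1 - δ) ≤ C)
    (a b : ℕ) :
    δ ≤ ((outs (O.U : Matrix (Block q l m) (Block q l m) ℂ) mainCmd (startState n q a b C)).map
      fun s => if IsValidList (GRS q n) ε O s.out then s.psi.normSq else 0).sum := by
  set U := (O.U : Matrix (Block q l m) (Block q l m) ℂ) with hU
  have hq : 0 < q := NeZero.pos q
  have hδ' : 0 < 1 - δ := by linarith
  have hCr : (0 : ℝ) < C := (by positivity : 0 < 1 / (1 - δ)).trans_le hC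
  have hCpos : 0 < C := by exact_mod_cast hCr
  set M := 256 * q ^ 2 * C with hM
  have hMpos : 0 < M := by positivity
  set B := (n + q + C + 10) ^ 16 with hB
  obtain ⟨hB1, hB2, hB3, hB4⟩ := samples_lt (n := n) (q := q) (C := C) rfl
  rw [← hB, ← hM] at hB1 hB2 hB3
  rw [← hB] at hB4
  set s0 := startState n q a b C with hs0
  set s1 := run U setupCmd s0 with hs1
  obtain ⟨e6, e8, e9, e10⟩ := run_setupCmd U n a b C
  rw [← hs0, ← hs1, ← hM] at e8 e10
  rw [← hs0, ← hs1] at e6 e9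
  have hv1 : ∀ x, setupCmd.wv x = false → s1.vars x = s0.vars x := fun x h => run_vars U _ h s0
  have e0 : s1.vars 0 = n := by simp [hv1 0 (by decide), hs0, startState_vars]
  have e1 : s1.vars 1 = q := by simp [hv1 1 (by decide), hs0, startState_vars]
  have e5 : s1.vars 5 = B := by simp [hv1 5 (by decide), hs0, startState_vars, hB]
  have hpsi : s1.psi = (initState [n, q, a, b, C]).psi := run_psi U _ (by decide) s0
  have hready : Ready q B 0 (setV s1 70 0) := by
    refine ⟨by simp [e1], by simp [e5], by simp [e9], by simp, ?_, ?_⟩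
    · rw [setV_out, hs1, run_out U _ (by decide)]
      rfl
    · intro b' hb' R j i _
      rw [setV_psi, hpsi] at hb'
      rw [Finset.mem_singleton.1 (Finsupp.support_single_subset hb')]
  have htally : ∀ r z, tally s1 r z = 0 := by
    intro r z
    unfold tally
    rw [hs1, run_rd U _ (by decide) (by decide) (by decide)]
    rfl
  obtain ⟨hall, hsum⟩ := outs_samples O (B := B) (N := q * M) ((q * M * C : ℕ) : ℝ) hready hB4
    (by omega) e8 htally
  rw [← hU] at hall hsum
  have houts : outs U mainCmd s0 =
      (outs U (rep 70 8 sampleCmd) s1).map (run U decodeCmd) := by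
    rw [mainCmd, outs, outs_eq_run U setupCmd setupCmd_det, ← hs1]
    simp only [List.flatMap_cons, List.flatMap_nil, List.append_nil]
    rw [outs, show outs U decodeCmd = fun s' => [run U decodeCmd s'] from
      funext fun s' => outs_eq_run U decodeCmd decodeCmd_det s']
    exact (List.map_eq_flatMap ..).symm
  rw [houts, List.map_map]
  have hK : (0 : ℝ) < ((q * M * C : ℕ) : ℝ) := by exact_mod_cast (by positivity : 0 < q * M * C)
  -- Markov's inequality, outcome by outcome: the left side is nonpositive when the deviation is at
  -- least `K = qMC`, and otherwise decoding succeeds and the weight is at most `K`.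
  have hterm : ∀ s' ∈ outs U (rep 70 8 sampleCmd) s1,
      s'.psi.normSq * (((q * M * C : ℕ) : ℝ) - deviation O (q * M) (tally s')) ≤
      (((fun s => if IsValidList (GRS q n) ε O s.out then s.psi.normSq else 0) ∘
        run U decodeCmd) s') * ((q * M * C : ℕ) : ℝ) := by
    intro s' hs'
    obtain ⟨hout, hle, hrow⟩ := hall s' hs'
    have hdev0 : 0 ≤ deviation O (q * M) (tally s') :=
      Finset.sum_nonneg fun _ _ => Finset.sum_nonneg fun _ _ => sq_nonneg _
    have hnn := normSq_nonneg s'.psi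
    simp only [Function.comp]
    rw [run_psi U _ decodeCmd_classical]
    by_cases hdev : deviation O (q * M) (tally s') < ((q * M * C : ℕ) : ℝ)
    · rw [if_pos]
      · exact mul_le_mul_of_nonneg_left (by linarith) hnn
      have hv : ∀ x, (rep 70 8 sampleCmd).wv x = false → s'.vars x = s1.vars x := fun x h =>
        outs_vars U _ h s1 s' hs'
      obtain ⟨xs, hxs, hmem⟩ := run_decodeCmd U hn (μ := tally s') (s := s') (B := B)
        (Dm := q * M + 1) (by rw [hv 0 (by decide), e0]) (by rw [hv 1 (by decide), e1])
        (by rw [hv 5 (by decide), e5]) (by rw [hv 6 (by decide), e6])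
        (by rw [hv 10 (by decide), e10]) hB1 hB2 (by omega)
        (fun r _ z _ => (hle r z).trans (Nat.le_succ _)) (fun _ _ => rfl) hout
      have hrow' : ∀ r < q, ∑ z ∈ Finset.range q, tally s' r z ≤ M := fun r hr =>
        (hrow r).trans (rounds_mul hr M).le
      refine ⟨xs, hxs, fun x hx => hmem x ?_ ?_⟩
      -- The number of samples `qM` bounds every agreement, so trying the degrees below `qM + 1`
      -- misses no message.
      · refine Nat.lt_succ_of_le ?_
        calc agreement q n (tally s') x ≤ ∑ _r : ZMod q, M := Finset.sum_le_sum fun r _ =>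
              (Finset.single_le_sum (f := fun z => tally s' r.val z) (fun _ _ => Nat.zero_le _)
                (Finset.mem_range.2 (ZMod.val_lt _))).trans (hrow' _ (ZMod.val_lt r))
          _ = q * M := by simp [ZMod.card]
      · exact agreement_large hl O hn hnq hCpos hM hgap hrow' hdev hx
    · refine (mul_nonpos_of_nonneg_of_nonpos hnn (by linarith)).trans ?_
      refine mul_nonneg ?_ hK.le
      split_ifs
      · exact hnn
      · exact le_rfl
  have htotal := hsum.trans (List.sum_le_sum hterm)
  rw [List.sum_map_mul_right, hpsi, normSq_initState, one_mul] at htotal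
  refine le_of_mul_le_mul_right (le_trans ?_ htotal) hK
  -- The total gives success probability at least `(K - N)/K = 1 - 1/C` with `N = qM` and `K = NC`,
  -- and `1/C ≤ 1 - δ`.
  have h1 : 1 ≤ C * (1 - δ) := by rwa [div_le_iff₀ hδ'] at hC
  have h2 : (0 : ℝ) ≤ ((q * M : ℕ) : ℝ) := by positivity
  rw [Nat.cast_mul (q * M) C]
  generalize ((q * M : ℕ) : ℝ) = N at h2 ⊢
  have h3 := mul_le_mul_of_nonneg_left h1 h2
  rw [mul_one] at h3
  calc δ * (N * C) = N * C - N * (C * (1 - δ)) := by ring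
    _ ≤ N * C - N := sub_le_sub_left h3 _

/-! ### The running time as a polynomial in the parameters -/

theorem aeval_mono (Q : ℕ[X]) {x y : ℝ} (hx : 0 ≤ x) (hxy : x ≤ y) : aeval x Q ≤ aeval y Q := by
  simp only [aeval_eq_sum_range]
  refine Finset.sum_le_sum fun i _ => ?_
  rw [nsmul_eq_mul, nsmul_eq_mul]
  gcongr

/-- The bound for the running time as a polynomial in the parameters. -/
noncomputable def timeBound : MvPolynomial (Fin 4) ℕ :=
  aeval (MvPolynomial.X 0 + MvPolynomial.X 1 + MvPolynomial.X 3 + 11) decoderCost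

theorem aeval_timeBound (v : Fin 4 → ℝ) :
    MvPolynomial.aeval v timeBound = aeval (v 0 + v 1 + v 3 + 11) decoderCost := by
  rw [timeBound, ← Polynomial.aeval_algHom_apply]
  simp

/-- Rounding up adds less than 1, which turns the summand 10 into 11; the cost polynomial has
natural coefficients and is monotone. -/
theorem le_timeBound {n q C : ℕ} {δ : ℝ} (hδ : δ < 1) (hC : C = ⌈1 / (1 - δ)⌉₊) :
    ((decoderCost.eval (n + q + C + 10) : ℕ) : ℝ) ≤
      MvPolynomial.aeval ![(n : ℝ), (q : ℝ), 1 / δ, 1 / (1 - δ)] timeBound := by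
  have hδ' : 0 < 1 - δ := by linarith
  have hC' : (C : ℝ) < 1 / (1 - δ) + 1 := hC ▸ Nat.ceil_lt_add_one (by positivity)
  have h : ((decoderCost.eval (n + q + C + 10) : ℕ) : ℝ) =
      aeval ((n + q + C + 10 : ℕ) : ℝ) decoderCost :=
    (aeval_algebraMap_apply_eq_algebraMap_eval (A := ℝ) (n + q + C + 10) decoderCost).symm
  rw [h, aeval_timeBound]
  refine aeval_mono _ (by positivity) ?_
  push_cast
  rw [one_div] at hC'
  simp
  linarith

end ListDecoder

theorem mainTheorem4 :
    ∃ (A : Program) (P : MvPolynomial (Fin 4) ℕ),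
      ∀ (n q : ℕ) [Fact q.Prime] (ε ε' δ : ℝ),
        ε ∈ Set.Ioo (0 : ℝ) 1 → ε' ∈ Set.Ioo (0 : ℝ) 1 → δ ∈ Set.Ioo (0 : ℝ) 1 →
        2 ≤ n → n ≤ q →
        (n : ℝ) - 2 ≤ q * ε' → q * ε' ≤ (q : ℝ) - 1 →
        ε' + (1 - 1 / (q : ℝ) - ε') * Real.sqrt (((n : ℝ) - 1) / (1 + q * ε')) < ε →
        ε ≤ 1 - 1 / (q : ℝ) →
        IsQuantumListDecoder A (GRS q n) ε δ
          (MvPolynomial.aeval ![(n : ℝ), (q : ℝ), 1 / δ, 1 / (1 - δ)] P) := by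
  refine ⟨ListDecoder.decoder, ListDecoder.timeBound, ?_⟩
  intro n q _ ε ε' δ _ _ hδ hn hnq h1 h2 h3 _ l m hl O
  obtain ⟨L, hL, hmap, htime⟩ := ListDecoder.reaches_decoder
    (O.U : Matrix (Block q l m) (Block q l m) ℂ) (NeZero.pos q) n ⌈1 / ε⌉₊ ⌈1 / δ⌉₊ ⌈1 / (1 - δ)⌉₊
  refine ⟨L, hL, fun p hp => ?_, ?_⟩
  · exact (Nat.cast_le.2 (htime p hp).1).trans (ListDecoder.le_timeBound hδ.2 rfl)
  · have h := ListDecoder.decoder_prob hl O hn hnq (ListDecoder.radius_gap hn hnq h1 h2 h3) hδ.2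
      (Nat.le_ceil _) ⌈1 / ε⌉₊ ⌈1 / δ⌉₊
    rw [← hmap, List.map_map] at h
    exact h
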